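/- Let $\mathsf k$ be a field, $M$ a lattice (a finitely generated free abelian group), $M_{\mathbb R}=M\otimes\mathbb R$, and let $C\subset M_{\mathbb R}$ be a pointed, full-dimensional rational polyhedral cone. Let $R=\mathsf k[C\cap M]$ be the toric algebra, a subalgebra of the Laurent ring $\mathsf k[M]=\mathsf k[x^m\mid m\in M]$, and let $\Sigma_1$ be the set of primitive inward-pointing normals to the facets of $C$, i.e. the primitive vectors of the dual lattice spanning the extremal rays of the dual cone. For $v\in M_{\mathbb R}$ the conic module $A_v$ and the open conic module $\mathring A_v$ are the $M$-graded $R$-submodules of $\mathsf k[M]$ spanned by the monomials $x^m$ with $m\in M\cap(C+v)$, respectively $m\in M\cap(\mathring C+v)$, where $\mathring C$ is the interior of $C$. The chamber of constancy of $v$ is $\Delta=\{w\in M_{\mathbb R}\mid A_w=A_v\}$, and $A_\Delta:=A_v$. With $d_n=\lceil\langle v,n\rangle\rceil$, the open cells of $\Delta$ are the nonempty sets $$\tau_\Omega=\{x\in M_{\mathbb R}\mid d_n-1<\langle x,n\rangle<d_n\ (n\in\Omega),\ \langle x,n\rangle=d_n\ (n\in\Sigma_1\setminus\Omega)\},\qquad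 \Omega\subseteq\Sigma_1,$$ and $\mathring A_\tau:=\mathring A_x$ for $x\in\tau$. Choose an arbitrary orientation of each cell of $\Delta$, and let $K_\Delta^\bullet$ be the sequence of $M$-graded $R$-modules $$\cdots\to K_\Delta^2\to K_\Delta^1\to K_\Delta^0=A_\Delta,\qquad K_\Delta^i=\bigoplus_{\tau\subseteq\Delta,\ \operatorname{codim}\tau=i}\mathring A_\tau,$$ whose differential has as component $\mathring A_{\tau}\to\mathring A_{\tau'}$ ($\operatorname{codim}\tau=i+1$, $\operatorname{codim}\tau'=i$) the inclusion times a sign if $\mathring A_\tau\subseteq\mathring A_{\tau'}$, and $0$ otherwise; the sign is $+1$ if the orientation of $\tau$ agrees with the one induced from $\tau'$ (outward-pointing vector first), and $-1$ otherwise. Let $\mathbb A=\bigoplus_{j} A_{\Delta_j}^{r_j}$ be a finite direct sum with all $r_j\ge1$ such that every conic module is isomorphic, as an $R$-module, to $A_{\Delta_j}$ for exactly one $j$. Regard $\operatorname{Hom}_R(\mathbb A,B)$ as a right $\operatorname{End}_R(\mathbb A)$-module by precomposition, and grade $\mathbb A$, $\operatorname{End}_R(\mathbb A)$ and the modules $\operatorname{Hom}_R(\mathbb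 A,-)$ by $M$ in the natural way. Let $P_\Delta=\operatorname{Hom}_R(\mathbb A,A_\Delta)$ and let $S_\Delta$ be the quotient of $P_\Delta$ by its unique maximal graded submodule. Then, for every chamber of constancy $\Delta$ and every choice of orientations, $K_\Delta^\bullet$ is a complex, $S_\Delta$ is a graded simple module, and $\operatorname{Hom}_R(\mathbb A,K_\Delta^\bullet)$, together with the natural projection $\operatorname{Hom}_R(\mathbb A,K_\Delta^0)=P_\Delta\to S_\Delta$, is an $M$-graded projective resolution of the right $\operatorname{End}_R(\mathbb A)$-module $S_\Delta$. It has finite length, and no projective resolution of $S_\Delta$ over $\operatorname{End}_R(\mathbb A)$, graded or not, is shorter. -/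

import Mathlib

open Module Set

noncomputable section

namespace ConicModules

/-! ### Graded rings and graded modules over an additive commutative group of degrees -/

section Graded

variable {G : Type*} [AddCommGroup G]

open Classical in
/-- The subgroups `𝒳 g` form a grading of `X`: `X` is their internal direct sum. -/
def IsGrading {X : Type*} [AddCommGroup X] (𝒳 : G → AddSubgroup X) : Prop :=
  DirectSum.IsInternal 𝒳

/-- `𝒜` makes `Λ` a `G`-graded ring. -/
structure IsRingGrading {Λ : Type*} [Ring Λ] (𝒜 : G → AddSubgroup Λ) : Prop where
  isGrading : IsGrading 𝒜
  one_mem : (1 : Λ) ∈ 𝒜 0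
  mul_mem : ∀ {g h : G} {a b : Λ}, a ∈ 𝒜 g → b ∈ 𝒜 h → a * b ∈ 𝒜 (g + h)

/-- `𝒳` makes `X` a `G`-graded module over the graded ring `(Λ, 𝒜)`. -/
structure IsModuleGrading {Λ : Type*} [Ring Λ] (𝒜 : G → AddSubgroup Λ)
    {X : Type*} [AddCommGroup X] [Module Λ X] (𝒳 : G → AddSubgroup X) : Prop where
  isGrading : IsGrading 𝒳
  smul_mem : ∀ {g h : G} {a : Λ} {x : X}, a ∈ 𝒜 g → x ∈ 𝒳 h → a • x ∈ 𝒳 (g + h)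

/-- A graded submodule: a submodule generated by homogeneous elements. -/
def IsGradedSubmodule {Λ : Type*} [Ring Λ] {X : Type*} [AddCommGroup X] [Module Λ X]
    (𝒳 : G → AddSubgroup X) (N : Submodule Λ X) : Prop :=
  Submodule.span Λ {x : X | x ∈ N ∧ ∃ g, x ∈ 𝒳 g} = N

/-- A nonzero module whose only graded submodules are zero and the whole module. -/
def IsGradedSimple (Λ : Type*) [Ring Λ] {X : Type*} [AddCommGroup X] [Module Λ X]
    (𝒳 : G → AddSubgroup X) : Prop :=
  Nontrivial X ∧ ∀ N : Submodule Λ X, IsGradedSubmodule 𝒳 N → N = ⊥ ∨ N = ⊤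

/-- The sum of all proper graded submodules. If there is a unique maximal (proper) graded
submodule, this is that submodule. -/
def gradedRadical (Λ : Type*) [Ring Λ] {X : Type*} [AddCommGroup X] [Module Λ X]
    (𝒳 : G → AddSubgroup X) : Submodule Λ X :=
  sSup {N : Submodule Λ X | IsGradedSubmodule 𝒳 N ∧ N ≠ ⊤}

/-- The grading induced on a quotient: images of the homogeneous pieces. -/
def quotientGrading {Λ : Type*} [Ring Λ] {X : Type*} [AddCommGroup X] [Module Λ X]
    (𝒳 : G → AddSubgroup X) (N : Submodule Λ X) : G → AddSubgroup (X ⧸ N) :=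
  fun g => (𝒳 g).map N.mkQ.toAddMonoidHom

/-- The componentwise grading of a product (for finite families, the direct sum). -/
def piGrading {ι : Type*} {X : ι → Type*} [∀ i, AddCommGroup (X i)]
    (𝒳 : ∀ i, G → AddSubgroup (X i)) : G → AddSubgroup (∀ i, X i) :=
  fun g => AddSubgroup.pi Set.univ (fun i => 𝒳 i g)

/-- The homomorphisms that raise degrees by `g`. -/
def homGrading {R : Type*} [CommRing R] {X Y : Type*} [AddCommGroup X] [AddCommGroup Y]
    [Module R X] [Module R Y] (𝒳 : G → AddSubgroup X) (𝒴 : G → AddSubgroup Y) :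
    G → AddSubgroup (X →ₗ[R] Y) := fun g =>
  { carrier := {φ | ∀ h, ∀ x ∈ 𝒳 h, φ x ∈ 𝒴 (h + g)}
    zero_mem' := fun h x _ => by simp
    add_mem' := fun ha hb h x hx => by
      simpa using (𝒴 _).add_mem (ha h x hx) (hb h x hx)
    neg_mem' := fun ha h x hx => by
      simpa using (𝒴 _).neg_mem (ha h x hx) }

/-- A projective resolution `⋯ → P 1 → P 0 → S → 0` of `S` over `Λ`. -/
structure IsProjectiveResolution (Λ : Type*) [Ring Λ]
    {P : ℕ → Type*} [∀ i, AddCommGroup (P i)] [∀ i, Module Λ (P i)]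
    (d : ∀ i, P (i + 1) →ₗ[Λ] P i)
    {S : Type*} [AddCommGroup S] [Module Λ S] (ε : P 0 →ₗ[Λ] S) : Prop where
  projective : ∀ i, Module.Projective Λ (P i)
  surjective : Function.Surjective ε
  exact_zero : Function.Exact (d 0) ε
  exact_succ : ∀ i, Function.Exact (d (i + 1)) (d i)

/-- A graded projective resolution: moreover ring and modules are graded, and all maps are
homogeneous of degree zero. -/
structure IsGradedProjectiveResolution {Λ : Type*} [Ring Λ] (𝒜 : G → AddSubgroup Λ)
    {P : ℕ → Type*} [∀ i, AddCommGroup (P i)] [∀ i, Module Λ (P i)]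
    (𝒬 : ∀ i, G → AddSubgroup (P i))
    (d : ∀ i, P (i + 1) →ₗ[Λ] P i)
    {S : Type*} [AddCommGroup S] [Module Λ S] (𝒮 : G → AddSubgroup S)
    (ε : P 0 →ₗ[Λ] S) : Prop where
  isResolution : IsProjectiveResolution Λ d ε
  ring_graded : IsRingGrading 𝒜
  module_graded : ∀ i, IsModuleGrading 𝒜 (𝒬 i)
  target_graded : IsModuleGrading 𝒜 𝒮
  map_mem : ∀ i g, ∀ x ∈ 𝒬 (i + 1) g, d i x ∈ 𝒬 i g
  augmentation_mem : ∀ g, ∀ x ∈ 𝒬 0 g, ε x ∈ 𝒮 g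

/-- The terms of degree larger than `n` vanish. -/
def LengthLE (P : ℕ → Type*) (n : ℕ) : Prop := ∀ i, n < i → Subsingleton (P i)

end Graded

/-! ### The functor `Hom_R(A, -)` to right `End_R(A)`-modules

A right `End_R(A)`-module is a module over the opposite ring `(Module.End R A)ᵐᵒᵖ`, which acts on
`A →ₗ[R] B` by precomposition. -/

section Hom

variable {R : Type*} [CommRing R]

/-- The opposite of the ring `End_R(A)`. -/
abbrev EndOp (R : Type*) [CommRing R] (A : Type*) [AddCommGroup A] [Module R A] : Type _ :=
  (Module.End R A)ᵐᵒᵖ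

instance homModule (A : Type*) [AddCommGroup A] [Module R A] (B : Type*) [AddCommGroup B]
    [Module R B] : Module (EndOp R A) (A →ₗ[R] B) where
  smul a φ := φ ∘ₗ a.unop
  one_smul _ := rfl
  mul_smul _ _ _ := rfl
  smul_zero _ := rfl
  smul_add _ _ _ := rfl
  add_smul _ _ φ := LinearMap.comp_add _ _ φ
  zero_smul φ := LinearMap.comp_zero φ

/-- `Hom_R(A, f)`, i.e. composition with `f`. -/
def homMap (A : Type*) [AddCommGroup A] [Module R A] {X Y : Type*} [AddCommGroup X]
    [AddCommGroup Y] [Module R X] [Module R Y] (f : X →ₗ[R] Y) :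
    (A →ₗ[R] X) →ₗ[EndOp R A] (A →ₗ[R] Y) where
  toFun φ := f ∘ₗ φ
  map_add' φ ψ := LinearMap.comp_add φ ψ f
  map_smul' a φ := by
    ext x
    rfl

/-- The grading of the opposite of `End_R(A)` by degrees of endomorphisms. -/
def endGrading {G : Type*} [AddCommGroup G] {A : Type*} [AddCommGroup A] [Module R A]
    (𝒜 : G → AddSubgroup A) : G → AddSubgroup (EndOp R A) := fun g =>
  { carrier := {a | a.unop ∈ homGrading (R := R) 𝒜 𝒜 g}
    zero_mem' := (homGrading (R := R) 𝒜 𝒜 g).zero_mem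
    add_mem' := fun ha hb => (homGrading (R := R) 𝒜 𝒜 g).add_mem ha hb
    neg_mem' := fun ha => (homGrading (R := R) 𝒜 𝒜 g).neg_mem ha }

end Hom

/-! ### Cones and toric algebras

`M` is a lattice in the finite dimensional real vector space `E`, so that `E = M ⊗ ℝ`. -/

variable {E : Type*} [NormedAddCommGroup E] [NormedSpace ℝ E]

/-- A pointed full-dimensional rational polyhedral cone in `E`. -/
structure ToricCone (M : Submodule ℤ E) where
  /-- the underlying cone -/
  cone : PointedCone ℝ E
  rational : ∃ S : Finset E, (S : Set E) ⊆ (M : Set E) ∧ cone = PointedCone.hull ℝ (S : Set E)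
  fullDimensional : Submodule.span ℝ (cone : Set E) = ⊤
  pointed : ∀ x, x ∈ cone → -x ∈ cone → x = 0

section Normals

variable {M : Submodule ℤ E} (C : ToricCone M)

/-- The linear functional `n` belongs to the dual lattice `N`. -/
def IsIntegral (M : Submodule ℤ E) (n : Dual ℝ E) : Prop := ∀ m ∈ M, ∃ z : ℤ, n m = z

/-- The dual cone `σ`. -/
def ToricCone.dualCone : Set (Dual ℝ E) := {n | ∀ x ∈ C.cone, 0 ≤ n x}

/-- The set `Σ₁` of primitive inward-pointing normals to the facets of the cone: the primitive
vectors of the dual lattice that span an extremal ray of the dual cone. -/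
def ToricCone.normals : Set (Dual ℝ E) :=
  {n | n ∈ C.dualCone ∧ n ≠ 0 ∧
    (∀ a ∈ C.dualCone, ∀ b ∈ C.dualCone, a + b = n → ∃ c : ℝ, 0 ≤ c ∧ a = c • n) ∧
    IsIntegral M n ∧ ∀ ε : ℝ, 0 < ε → ε < 1 → ¬ IsIntegral M (ε • n)}

theorem ToricCone.finite_normals : C.normals.Finite := by
  classical
  obtain ⟨S, hSM, hS⟩ := C.rational
  have hdual : ∀ n : Dual ℝ E, (∀ s ∈ S, 0 ≤ n s) → n ∈ C.dualCone := by
    intro n hn x hx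
    rw [hS] at hx
    induction hx using Submodule.span_induction with
    | mem x hx => exact hn x hx
    | zero => simp
    | add x y _ _ hx hy => simpa using add_nonneg hx hy
    | smul a x _ hx =>
      have : n (a • x) = (a : ℝ) * n x := by
        exact n.map_smul (a : ℝ) x
      rw [this]
      exact mul_nonneg a.2 hx
  have hmem : ∀ s ∈ S, s ∈ C.cone := by
    intro s hs
    rw [hS]
    exact Submodule.subset_span hs
  refine Set.Finite.of_finite_image (f := fun n : Dual ℝ E => S.filter fun s => n s = 0)
    ((S.powerset : Finset (Finset E)).finite_toSet.subset ?_) ?_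
  · rintro _ ⟨n, _, rfl⟩
    exact Finset.mem_coe.2 (Finset.mem_powerset.2 (Finset.filter_subset _ _))
  · intro n hn n' hn' h
    have hz : ∀ s ∈ S, (n s = 0 ↔ n' s = 0) := by
      intro s hs
      have := congrArg (fun T : Finset E => s ∈ T) h
      simpa [hs] using this
    obtain ⟨hnσ, hn0, hext, hint, hprim⟩ := hn
    obtain ⟨hnσ', hn0', hext', hint', hprim'⟩ := hn'
    -- a small multiple of `n'` can be subtracted from `n` inside the dual cone
    have key : ∃ ε : ℝ, 0 < ε ∧ ∀ s ∈ S, ε * n' s ≤ n s := by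
      have : ∀ T : Finset E, T ⊆ S → ∃ ε : ℝ, 0 < ε ∧ ∀ s ∈ T, ε * n' s ≤ n s := by
        intro T
        induction T using Finset.induction_on with
        | empty => intro _; exact ⟨1, one_pos, by simp⟩
        | insert a T _ ih =>
          intro hT
          obtain ⟨ε, hε, h1⟩ := ih fun x hx => hT (Finset.mem_insert_of_mem hx)
          have haS : a ∈ S := hT (Finset.mem_insert_self _ _)
          have hna : 0 ≤ n a := hnσ a (hmem a haS)
          have hna' : 0 ≤ n' a := hnσ' a (hmem a haS)
          by_cases ha : n' a = 0
          · refine ⟨ε, hε, fun s hs => ?_⟩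
            rcases Finset.mem_insert.1 hs with rfl | hs
            · simpa [ha] using hna
            · exact h1 s hs
          · have hpos' : 0 < n' a := lt_of_le_of_ne hna' (Ne.symm ha)
            have hpos : 0 < n a :=
              lt_of_le_of_ne hna (Ne.symm fun h0 => ha ((hz a haS).1 h0))
            refine ⟨min ε (n a / n' a), lt_min hε (div_pos hpos hpos'), fun s hs => ?_⟩
            rcases Finset.mem_insert.1 hs with rfl | hs
            · calc min ε (n s / n' s) * n' s ≤ n s / n' s * n' s :=
                    mul_le_mul_of_nonneg_right (min_le_right _ _) hna'
                _ = n s := div_mul_cancel₀ _ ha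
            · have hs' : 0 ≤ n' s :=
                hnσ' s (hmem s (hT (Finset.mem_insert_of_mem hs)))
              exact (mul_le_mul_of_nonneg_right (min_le_left _ _) hs').trans (h1 s hs)
      exact this S subset_rfl
    obtain ⟨ε, hε, hle⟩ := key
    have h1 : ε • n' ∈ C.dualCone := by
      intro x hx
      simpa using mul_nonneg hε.le (hnσ' x hx)
    have h2 : n - ε • n' ∈ C.dualCone := by
      apply hdual
      intro s hs
      simpa using hle s hs
    obtain ⟨c, hc, hcn⟩ := hext _ h1 _ h2 (by abel)
    have hn'c : n' = (c / ε) • n := by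
      have : n' = ε⁻¹ • (ε • n') := by rw [smul_smul, inv_mul_cancel₀ hε.ne', one_smul]
      rw [this, hcn, smul_smul, div_eq_inv_mul]
    have hr0 : c / ε ≠ 0 := by
      intro h0
      rw [h0, zero_smul] at hn'c
      exact hn0' hn'c
    have hrpos : 0 < c / ε := lt_of_le_of_ne (div_nonneg hc hε.le) (Ne.symm hr0)
    rcases lt_trichotomy (c / ε) 1 with hlt | heq | hgt
    · exact absurd (hn'c ▸ hint') (hprim _ hrpos hlt)
    · rw [hn'c, heq, one_smul]
    · have hnn : n = (c / ε)⁻¹ • n' := by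
        rw [hn'c, smul_smul, inv_mul_cancel₀ hr0, one_smul]
      refine absurd ?_ (hprim' (c / ε)⁻¹ (inv_pos.2 hrpos) (inv_lt_one_of_one_lt₀ hgt))
      rw [← hnn]
      exact hint

/-- The chamber of constancy containing `v`: all `w` for which `C + v` and `C + w` contain the same
lattice points, that is, for which the conic modules of `v` and `w` coincide. -/
def ToricCone.chamber (v : E) : Set E :=
  {w | ∀ m ∈ M, m - w ∈ C.cone ↔ m - v ∈ C.cone}

/-- The cell of the chamber of `v` given by a set `Ω` of normals (possibly empty). -/
def ToricCone.openCell (v : E) (Ω : Set (Dual ℝ E)) : Set E :=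
  {x | ∀ n ∈ C.normals,
    (n ∈ Ω → (⌈n v⌉ : ℝ) - 1 < n x ∧ n x < (⌈n v⌉ : ℝ)) ∧ (n ∉ Ω → n x = (⌈n v⌉ : ℝ))}

/-- The open cells of the chamber of `v`. -/
def ToricCone.cells (v : E) : Set (Set E) :=
  {τ | τ.Nonempty ∧ τ ⊆ C.chamber v ∧ ∃ Ω ⊆ C.normals, τ = C.openCell v Ω}

theorem ToricCone.finite_cells (v : E) : (C.cells v).Finite := by
  refine (C.finite_normals.finite_subsets.image (C.openCell v)).subset ?_
  rintro τ ⟨_, _, Ω, hΩ, rfl⟩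
  exact ⟨Ω, hΩ, rfl⟩

/-- The open cells of codimension `i` of the chamber of `v`. -/
def Cell (v : E) (i : ℕ) : Type _ :=
  {τ : Set E // τ ∈ C.cells v ∧ finrank ℝ (vectorSpan ℝ τ) + i = finrank ℝ E}

instance (v : E) (i : ℕ) : Finite (Cell C v i) :=
  ((C.finite_cells v).subset fun _ h => h.1 :
    {τ : Set E | τ ∈ C.cells v ∧ finrank ℝ (vectorSpan ℝ τ) + i = finrank ℝ E}.Finite)

instance (v : E) (i : ℕ) : Fintype (Cell C v i) := Fintype.ofFinite _

variable {C} in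
/-- A point of a cell. -/
def Cell.point {v : E} {i : ℕ} (τ : Cell C v i) : E := τ.2.1.1.some

variable {C} in
theorem Cell.point_mem_chamber {v : E} {i : ℕ} (τ : Cell C v i) : τ.point ∈ C.chamber v :=
  τ.2.1.2.1 τ.2.1.1.some_mem

end Normals

/-! ### Orientations of cells -/

/-- An orientation of a cell, that is, of the vector space parallel to its affine span. -/
abbrev CellOrientation (τ : Set E) : Type _ :=
  Orientation ℝ (vectorSpan ℝ τ) (Fin (finrank ℝ (vectorSpan ℝ τ)))

/-- For a boundary component `τ` of codimension one of the cell `τ'`, the orientation `o` of `τ`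
agrees with the one induced by the orientation `o'` of `τ'`, by the rule that an outward pointing
vector comes first: contracting a volume form of `o'` with an outward pointing vector `u` and
restricting to `τ` gives a volume form of `o`. -/
def AgreesWithInduced (τ' τ : Set E) (o' : CellOrientation τ') (o : CellOrientation τ) : Prop :=
  ∃ (hle : vectorSpan ℝ τ ≤ vectorSpan ℝ τ')
    (hdim : finrank ℝ (vectorSpan ℝ τ) + 1 = finrank ℝ (vectorSpan ℝ τ'))
    (ω' : vectorSpan ℝ τ' [⋀^Fin (finrank ℝ (vectorSpan ℝ τ'))]→ₗ[ℝ] ℝ) (hω' : ω' ≠ 0)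
    (ω : vectorSpan ℝ τ [⋀^Fin (finrank ℝ (vectorSpan ℝ τ))]→ₗ[ℝ] ℝ) (hω : ω ≠ 0)
    (u : vectorSpan ℝ τ'),
    rayOfNeZero ℝ ω' hω' = o' ∧ rayOfNeZero ℝ ω hω = o ∧
    (∃ x ∈ τ, ∃ x' ∈ τ', (u : E) = x - x') ∧
    ∀ b : Fin (finrank ℝ (vectorSpan ℝ τ)) → vectorSpan ℝ τ,
      ω b = ω' fun j =>
        (Fin.cons u (fun i => Submodule.inclusion hle (b i)) :
          Fin (finrank ℝ (vectorSpan ℝ τ) + 1) → vectorSpan ℝ τ') (Fin.cast hdim.symm j)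

open Classical in
/-- The sign comparing the orientation of `τ` with the one induced from `τ'`. -/
def incidenceSign (τ' τ : Set E) (o' : CellOrientation τ') (o : CellOrientation τ) : ℤ :=
  if AgreesWithInduced τ' τ o' o then 1 else -1

/-! ### Toric algebras and conic modules -/

section Conic

variable {M : Submodule ℤ E} (k : Type*) [Field k] (C : ToricCone M)

/-- The toric algebra `R = k[C ∩ M]` inside the Laurent ring `k[M]`. -/
def toricAlgebra : Subalgebra k (AddMonoidAlgebra k M) where
  carrier := {f | ∀ m : M, f.coeff m ≠ 0 → (m : E) ∈ C.cone}
  add_mem' := by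
    intro f g hf hg m hm
    by_cases h : f.coeff m = 0
    · exact hg m (by simpa [h] using hm)
    · exact hf m h
  mul_mem' := by
    classical
    intro f g hf hg m hm
    have := AddMonoidAlgebra.support_coeff_mul_subset f g (Finsupp.mem_support_iff.2 hm)
    obtain ⟨a, ha, b, hb, rfl⟩ := Finset.mem_add.1 this
    exact C.cone.add_mem (hf a (Finsupp.mem_support_iff.1 ha)) (hg b (Finsupp.mem_support_iff.1 hb))
  algebraMap_mem' := by
    classical
    intro c m hm
    have h0 : m = 0 := by
      by_contra h
      apply hm
      simp [Ne.symm h]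
    simp [h0]

/-- The toric algebra as a ring in its own right. -/
def ToricRing : Type _ := toricAlgebra k C

instance : CommRing (ToricRing k C) := inferInstanceAs (CommRing (toricAlgebra k C))

instance : Algebra k (ToricRing k C) := inferInstanceAs (Algebra k (toricAlgebra k C))

/-- The toric algebra acts on the Laurent ring by multiplication. -/
instance : Algebra (ToricRing k C) (AddMonoidAlgebra k M) :=
  inferInstanceAs (Algebra (toricAlgebra k C) (AddMonoidAlgebra k M))

/-- The conic module `A_v`: the span of the monomials with exponent in `C + v`. -/
def conic (v : E) : Submodule (ToricRing k C) (AddMonoidAlgebra k M) where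
  carrier := {f | ∀ m : M, f.coeff m ≠ 0 → (m : E) - v ∈ C.cone}
  zero_mem' := by simp
  add_mem' := by
    intro f g hf hg m hm
    by_cases h : f.coeff m = 0
    · exact hg m (by simpa [h] using hm)
    · exact hf m h
  smul_mem' := by
    classical
    intro r f hf m hm
    have := AddMonoidAlgebra.support_coeff_mul_subset r.1 f (Finsupp.mem_support_iff.2 hm)
    obtain ⟨a, ha, b, hb, rfl⟩ := Finset.mem_add.1 this
    have := C.cone.add_mem (r.2 a (Finsupp.mem_support_iff.1 ha))
      (hf b (Finsupp.mem_support_iff.1 hb))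
    simpa [add_sub_assoc] using this

theorem add_mem_interior {x y : E} (hx : x ∈ C.cone) (hy : y ∈ interior (C.cone : Set E)) :
    x + y ∈ interior (C.cone : Set E) := by
  have hopen : IsOpen ((fun z => x + z) '' interior (C.cone : Set E)) :=
    (Homeomorph.addLeft x).isOpenMap _ isOpen_interior
  refine interior_maximal ?_ hopen ⟨y, hy, rfl⟩
  rintro _ ⟨z, hz, rfl⟩
  exact C.cone.add_mem hx (interior_subset hz)

/-- The open conic module: the span of the monomials with exponent in the interior of `C + v`. -/
def openConic (v : E) : Submodule (ToricRing k C) (AddMonoidAlgebra k M) where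
  carrier := {f | ∀ m : M, f.coeff m ≠ 0 → (m : E) - v ∈ interior (C.cone : Set E)}
  zero_mem' := by simp
  add_mem' := by
    intro f g hf hg m hm
    by_cases h : f.coeff m = 0
    · exact hg m (by simpa [h] using hm)
    · exact hf m h
  smul_mem' := by
    classical
    intro r f hf m hm
    have := AddMonoidAlgebra.support_coeff_mul_subset r.1 f (Finsupp.mem_support_iff.2 hm)
    obtain ⟨a, ha, b, hb, rfl⟩ := Finset.mem_add.1 this
    have := add_mem_interior C (r.2 a (Finsupp.mem_support_iff.1 ha))
      (hf b (Finsupp.mem_support_iff.1 hb))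
    simpa [add_sub_assoc] using this

theorem mem_chamber_iff (v w : E) : w ∈ C.chamber v ↔ conic k C w = conic k C v := by
  classical
  constructor
  · intro h
    ext f
    exact forall_congr' fun m => imp_congr_right fun _ => h m m.2
  · intro h m hm
    have := SetLike.ext_iff.1 h (AddMonoidAlgebra.single ⟨m, hm⟩ 1)
    have key : ∀ u : E, AddMonoidAlgebra.single (⟨m, hm⟩ : M) (1 : k) ∈ conic k C u ↔
        m - u ∈ C.cone := by
      intro u
      constructor
      · intro hu
        exact hu ⟨m, hm⟩ (by simp)
      · intro hu m' hm'
        have : m' = ⟨m, hm⟩ := by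
          by_contra hne
          apply hm'
          simp [Ne.symm hne]
        rw [this]
        exact hu
    rw [key, key] at this
    exact this

theorem openConic_le_conic {v w : E} (hw : w ∈ C.chamber v) : openConic k C w ≤ conic k C v :=
  fun _ hf m hm => (hw m m.2).1 (interior_subset (hf m hm))

variable {k C} in
/-- A submodule of the Laurent ring, as an `R`-module in its own right. -/
def Mod (B : Submodule (ToricRing k C) (AddMonoidAlgebra k M)) : Type _ := B

instance (B : Submodule (ToricRing k C) (AddMonoidAlgebra k M)) : AddCommGroup (Mod B) :=
  inferInstanceAs (AddCommGroup B)

instance (B : Submodule (ToricRing k C) (AddMonoidAlgebra k M)) : Module (ToricRing k C) (Mod B) :=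
  inferInstanceAs (Module (ToricRing k C) B)

variable {k C} in
/-- The embedding of a submodule into the Laurent ring. -/
def Mod.val {B : Submodule (ToricRing k C) (AddMonoidAlgebra k M)} :
    Mod B →ₗ[ToricRing k C] AddMonoidAlgebra k M := B.subtype

variable {k C} in
/-- The inclusion of a submodule of the Laurent ring into a larger one. -/
def Mod.inclusion {B B' : Submodule (ToricRing k C) (AddMonoidAlgebra k M)} (h : B ≤ B') :
    Mod B →ₗ[ToricRing k C] Mod B' := Submodule.inclusion h

variable {k C} in
/-- The `M`-grading of a submodule of the Laurent ring: scalar multiples of `x^m`. -/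
def monomialGrading (B : Submodule (ToricRing k C) (AddMonoidAlgebra k M)) :
    M → AddSubgroup (Mod B) := fun m =>
  { carrier := {f | ∀ m' : M, (Mod.val f).coeff m' ≠ 0 → m' = m}
    zero_mem' := by simp
    add_mem' := by
      intro f g hf hg m' hm'
      by_cases h : (Mod.val f).coeff m' = 0
      · exact hg m' (by simpa [h] using hm')
      · exact hf m' h
    neg_mem' := by
      intro f hf m' hm'
      exact hf m' (by simpa using hm') }

/-! ### The complex of a chamber -/

/-- The open conic module of a cell. -/
abbrev cellModule {v : E} {i : ℕ} (τ : Cell C v i) :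
    Submodule (ToricRing k C) (AddMonoidAlgebra k M) :=
  openConic k C τ.point

/-- The `i`-th term of the complex of the chamber of `v`: the (finite) direct sum of the open conic
modules of the cells of codimension `i`. -/
abbrev K (v : E) (i : ℕ) : Type _ := (τ : Cell C v i) → Mod (cellModule k C τ)

/-- The `M`-grading of the terms of the complex. -/
def KGrading (v : E) (i : ℕ) : M → AddSubgroup (K k C v i) :=
  piGrading fun τ => monomialGrading (cellModule k C τ)

open Classical in
/-- The differential: the component from `τ` to `τ'` is the signed inclusion of the open conic
modules if there is an inclusion, and zero otherwise. -/
def Kd {v : E} (o : ∀ (i : ℕ) (τ : Cell C v i), CellOrientation τ.1) (i : ℕ) :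
    K k C v (i + 1) →ₗ[ToricRing k C] K k C v i :=
  LinearMap.pi fun τ' => ∑ τ : Cell C v (i + 1),
    (if h : cellModule k C τ ≤ cellModule k C τ' then
      incidenceSign τ'.1 τ.1 (o i τ') (o (i + 1) τ) • Mod.inclusion h
    else 0) ∘ₗ LinearMap.proj τ

/-- The identification of the term in degree zero with `A_v`, as a map (there is just one cell of
codimension zero). -/
def KzeroTo (v : E) : K k C v 0 →ₗ[ToricRing k C] Mod (conic k C v) :=
  ∑ τ : Cell C v 0,
    Mod.inclusion (openConic_le_conic k C τ.point_mem_chamber) ∘ₗ LinearMap.proj τ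

/-! ### Complete sums of conic modules and the simple modules over their endomorphism rings -/

variable {ι : Type*} (c : ι → E) (r : ι → ℕ)

/-- The multiplicities `r i` are positive, and every conic module is isomorphic to `A_{c i}` for a
unique index `i`. -/
structure IsCompleteSum : Prop where
  mult_pos : ∀ i, 0 < r i
  existsUnique : ∀ w : E, ∃! i, Nonempty (Mod (conic k C w) ≃ₗ[ToricRing k C] Mod (conic k C (c i)))

/-- The direct sum of `r i` copies of `A_{c i}`, over all indices `i` (of a finite type). -/
abbrev ConicSum : Type _ := (s : Σ i, Fin (r i)) → Mod (conic k C (c s.1))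

/-- The `M`-grading of the direct sum. -/
def conicSumGrading : M → AddSubgroup (ConicSum k C c r) :=
  piGrading fun s => monomialGrading (conic k C (c s.1))

/-- The opposite of the endomorphism ring of the direct sum. -/
abbrev EndRing : Type _ := EndOp (ToricRing k C) (ConicSum k C c r)

/-- The right module `P_v = Hom_R(𝔸, A_v)`. -/
abbrev ProjMod (v : E) : Type _ := ConicSum k C c r →ₗ[ToricRing k C] Mod (conic k C v)

/-- The `M`-grading of `P_v`. -/
def projGrading (v : E) : M → AddSubgroup (ProjMod k C c r v) :=
  homGrading (conicSumGrading k C c r) (monomialGrading (conic k C v))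

/-- The unique maximal graded submodule of `P_v`. -/
def projRadical (v : E) : Submodule (EndRing k C c r) (ProjMod k C c r v) :=
  gradedRadical (EndRing k C c r) (projGrading k C c r v)

/-- The graded simple module `S_v`, the quotient of `P_v` by its maximal graded submodule. -/
abbrev SimpleMod (v : E) : Type _ := ProjMod k C c r v ⧸ projRadical k C c r v

/-- The `M`-grading of `S_v`. -/
def simpleGrading (v : E) : M → AddSubgroup (SimpleMod k C c r v) :=
  quotientGrading (projGrading k C c r v) (projRadical k C c r v)

/-- The terms of `Hom_R(𝔸, K)`. -/
abbrev HomK (v : E) (i : ℕ) : Type _ := ConicSum k C c r →ₗ[ToricRing k C] K k C v i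

/-- The `M`-grading of the terms of `Hom_R(𝔸, K)`. -/
def homKGrading (v : E) (i : ℕ) : M → AddSubgroup (HomK k C c r v i) :=
  homGrading (conicSumGrading k C c r) (KGrading k C v i)

/-- The differential of `Hom_R(𝔸, K)`. -/
def homKd {v : E} (o : ∀ (i : ℕ) (τ : Cell C v i), CellOrientation τ.1) (i : ℕ) :
    HomK k C c r v (i + 1) →ₗ[EndRing k C c r] HomK k C c r v i :=
  homMap (ConicSum k C c r) (Kd k C o i)

/-- The natural projection `Hom_R(𝔸, K⁰) = P_v → S_v`. -/
def homKaug (v : E) : HomK k C c r v 0 →ₗ[EndRing k C c r] SimpleMod k C c r v :=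
  (projRadical k C c r v).mkQ ∘ₗ homMap (ConicSum k C c r) (KzeroTo k C v)

end Conic

end ConicModules

end

open ConicModules

universe u v w x

noncomputable section

namespace ConicModules

section

variable {E : Type*} [NormedAddCommGroup E] [NormedSpace ℝ E]

/-! ### Finitely generated pointed cones are closed -/

/-! A homomorphism between monomial modules is multiplication by a Laurent polynomial
(`val_eq_symbol_mul`), so `Hom(𝔸, K)` splits into complexes of vector spaces, one for each summand
`A_c` of `𝔸` and each exponent `m`. Put `y = m + c` and let `d n = ⌈n p⌉` be the levels of the
chamber. A cell contributes a line to this complex exactly when the level of its open conic module,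
`d n + 1` on the walls containing the cell and `d n` elsewhere, is at most `⌈n y⌉` for all normals
`n`.

There are three cases. If `⌈n y⌉ < d n` for some `n`, every term vanishes. If `⌈n y⌉ = d n` for all
`n`, only the open cell survives, and `x^m` is an isomorphism from `A_c` to `A_Δ`; the coefficients
in these degrees make up the simple module. Otherwise the complex has to be exact
(`exists_Kcoeff_preimage`).

For exactness the walls are extended to a hyperplane arrangement in the open convex set where `n > d
n - 1` for all `n`. A differential from cells to larger cells computes cohomology with compact
support. On an open convex piece this is a line in top degree, detected by a signed count of open
cells (`hasAugmentation_stratum`, by induction over the hyperplanes). The contributing cells are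
what is left of such a piece after removing what lies beyond at least one of several hyperplanes. A
point just below `y` lies beyond all of these at once, so they can be removed one after another, and
nothing is left of the cohomology (`acyclic_visible`). That the differential squares to zero is the
usual fact that between cells of dimension differing by two there are exactly two cells, with
opposite signs (`sum_inc_mul_inc`).

The terms are projective because an open conic module is a conic module for a nearby point, hence a
direct summand of `𝔸`. The maximal graded submodule consists of the homomorphisms without
isomorphisms among their monomials (`projRadical_eq`).

The resolution is minimal: its differential is built from strict inclusions of conic modules, so it
is annihilated by `Hom(-, S_v)` for every graded simple `S_v` (`comp_homKd_eq_zero`). Comparison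
with any other projective resolution, graded or not, shows that the latter is at least as long
(`eq_zero_of_lengthLE`). -/

theorem mem_hull_finset {S : Finset E} {x : E} :
    x ∈ PointedCone.hull ℝ (S : Set E) ↔ ∃ a : E → ℝ, (∀ s, 0 ≤ a s) ∧ ∑ s ∈ S, a s • s = x := by
  constructor
  · intro hx
    obtain ⟨f, -, hf⟩ := Submodule.mem_span_finset.1 hx
    exact ⟨fun s => (f s : ℝ), fun s => (f s).2, hf⟩
  · rintro ⟨a, ha, rfl⟩
    exact Submodule.sum_mem _ fun s hs =>
      PointedCone.smul_mem _ (ha s)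
        (Submodule.subset_span hs)

/-- Pointedness keeps 0 out of the convex hull of the nonzero generators, so some functional `φ` is
positive on all of them. On a slice `φ < c` the coefficients of nonnegative combinations are then
bounded, and the slice lies in the image of a compact box. -/
theorem isClosed_hull_finset [FiniteDimensional ℝ E] (S : Finset E)
    (hp : ∀ x, x ∈ PointedCone.hull ℝ (S : Set E) → -x ∈ PointedCone.hull ℝ (S : Set E) → x = 0) :
    IsClosed (PointedCone.hull ℝ (S : Set E) : Set E) := by
  classical
  set S' := S.filter (· ≠ 0) with hS'
  have h0 : (0 : E) ∉ convexHull ℝ (S' : Set E) := by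
    intro h
    obtain ⟨w, hw, hw1, hw0⟩ := Finset.mem_convexHull'.1 h
    obtain ⟨s, hs, hws⟩ : ∃ s ∈ S', w s ≠ 0 := by
      by_contra! hcon
      rw [Finset.sum_eq_zero hcon] at hw1
      exact zero_ne_one hw1
    have hsS : s ∈ S := (Finset.mem_filter.1 hs).1
    -- One term of the vanishing combination is the negative of the sum of the others, so it and its
    -- negative both lie in the cone.
    have key : w s • s = 0 := by
      refine hp _ (mem_hull_finset.2 ⟨fun t => if t = s then w s else 0, ?_, ?_⟩)
        (mem_hull_finset.2 ⟨fun t => if t ∈ S' ∧ t ≠ s then w t else 0, ?_, ?_⟩)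
      · intro t; dsimp; split_ifs; exacts [hw s hs, le_rfl]
      · simp [ite_smul, Finset.sum_ite_eq', hsS]
      · intro t; dsimp; split_ifs with ht; exacts [hw t ht.1, le_rfl]
      · rw [eq_neg_iff_add_eq_zero, ← hw0, ← Finset.sum_erase_add _ _ hs]
        congr 1
        simp only [ite_smul, zero_smul]
        rw [← Finset.sum_filter]
        refine Finset.sum_congr ?_ fun _ _ => rfl
        ext t
        simp only [Finset.mem_filter, Finset.mem_erase, hS']
        tauto
    rcases smul_eq_zero.1 key with h | h
    · exact hws h
    · exact (Finset.mem_filter.1 hs).2 h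
  obtain ⟨φ, u, hφ0, hφ⟩ := geometric_hahn_banach_point_closed (convex_convexHull ℝ _)
    (S'.finite_toSet.isCompact_convexHull (𝕜 := ℝ)).isClosed h0
  have hpos : ∀ s ∈ S', 0 < φ s := fun s hs => by
    have := hφ s (subset_convexHull ℝ _ hs)
    rw [map_zero] at hφ0
    linarith
  refine isClosed_of_closure_subset fun x hx => ?_
  -- Any bound above `φ x` would do: points of the cone near `x` satisfy it, and it caps the
  -- coefficient of `s` by `c / φ s`.
  set c := φ x + 1
  have hcpt : IsCompact ((fun a : E → ℝ => ∑ s ∈ S', a s • s) ''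
      (Set.univ.pi fun s => Set.Icc 0 (if s ∈ S' then c / φ s else 0))) := by
    refine (isCompact_univ_pi fun s => isCompact_Icc).image ?_
    fun_prop
  have hopen : IsOpen {y : E | φ y < c} := isOpen_lt φ.continuous continuous_const
  have hx' : x ∈ closure ({y : E | φ y < c} ∩ (PointedCone.hull ℝ (S : Set E) : Set E)) :=
    hopen.inter_closure ⟨by simp [c], hx⟩
  have hsub : {y : E | φ y < c} ∩ (PointedCone.hull ℝ (S : Set E) : Set E) ⊆
      ((fun a : E → ℝ => ∑ s ∈ S', a s • s) '' (Set.univ.pi fun s => Set.Icc 0 (if s ∈ S' then c / φ s else 0))) := by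
    rintro y ⟨hyc, hy⟩
    obtain ⟨a, ha, hay⟩ := mem_hull_finset.1 hy
    have hsum : ∑ s ∈ S', a s • s = y := by
      rw [← hay, hS', Finset.sum_filter]
      refine Finset.sum_congr rfl fun s _ => ?_
      split_ifs with h
      · rfl
      · simp [not_not.1 h]
    refine ⟨fun s => if s ∈ S' then a s else 0, ?_, ?_⟩
    · intro s _
      dsimp only
      split_ifs with hs
      · refine ⟨ha s, (le_div_iff₀ (hpos s hs)).2 ?_⟩
        have h1 : φ y = ∑ t ∈ S', a t * φ t := by simp [← hsum, map_sum]
        have h2 : a s * φ s ≤ ∑ t ∈ S', a t * φ t :=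
          Finset.single_le_sum (f := fun t => a t * φ t)
            (fun t ht => mul_nonneg (ha t) (hpos t ht).le) hs
        have h3 : φ y < c := hyc
        linarith
      · exact ⟨le_rfl, le_rfl⟩
    · rw [← hsum]
      exact Finset.sum_congr rfl fun s hs => by simp [hs]
  obtain ⟨a, ha, rfl⟩ := closure_minimal hsub hcpt.isClosed hx'
  exact Submodule.sum_mem _ fun s hs =>
    PointedCone.smul_mem _ (ha s trivial).1 (Submodule.subset_span (Finset.mem_filter.1 hs).1)

/-! ### Facet description of a rational cone by its primitive normals -/

namespace ToricCone

variable {M : Submodule ℤ E} (C : ToricCone M)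

theorem isClosed_cone [FiniteDimensional ℝ E] : IsClosed (C.cone : Set E) := by
  obtain ⟨S, -, hS⟩ := C.rational
  have hp := C.pointed
  rw [hS] at hp ⊢
  exact isClosed_hull_finset S hp

theorem exists_dual_neg [FiniteDimensional ℝ E] {x : E} (hx : x ∉ C.cone) :
    ∃ n ∈ C.dualCone, n x < 0 := by
  obtain ⟨f, hf, hfx⟩ :=
    ProperCone.hyperplane_separation_point (⟨C.cone, C.isClosed_cone⟩ : ProperCone ℝ E) hx
  exact ⟨f.toLinearMap, hf, hfx⟩

theorem mem_dualCone_iff {S : Finset E} (hS : C.cone = PointedCone.hull ℝ (S : Set E))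
    {n : Dual ℝ E} : n ∈ C.dualCone ↔ ∀ s ∈ S, 0 ≤ n s := by
  refine ⟨fun h s hs => h s (hS ▸ Submodule.subset_span hs), fun h x hx => ?_⟩
  rw [hS] at hx
  obtain ⟨a, ha, rfl⟩ := mem_hull_finset.1 hx
  simp only [map_sum, map_smul, smul_eq_mul]
  exact Finset.sum_nonneg fun s hs => mul_nonneg (ha s) (h s hs)

theorem eq_zero_of_generators {S : Finset E} (hS : C.cone = PointedCone.hull ℝ (S : Set E))
    {n : Dual ℝ E} (h : ∀ s ∈ S, n s = 0) : n = 0 := by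
  have h1 : Submodule.span ℝ (C.cone : Set E) ≤ LinearMap.ker n := by
    refine Submodule.span_le.2 fun x hx => ?_
    rw [SetLike.mem_coe, hS] at hx
    obtain ⟨a, -, rfl⟩ := mem_hull_finset.1 hx
    simp only [SetLike.mem_coe, LinearMap.mem_ker, map_sum, map_smul, smul_eq_mul]
    exact Finset.sum_eq_zero fun s hs => by rw [h s hs, mul_zero]
  rw [C.fullDimensional, top_le_iff, LinearMap.ker_eq_top] at h1
  exact h1

/-- A separating functional whose vanishing set is as large as possible spans the annihilator
of that set. -/
theorem exists_separating_extremal [FiniteDimensional ℝ E] {S : Finset E}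
    (hS : C.cone = PointedCone.hull ℝ (S : Set E)) {x : E} (hx : x ∉ C.cone) :
    ∃ n ∈ C.dualCone, n x < 0 ∧
      ∀ n' : Dual ℝ E, (∀ s ∈ S, n s = 0 → n' s = 0) → ∃ c : ℝ, n' = c • n := by
  classical
  -- A largest vanishing set is obtained by minimising the number of generators on which the
  -- functional is nonzero.
  obtain ⟨n, ⟨hn, hnx⟩, hmax⟩ := WellFounded.has_min
    (measure fun n : Dual ℝ E => (S.filter fun s => n s ≠ 0).card).wf
    {n | n ∈ C.dualCone ∧ n x < 0} (by obtain ⟨n, h⟩ := C.exists_dual_neg hx; exact ⟨n, h⟩)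
  refine ⟨n, hn, hnx, fun n₁ hn₁ => ?_⟩
  by_contra hne
  -- Subtracting a multiple of `n` makes the value at `x` vanish, so that adding multiples of the
  -- result to `n` does not disturb separation.
  have hn₂ : ∃ n₂ : Dual ℝ E, n₂ x = 0 ∧ (∀ s ∈ S, n s = 0 → n₂ s = 0) ∧ n₂ ≠ 0 := by
    refine ⟨n₁ - (n₁ x / n x) • n, ?_, fun s hs h => by simp [hn₁ s hs h, h], fun h => ?_⟩
    · simp [div_mul_cancel₀ _ hnx.ne]
    · exact hne ⟨_, sub_eq_zero.1 h⟩
  have hn₃ : ∃ n₂ : Dual ℝ E, n₂ x = 0 ∧ (∀ s ∈ S, n s = 0 → n₂ s = 0) ∧ ∃ s ∈ S, n₂ s < 0 := by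
    obtain ⟨n₂, h1, h2, h3⟩ := hn₂
    obtain ⟨s, hs, hs0⟩ : ∃ s ∈ S, n₂ s ≠ 0 := by
      by_contra! hcon
      exact h3 (C.eq_zero_of_generators hS hcon)
    rcases lt_or_gt_of_ne hs0 with h | h
    · exact ⟨n₂, h1, h2, s, hs, h⟩
    · exact ⟨-n₂, by simp [h1], fun t ht h' => by simp [h2 t ht h'], s, hs, by simpa using h⟩
  obtain ⟨n₂, h1, h2, h3⟩ := hn₃
  -- Ratio test: `t` is the largest multiple of `n₂` that can be added before a generator becomes
  -- negative. At `s₀` a new zero appears, against the choice of `n`.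
  obtain ⟨s₀, hs₀, hmin⟩ := (S.filter fun s => n₂ s < 0).exists_min_image
    (fun s => n s / (-n₂ s)) (by obtain ⟨s, hs, h⟩ := h3; exact ⟨s, Finset.mem_filter.2 ⟨hs, h⟩⟩)
  obtain ⟨hs₀S, hs₀n⟩ := Finset.mem_filter.1 hs₀
  have hnS := (C.mem_dualCone_iff hS).1 hn
  set t := n s₀ / (-n₂ s₀) with ht
  have ht0 : 0 ≤ t := div_nonneg (hnS s₀ hs₀S) (by linarith)
  refine hmax (n + t • n₂) ⟨(C.mem_dualCone_iff hS).2 fun s hs => ?_, by simp [h1, hnx]⟩ ?_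
  · simp only [LinearMap.add_apply, LinearMap.smul_apply, smul_eq_mul]
    rcases le_or_gt 0 (n₂ s) with h | h
    · exact add_nonneg (hnS s hs) (mul_nonneg ht0 h)
    · have := (le_div_iff₀ (by linarith)).1 (hmin s (Finset.mem_filter.2 ⟨hs, h⟩))
      linarith
  · refine Finset.card_lt_card (Finset.ssubset_iff_subset_ne.2 ⟨fun s hs => ?_, fun h => ?_⟩)
    · simp only [Finset.mem_filter] at hs ⊢
      refine ⟨hs.1, fun h => hs.2 ?_⟩
      simp [h, h2 s hs.1 h]
    · have hs₀' : s₀ ∈ S.filter fun s => n s ≠ 0 :=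
        Finset.mem_filter.2 ⟨hs₀S, fun h' => hs₀n.ne (h2 s₀ hs₀S h')⟩
      rw [← h, Finset.mem_filter] at hs₀'
      apply hs₀'.2
      simp only [LinearMap.add_apply, LinearMap.smul_apply, smul_eq_mul, ht]
      rw [div_neg, neg_mul, div_mul_cancel₀ _ hs₀n.ne, add_neg_cancel]

/-- If lattice vectors do not span the space, some nonzero integral functional kills them. -/
theorem exists_integral_annihilator [FiniteDimensional ℝ E] (M : Submodule ℤ E)
    [DiscreteTopology M] [IsZLattice ℝ M] {Z : Set E} (hZ : Z ⊆ (M : Set E))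
    (hspan : Submodule.span ℝ Z ≠ ⊤) :
    ∃ n : Dual ℝ E, n ≠ 0 ∧ IsIntegral M n ∧ ∀ z ∈ Z, n z = 0 := by
  classical
  have : Module.Finite ℤ M := ZLattice.module_finite ℝ M
  have : Module.Free ℤ M := ZLattice.module_free ℝ M
  let b₀ := Module.Free.chooseBasis ℤ M
  let b := b₀.ofZLatticeBasis ℝ M
  -- Two extensions, starting from the empty family: inside `Z` to a basis `B₀` of its span, then by
  -- lattice basis vectors to a basis `B` of `E`. The proper span leaves some `e` in `B` outside
  -- `B₀`.
  have hb₀ : LinearIndepOn ℝ id (∅ : Set E) := linearIndepOn_empty _ _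
  have hB₀ := hb₀.linearIndepOn_extend (Set.empty_subset Z)
  have hB₀Z := hb₀.extend_subset (Set.empty_subset Z)
  have hZB₀ := hb₀.subset_span_extend (Set.empty_subset Z)
  set B₀ := hb₀.extend (Set.empty_subset Z)
  have hsub : B₀ ⊆ Z ∪ Set.range b := hB₀Z.trans Set.subset_union_left
  have hB := hB₀.linearIndepOn_extend hsub
  have hBZ := hB₀.extend_subset hsub
  have hZB := hB₀.subset_span_extend hsub
  have hB₀B := hB₀.subset_extend hsub
  set B := hB₀.extend hsub
  have htop : ⊤ ≤ Submodule.span ℝ (Set.range ((↑) : B → E)) := by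
    rw [Subtype.range_coe, ← b.span_eq]
    exact Submodule.span_le.2 (Set.subset_union_right.trans hZB)
  let β : Basis B ℝ E := Basis.mk hB htop
  obtain ⟨e, he, heB₀⟩ : ∃ e ∈ B, e ∉ B₀ := by
    by_contra! hcon
    apply hspan
    rw [← top_le_iff]
    calc ⊤ ≤ Submodule.span ℝ B := by simpa using htop
      _ ≤ Submodule.span ℝ Z := Submodule.span_mono ((show B ⊆ B₀ from hcon).trans hB₀Z)
  let eqv := b.indexEquiv β
  let v : Module.Free.ChooseBasisIndex ℤ M → E := fun i => β (eqv i)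
  let i₀ := eqv.symm ⟨e, he⟩
  have hvM : ∀ i, v i ∈ M := fun i => by
    have h1 : v i = (eqv i : E) := by simp [v, β]
    rw [h1]
    rcases hBZ (eqv i).2 with h | ⟨j, h⟩
    · exact hZ h
    · rw [← h, Basis.ofZLatticeBasis_apply]; exact (b₀ j).2
  -- As in Cramer's rule, the argument takes the place of `e` in the determinant of `B`. All other
  -- columns are lattice vectors, so values on `M` are integers; an argument from `B₀` repeats a
  -- column.
  refine ⟨b.det.toMultilinearMap.toLinearMap v i₀, fun h => ?_, fun m hm => ?_, fun z hz => ?_⟩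
  · have h1 := LinearMap.congr_fun h (v i₀)
    have h2 : b.det v ≠ 0 := by
      have : v = β.reindex eqv.symm := by ext i; simp [v]
      rw [this]
      exact (b.isUnit_det _).ne_zero
    apply h2
    simpa [MultilinearMap.toLinearMap] using h1
  · have hw : ∀ j, Function.update v i₀ m j ∈ M := fun j => by
      by_cases hj : j = i₀
      · subst hj; simpa using hm
      · simpa [hj] using hvM j
    refine ⟨(Matrix.of fun i j => b₀.repr ⟨_, hw j⟩ i).det, ?_⟩
    have h1 : b.toMatrix (Function.update v i₀ m) =
        (Matrix.of fun i j => b₀.repr ⟨_, hw j⟩ i).map (Int.castRingHom ℝ) := by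
      ext i j
      simpa [Basis.toMatrix_apply] using b₀.ofZLatticeBasis_repr_apply ℝ M ⟨_, hw j⟩ i
    change b.det (Function.update v i₀ m) = _
    rw [Basis.det_apply, h1, ← RingHom.mapMatrix_apply, ← RingHom.map_det]
    rfl
  · refine (Submodule.span_le (p := LinearMap.ker _)).2 (fun x hx => ?_) (hZB₀ hz)
    have hne : eqv.symm ⟨x, hB₀B hx⟩ ≠ i₀ := fun h => by
      have := eqv.symm.injective h
      simp only [Subtype.mk.injEq] at this
      exact heB₀ (this ▸ hx)
    change b.det (Function.update v i₀ x) = 0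
    refine b.det.map_eq_zero_of_eq _ (i := i₀) (j := eqv.symm ⟨x, hB₀B hx⟩) ?_ hne.symm
    simp [hne, v, β]

/-- A separating functional of maximal vanishing is extremal in the dual cone; it remains to rescale
it to a primitive integral one. -/
theorem exists_normal_neg [FiniteDimensional ℝ E] [DiscreteTopology M] [IsZLattice ℝ M] {x : E}
    (hx : x ∉ C.cone) : ∃ n ∈ C.normals, n x < 0 := by
  classical
  obtain ⟨S, hSM, hS⟩ := C.rational
  obtain ⟨n, hn, hnx, hext⟩ := C.exists_separating_extremal hS hx
  have hn0 : n ≠ 0 := fun h => by simp [h] at hnx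
  have hnS := (C.mem_dualCone_iff hS).1 hn
  obtain ⟨s₀, hs₀, hns₀⟩ : ∃ s ∈ S, 0 < n s := by
    by_contra! hcon
    exact hn0 (C.eq_zero_of_generators hS fun s hs => le_antisymm (hcon s hs) (hnS s hs))
  -- The generators killed by `n` do not span, as `n ≠ 0`, so a nonzero integral functional vanishes
  -- on them. By extremality it is a multiple of `n`.
  have hpos : ∃ c : ℝ, 0 < c ∧ IsIntegral M (c • n) := by
    obtain ⟨n₀, h1, h2, h3⟩ := exists_integral_annihilator M (Z := {s | s ∈ S ∧ n s = 0})
      (fun s hs => hSM hs.1) (fun htop => hn0 (LinearMap.ker_eq_top.1 (top_le_iff.1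
        (htop ▸ Submodule.span_le.2 fun s hs => hs.2))))
    obtain ⟨c, rfl⟩ := hext n₀ fun s hs h => h3 s ⟨hs, h⟩
    rcases lt_trichotomy c 0 with hc | rfl | hc
    · refine ⟨-c, by linarith, fun m hm => ?_⟩
      obtain ⟨z, hz⟩ := h2 m hm
      exact ⟨-z, by rw [Int.cast_neg, ← hz]; simp⟩
    · simp at h1
    · exact ⟨c, hc, h2⟩
  obtain ⟨c₁, hc₁, hint₁⟩ := hpos
  have hnat : ∀ c : ℝ, 0 < c → IsIntegral M (c • n) → ∃ j : ℕ, c * n s₀ = j := by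
    intro c hc hint
    obtain ⟨z, hz⟩ := hint s₀ (hSM hs₀)
    have hz0 : (0 : ℝ) ≤ z := hz ▸ by simpa using mul_nonneg hc.le hns₀.le
    refine ⟨z.toNat, ?_⟩
    have : ((z.toNat : ℤ) : ℝ) = z := by rw [Int.toNat_of_nonneg (by exact_mod_cast hz0)]
    rw [← Int.cast_natCast, this]
    simpa using hz
  -- Primitivity: positive integral multiples of `n` take natural values at the generator `s₀`, and
  -- the multiple with the least value there is chosen.
  obtain ⟨j, ⟨c, hc, hint, hcj⟩, hmin⟩ := WellFounded.has_min (wellFounded_lt (α := ℕ))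
    {j | ∃ c : ℝ, 0 < c ∧ IsIntegral M (c • n) ∧ c * n s₀ = j}
    (by obtain ⟨j, hj⟩ := hnat c₁ hc₁ hint₁; exact ⟨j, c₁, hc₁, hint₁, hj⟩)
  refine ⟨c • n, ⟨fun y hy => ?_, smul_ne_zero hc.ne' hn0, fun a ha b hb hab => ?_, hint,
    fun ε hε hε1 hεint => ?_⟩, ?_⟩
  · simpa using mul_nonneg hc.le (hn y hy)
  · have ha' := (C.mem_dualCone_iff hS).1 ha
    have hb' := (C.mem_dualCone_iff hS).1 hb
    obtain ⟨t, rfl⟩ := hext a fun s hs h => by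
      have h1 := LinearMap.congr_fun hab s
      simp only [LinearMap.add_apply, LinearMap.smul_apply, h, smul_zero] at h1
      linarith [ha' s hs, hb' s hs]
    have ht : 0 ≤ t := by
      have := ha' s₀ hs₀
      simp only [LinearMap.smul_apply, smul_eq_mul] at this
      exact nonneg_of_mul_nonneg_left this hns₀
    exact ⟨t / c, div_nonneg ht hc.le, by rw [smul_smul, div_mul_cancel₀ _ hc.ne']⟩
  · rw [smul_smul] at hεint
    obtain ⟨i, hi⟩ := hnat _ (mul_pos hε hc) hεint
    refine hmin i ⟨_, mul_pos hε hc, hεint, hi⟩ ?_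
    have : (i : ℝ) < j := by
      rw [← hi, ← hcj, mul_assoc]
      exact mul_lt_of_lt_one_left (mul_pos hc hns₀) hε1
    exact_mod_cast this
  · simpa using mul_neg_of_pos_of_neg hc hnx

theorem mem_cone_iff [FiniteDimensional ℝ E] [DiscreteTopology M] [IsZLattice ℝ M] {x : E} :
    x ∈ C.cone ↔ ∀ n ∈ C.normals, 0 ≤ n x := by
  refine ⟨fun hx n hn => hn.1 x hx, fun h => ?_⟩
  by_contra hx
  obtain ⟨n, hn, hnx⟩ := C.exists_normal_neg hx
  exact absurd (h n hn) (not_le.2 hnx)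

/-- From an interior point one can move a little against a nonzero functional, so it cannot vanish
there; conversely finitely many strict inequalities cut out an open subset of the cone. -/
theorem mem_interior_iff [FiniteDimensional ℝ E] [DiscreteTopology M] [IsZLattice ℝ M] {x : E} :
    x ∈ interior (C.cone : Set E) ↔ ∀ n ∈ C.normals, 0 < n x := by
  constructor
  · intro hx n hn
    obtain ⟨w, hw⟩ : ∃ w, 0 < n w := by
      by_contra! hcon
      refine hn.2.1 (LinearMap.ext fun w => le_antisymm (hcon w) ?_)
      simpa using hcon (-w)
    have hlim : Filter.Tendsto (fun t : ℝ => x - t • w) (nhdsWithin 0 (Set.Ioi 0)) (nhds x) := by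
      have : Continuous fun t : ℝ => x - t • w := by fun_prop
      simpa using this.continuousWithinAt (s := Set.Ioi 0) (x := 0) |>.tendsto
    obtain ⟨t, ht, ht0⟩ := ((hlim.eventually (isOpen_interior.mem_nhds hx)).and
      self_mem_nhdsWithin).exists
    have h1 := hn.1 _ (interior_subset ht)
    simp only [map_sub, map_smul, smul_eq_mul] at h1
    have h2 : 0 < t * n w := mul_pos ht0 hw
    linarith
  · intro h
    refine mem_interior.2 ⟨⋂ n ∈ C.normals, {y | 0 < n y}, fun y hy => ?_, ?_, ?_⟩
    · simp only [Set.mem_iInter, Set.mem_ofPred_eq] at hy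
      exact C.mem_cone_iff.2 fun n hn => (hy n hn).le
    · exact C.finite_normals.isOpen_biInter fun n _ =>
        isOpen_lt continuous_const n.continuous_of_finiteDimensional
    · simpa using h

/-- A normal is determined by its zeros among the generators. -/
theorem normals_ext {S : Finset E} (hS : C.cone = PointedCone.hull ℝ (S : Set E))
    {n n' : Dual ℝ E} (hn : n ∈ C.normals) (hn' : n' ∈ C.normals)
    (h : ∀ s ∈ S, n s = 0 → n' s = 0) : n' = n := by
  classical
  have hnS := (C.mem_dualCone_iff hS).1 hn.1
  have hnS' := (C.mem_dualCone_iff hS).1 hn'.1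
  obtain ⟨ε, hε, hle⟩ : ∃ ε : ℝ, 0 < ε ∧ ∀ s ∈ S, ε * n' s ≤ n s := by
    have hev : ∀ᶠ ε : ℝ in nhdsWithin 0 (Set.Ioi 0), ∀ s ∈ S, ε * n' s ≤ n s := by
      rw [Filter.eventually_all_finset]
      intro s hs
      rcases (hnS s hs).eq_or_lt with h0 | h0
      · simp [h s hs h0.symm, ← h0]
      · have hlim : Filter.Tendsto (fun t : ℝ => t * n' s) (nhdsWithin 0 (Set.Ioi 0))
            (nhds 0) := by
          have : Continuous fun t : ℝ => t * n' s := by fun_prop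
          simpa using this.continuousWithinAt (s := Set.Ioi 0) (x := 0) |>.tendsto
        filter_upwards [hlim.eventually (gt_mem_nhds h0)] with t ht using ht.le
    obtain ⟨ε, h1, h2⟩ := (hev.and self_mem_nhdsWithin).exists
    exact ⟨ε, h2, h1⟩
  obtain ⟨c, hc, hcn⟩ := hn.2.2.1 (ε • n')
    ((C.mem_dualCone_iff hS).2 fun s hs => by simpa using mul_nonneg hε.le (hnS' s hs))
    (n - ε • n') ((C.mem_dualCone_iff hS).2 fun s hs => by simpa using hle s hs) (by abel)
  have hn'c : n' = (c / ε) • n := by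
    rw [div_eq_inv_mul, ← smul_smul, ← hcn, smul_smul, inv_mul_cancel₀ hε.ne', one_smul]
  have hr0 : c / ε ≠ 0 := fun h0 => hn'.2.1 (by rw [hn'c, h0, zero_smul])
  have hrpos : 0 < c / ε := lt_of_le_of_ne (div_nonneg hc hε.le) (Ne.symm hr0)
  rcases lt_trichotomy (c / ε) 1 with hlt | heq | hgt
  · exact absurd (hn'c ▸ hn'.2.2.2.1) (hn.2.2.2.2 _ hrpos hlt)
  · rw [hn'c, heq, one_smul]
  · have hnn : n = (c / ε)⁻¹ • n' := by
      rw [hn'c, smul_smul, inv_mul_cancel₀ hr0, one_smul]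
    exact absurd (hnn ▸ hn.2.2.2.1)
      (hn'.2.2.2.2 (c / ε)⁻¹ (inv_pos.2 hrpos) (inv_lt_one_of_one_lt₀ hgt))

/-- The sum of the generators on the facet of `n` works: another normal vanishing at it would vanish
on all of them and coincide with `n` by `normals_ext`. -/
theorem exists_facet_point {n : Dual ℝ E} (hn : n ∈ C.normals) :
    ∃ f ∈ M, n f = 0 ∧ ∀ n' ∈ C.normals, n' ≠ n → 0 < n' f := by
  classical
  obtain ⟨S, hSM, hS⟩ := C.rational
  refine ⟨∑ s ∈ S with n s = 0, s, Submodule.sum_mem _ fun s hs =>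
    hSM (Finset.mem_filter.1 hs).1, ?_, fun n' hn' hne => ?_⟩
  · rw [map_sum]
    exact Finset.sum_eq_zero fun s hs => (Finset.mem_filter.1 hs).2
  · rw [map_sum]
    have hnS' := (C.mem_dualCone_iff hS).1 hn'.1
    refine Finset.sum_pos' (fun s hs => hnS' s (Finset.mem_filter.1 hs).1) ?_
    by_contra! hcon
    refine hne (C.normals_ext hS hn hn' fun s hs h => ?_)
    exact le_antisymm (hcon s (Finset.mem_filter.2 ⟨hs, h⟩)) (hnS' s hs)

theorem exists_interior_point :
    ∃ u ∈ M, ∀ n ∈ C.normals, 0 < n u := by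
  classical
  obtain ⟨S, hSM, hS⟩ := C.rational
  refine ⟨∑ s ∈ S, s, Submodule.sum_mem _ fun s hs => hSM hs, fun n hn => ?_⟩
  rw [map_sum]
  have hnS := (C.mem_dualCone_iff hS).1 hn.1
  refine Finset.sum_pos' hnS ?_
  by_contra! hcon
  exact hn.2.1 (C.eq_zero_of_generators hS fun s hs => le_antisymm (hcon s hs) (hnS s hs))

/-- A primitive normal takes the value one on the lattice. -/
theorem exists_apply_eq_one {n : Dual ℝ E} (hn : n ∈ C.normals) : ∃ m ∈ M, n m = 1 := by
  obtain ⟨u, huM, hu⟩ := C.exists_interior_point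
  let H : AddSubgroup ℤ :=
    { carrier := {z | ∃ m ∈ M, n m = z}
      zero_mem' := ⟨0, M.zero_mem, by simp⟩
      add_mem' := by
        rintro a b ⟨m, hm, h⟩ ⟨m', hm', h'⟩
        exact ⟨m + m', M.add_mem hm hm', by simp [h, h']⟩
      neg_mem' := by
        rintro a ⟨m, hm, h⟩
        exact ⟨-m, M.neg_mem hm, by simp [h]⟩ }
  -- The values of `n` on `M` form `gℤ`. If `|g|` were not 1, division by it would contradict
  -- primitivity.
  obtain ⟨g, hg⟩ := Int.subgroup_cyclic H
  have hmem : ∀ z, z ∈ H ↔ g ∣ z := fun z => by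
    rw [hg, AddSubgroup.mem_closure_singleton]
    simp only [smul_eq_mul, dvd_def, eq_comm, mul_comm]
  have hg0 : g ≠ 0 := by
    rintro rfl
    obtain ⟨z, hz⟩ := hn.2.2.2.1 u huM
    have : z = 0 := by simpa using (hmem z).1 ⟨u, huM, hz⟩
    have := hu n hn
    rw [hz, ‹z = 0›] at this
    simp at this
  by_cases h1 : |g| = 1
  · obtain ⟨m, hm, h⟩ := (hmem 1).2 ((abs_dvd g 1).1 (by rw [h1]))
    exact ⟨m, hm, by simpa using h⟩
  · have h2 : (1 : ℝ) < |g| := by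
      have := abs_pos.2 hg0
      exact_mod_cast (show (1 : ℤ) < |g| by omega)
    rw [Int.cast_abs] at h2
    refine absurd ?_ (hn.2.2.2.2 |(g : ℝ)|⁻¹ (inv_pos.2 (by linarith))
      (inv_lt_one_of_one_lt₀ h2))
    intro m hm
    obtain ⟨z, hz⟩ := hn.2.2.2.1 m hm
    obtain ⟨y, rfl⟩ := (abs_dvd g z).2 ((hmem z).1 ⟨m, hm, hz⟩)
    refine ⟨y, ?_⟩
    have : |(g : ℝ)| ≠ 0 := by linarith
    simp only [LinearMap.smul_apply, hz, smul_eq_mul]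
    push_cast
    field_simp

/-- There are lattice points on which one normal takes a given integral value while the others are
large. -/
theorem exists_lattice_point {n : Dual ℝ E} (hn : n ∈ C.normals) (z : ℤ) (q : Dual ℝ E → ℝ) :
    ∃ m ∈ M, n m = z ∧ ∀ n' ∈ C.normals, n' ≠ n → q n' ≤ n' m := by
  obtain ⟨m₁, hm₁, h₁⟩ := C.exists_apply_eq_one hn
  obtain ⟨f, hf, hf0, hfpos⟩ := C.exists_facet_point hn
  -- Adding multiples of the facet point `f` leaves `n` unchanged and drives all other normals to
  -- infinity.
  have hev : ∀ᶠ j : ℕ in Filter.atTop, ∀ n' ∈ C.normals, n' ≠ n →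
      q n' ≤ n' ((z : ℤ) • m₁ + (j : ℕ) • f) := by
    rw [C.finite_normals.eventually_all]
    intro n' hn'
    by_cases hne : n' = n
    · exact Filter.Eventually.of_forall fun j h => absurd hne h
    · have hlim : Filter.Tendsto (fun j : ℕ => n' (z • m₁) + (j : ℝ) * n' f) Filter.atTop
          Filter.atTop :=
        Filter.tendsto_atTop_add_const_left _ _
          (tendsto_natCast_atTop_atTop.atTop_mul_const (hfpos n' hn' hne))
      filter_upwards [hlim.eventually_ge_atTop (q n')] with j hj _
      simpa using hj
  obtain ⟨j, hj⟩ := hev.exists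
  refine ⟨z • m₁ + j • f, M.add_mem (M.smul_mem z hm₁) (M.nsmul_mem hf j), ?_, hj⟩
  simp [h₁, hf0]

end ToricCone

end

section

/-! ### Complexes spanned by finitely many cells

The cells form a finite type `X`, the incidence numbers are `e x' x`; the chain complex of a
subset is `k`-valued functions with support in it. -/

section Incidence

variable {X : Type*} [Fintype X] (e : X → X → ℤ) (k : Type*) [Field k]

/-- The differential with incidence numbers `e`. -/
def bd : (X → k) →ₗ[k] (X → k) where
  toFun f x' := ∑ x, (e x' x : k) * f x
  map_add' f g := by ext; simp [mul_add, Finset.sum_add_distrib]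
  map_smul' c f := by ext; simp [Finset.mul_sum, mul_left_comm]

theorem bd_apply (f : X → k) (x' : X) : bd e k f x' = ∑ x, (e x' x : k) * f x := rfl

/-- Consecutive incidences between members of `S` pass through `S`. -/
def IncidenceConvex (S : Set X) : Prop :=
  ∀ x ∈ S, ∀ x'' ∈ S, ∀ x', e x'' x' ≠ 0 → e x' x ≠ 0 → x' ∈ S

/-- The complex of `S` is exact. -/
def Acyclic (S : Set X) : Prop :=
  ∀ f : X → k, (∀ x ∉ S, f x = 0) → (∀ x ∈ S, bd e k f x = 0) →
    ∃ g : X → k, (∀ x ∉ S, g x = 0) ∧ ∀ x ∈ S, bd e k g x = f x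

/-- The homology of the complex of `S` is one-dimensional, detected by `a`. -/
def HasAugmentation (a : X → ℤ) (S : Set X) : Prop :=
  (∀ f : X → k, (∀ x ∉ S, f x = 0) → (∀ x ∈ S, bd e k f x = 0) → ∑ x, (a x : k) * f x = 0 →
    ∃ g : X → k, (∀ x ∉ S, g x = 0) ∧ ∀ x ∈ S, bd e k g x = f x) ∧
  ∃ z : X → k, (∀ x ∉ S, z x = 0) ∧ (∀ x ∈ S, bd e k z x = 0) ∧ ∑ x, (a x : k) * z x = 1

/-- `a` is supported on `S` and vanishes on boundaries. -/
def IsCocycleOn (a : X → ℤ) (S : Set X) : Prop :=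
  (∀ x ∉ S, a x = 0) ∧ ∀ x ∈ S, ∑ x', a x' * e x' x = 0

variable {e k}

theorem sum_mul_bd (a : X → ℤ) (f : X → k) :
    ∑ x', (a x' : k) * bd e k f x' = ∑ x, ((∑ x', a x' * e x' x : ℤ) : k) * f x := by
  simp only [bd_apply, Finset.mul_sum, Int.cast_sum, Int.cast_mul, Finset.sum_mul, mul_assoc]
  exact Finset.sum_comm

theorem IsCocycleOn.sum_bd {a : X → ℤ} {S : Set X} (ha : IsCocycleOn e a S) {f : X → k}
    (hf : ∀ x ∉ S, f x = 0) : ∑ x', (a x' : k) * bd e k f x' = 0 := by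
  rw [sum_mul_bd]
  refine Finset.sum_eq_zero fun x _ => ?_
  by_cases hx : x ∈ S
  · rw [ha.2 x hx, Int.cast_zero, zero_mul]
  · rw [hf x hx, mul_zero]

theorem bd_eq_zero_of_incidence {f : X → k} {x' : X} (h : ∀ x, f x ≠ 0 → e x' x = 0) :
    bd e k f x' = 0 := by
  rw [bd_apply]
  refine Finset.sum_eq_zero fun x _ => ?_
  by_cases hx : f x = 0
  · rw [hx, mul_zero]
  · rw [h x hx, Int.cast_zero, zero_mul]

theorem bd_congr {f g : X → k} {x' : X} (h : ∀ x, e x' x ≠ 0 → f x = g x) :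
    bd e k f x' = bd e k g x' := by
  simp only [bd_apply]
  refine Finset.sum_congr rfl fun x _ => ?_
  by_cases hx : e x' x = 0
  · simp [hx]
  · rw [h x hx]

/-- Cutting the differential down to `S` loses only paths through cells outside `S`, and convexity
says that no such path starts and ends in `S`. -/
theorem bd_bd_restrict (he : ∀ x'' x, ∑ x', e x'' x' * e x' x = 0) {S : Set X}
    (hS : IncidenceConvex e S) {f h : X → k} (hf : ∀ x ∉ S, f x = 0)
    (hh : ∀ x ∈ S, h x = bd e k f x) (hh0 : ∀ x ∉ S, h x = 0) {x'' : X} (hx'' : x'' ∈ S) :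
    bd e k h x'' = 0 := by
  have h1 : bd e k (bd e k f) x'' = 0 := by
    rw [bd_apply e k (bd e k f), sum_mul_bd]
    simp [he]
  rw [← h1]
  simp only [bd_apply e k _ x'']
  refine Finset.sum_congr rfl fun x' _ => ?_
  by_cases h2 : e x'' x' = 0
  · simp [h2]
  by_cases hx' : x' ∈ S
  · rw [hh x' hx']
  · rw [hh0 x' hx', bd_eq_zero_of_incidence]
    intro x hx
    by_contra h3
    exact hx' (hS x (by_contra fun hn => hx (hf x hn)) x'' hx'' x' h2 h3)

/-- Boundaries of `A` avoid `B`, so `A` is a subcomplex of `S` with quotient `B`; this is the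
two-out-of-three property of a short exact sequence of complexes. -/
theorem Acyclic.of_sdiff (he : ∀ x'' x, ∑ x', e x'' x' * e x' x = 0) {A B S : Set X}
    (hAB : S = A ∪ B) (hdisj : Disjoint A B) (hS : IncidenceConvex e S)
    (hopen : ∀ x ∈ A, ∀ x' ∈ B, e x' x = 0) (h1 : Acyclic e k S) (h2 : Acyclic e k A) :
    Acyclic e k B := by
  classical
  intro f hf hbf
  have hAS : A ⊆ S := hAB ▸ subset_union_left
  have hBS : B ⊆ S := hAB ▸ subset_union_right
  have hfS : ∀ x ∉ S, f x = 0 := fun x hx => hf x fun h => hx (hBS h)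
  have hind : ∀ y ∈ S, A.indicator (bd e k f) y = bd e k f y := by
    intro y hy
    rcases hAB ▸ hy with hy' | hy'
    · rw [indicator_of_mem hy']
    · rw [indicator_of_notMem (fun h => disjoint_left.1 hdisj h hy'), hbf y hy']
  -- The boundary in `S` of the cycle `f` of `B` is a cycle of `A`. Subtracting a primitive `g` of
  -- it turns `f` into a cycle of `S`.
  obtain ⟨g, hg, hbg⟩ := h2 (A.indicator (bd e k f)) (fun x hx => indicator_of_notMem hx _)
    fun x hx => bd_bd_restrict he hS hfS hind
      (fun y hy => indicator_of_notMem (fun h => hy (hAS h)) _) (hAS hx)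
  have hgB : ∀ x ∈ B, bd e k g x = 0 := fun x hx => bd_eq_zero_of_incidence fun y hy =>
    hopen y (by_contra fun h => hy (hg y h)) x hx
  obtain ⟨g', hg', hbg'⟩ := h1 (f - g) (fun x hx => by
    simp [hfS x hx, hg x fun h => hx (hAS h)]) (fun x hx => by
    rw [map_sub, Pi.sub_apply]
    rcases hAB ▸ hx with hx | hx
    · rw [hbg x hx, indicator_of_mem hx, sub_self]
    · rw [hbf x hx, hgB x hx, sub_self])
  refine ⟨B.indicator g', fun x hx => indicator_of_notMem hx _, fun x hx => ?_⟩
  have : f x = (f - g) x := by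
    simp [hg x fun h => disjoint_left.1 hdisj h hx]
  rw [this, ← hbg' x (hBS hx)]
  refine bd_congr fun y hy => ?_
  by_cases hyB : y ∈ B
  · rw [indicator_of_mem hyB]
  · rw [indicator_of_notMem hyB, hg' y]
    intro hyS
    rcases hAB ▸ hyS with h | h
    · exact hy (hopen y h x hx)
    · exact hyB h

/-- The augmentations agree on the subcomplex `A`, so its inclusion into `S` is an isomorphism of
one-dimensional homologies and the quotient `B` is exact. -/
theorem HasAugmentation.acyclic_sdiff (he : ∀ x'' x, ∑ x', e x'' x' * e x' x = 0)
    {A B S : Set X} {a a' : X → ℤ}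
    (hAB : S = A ∪ B) (hdisj : Disjoint A B) (hS : IncidenceConvex e S)
    (hopen : ∀ x ∈ A, ∀ x' ∈ B, e x' x = 0) (ha : IsCocycleOn e a S)
    (ha' : ∀ x ∈ A, a' x = a x) (h1 : HasAugmentation e k a S)
    (h2 : HasAugmentation e k a' A) : Acyclic e k B := by
  classical
  intro f hf hbf
  have hAS : A ⊆ S := hAB ▸ subset_union_left
  have hBS : B ⊆ S := hAB ▸ subset_union_right
  have hfS : ∀ x ∉ S, f x = 0 := fun x hx => hf x fun h => hx (hBS h)
  have hsum : ∀ g : X → k, (∀ x ∉ A, g x = 0) →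
      ∑ x, (a' x : k) * g x = ∑ x, (a x : k) * g x := fun g hg =>
    Finset.sum_congr rfl fun x _ => by
      by_cases hx : x ∈ A
      · rw [ha' x hx]
      · simp [hg x hx]
  have hind : ∀ y ∈ S, A.indicator (bd e k f) y = bd e k f y := by
    intro y hy
    rcases hAB ▸ hy with hy' | hy'
    · rw [indicator_of_mem hy']
    · rw [indicator_of_notMem (fun h => disjoint_left.1 hdisj h hy'), hbf y hy']
  have hBz : ∀ g : X → k, (∀ x ∉ A, g x = 0) → ∀ x ∈ B, bd e k g x = 0 := fun g hg x hx =>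
    bd_eq_zero_of_incidence fun y hy => hopen y (by_contra fun h => hy (hg y h)) x hx
  -- The boundary of `f` in `S` is concentrated on `A`, and the cocycle `a` vanishes on boundaries;
  -- hence a primitive `g` exists in `A`.
  obtain ⟨g, hg, hbg⟩ := h2.1 (A.indicator (bd e k f)) (fun x hx => indicator_of_notMem hx _)
    (fun x hx => bd_bd_restrict he hS hfS hind
      (fun y hy => indicator_of_notMem (fun h => hy (hAS h)) _) (hAS hx)) (by
      rw [hsum _ fun x hx => indicator_of_notMem hx _, ← ha.sum_bd hfS]
      refine Finset.sum_congr rfl fun x _ => ?_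
      by_cases hx : x ∈ S
      · rw [hind x hx]
      · simp [ha.1 x hx])
  obtain ⟨z, hz, hbz, hz1⟩ := h2.2
  rw [hsum z hz] at hz1
  -- The cycle `f - g` of `S` may have a nonzero class. Subtracting `t` times the normalised cycle
  -- `z` of `A` kills it without changing `f` on `B`.
  set t := ∑ x, (a x : k) * (f - g) x with ht
  obtain ⟨g', hg', hbg'⟩ := h1.1 (f - g - t • z) (fun x hx => by
      simp [hfS x hx, hg x fun h => hx (hAS h), hz x fun h => hx (hAS h)]) (fun x hx => by
      rw [map_sub, map_sub, map_smul, Pi.sub_apply, Pi.sub_apply, Pi.smul_apply]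
      rcases hAB ▸ hx with hx | hx
      · rw [hbg x hx, indicator_of_mem hx, hbz x hx, sub_self, smul_zero, sub_self]
      · rw [hbf x hx, hBz g hg x hx, hBz z hz x hx, sub_self, smul_zero, sub_self]) (by
      have : ∑ x, (a x : k) * (f - g - t • z) x =
          ∑ x, (a x : k) * (f - g) x - t * ∑ x, (a x : k) * z x := by
        rw [Finset.mul_sum, ← Finset.sum_sub_distrib]
        refine Finset.sum_congr rfl fun x _ => ?_
        simp only [Pi.sub_apply, Pi.smul_apply, smul_eq_mul]
        ring
      rw [this, hz1, mul_one, ← ht, sub_self])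
  refine ⟨B.indicator g', fun x hx => indicator_of_notMem hx _, fun x hx => ?_⟩
  have hxA : x ∉ A := fun h => disjoint_left.1 hdisj h hx
  have : f x = (f - g - t • z) x := by
    simp [hg x hxA, hz x hxA]
  rw [this, ← hbg' x (hBS hx)]
  refine bd_congr fun y hy => ?_
  by_cases hyB : y ∈ B
  · rw [indicator_of_mem hyB]
  · rw [indicator_of_notMem hyB, hg' y]
    intro hyS
    rcases hAB ▸ hyS with h | h
    · exact hy (hopen y h x hx)
    · exact hyB h

/-- Transport of a cocycle across a closed subset `Z` with open complement `A ∪ B`. -/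
theorem IsCocycleOn.connecting (he : ∀ x'' x, ∑ x', e x'' x' * e x' x = 0)
    {A Z S : Set X} {a a₀ : X → ℤ} (hAS : A ⊆ S) (hZS : Z ⊆ S)
    (hS : IncidenceConvex e S) (hAopen : ∀ x ∈ A, ∀ x' ∈ S, e x' x ≠ 0 → x' ∈ A)
    (hZA : ∀ x ∈ Z, ∀ x' ∈ S, e x' x ≠ 0 → ∀ x'' ∈ A, e x'' x' ≠ 0 → x' ∈ A ∨ x' ∈ Z)
    (ha : IsCocycleOn e a S) (ha₀ : ∀ x ∈ Z, a₀ x = ∑ x', A.indicator a x' * e x' x)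
    (ha₀0 : ∀ x ∉ Z, a₀ x = 0) : IsCocycleOn e a₀ Z := by
  classical
  refine ⟨ha₀0, fun x hx => ?_⟩
  have h1 : ∀ x' ∈ A, ∑ x'', A.indicator a x'' * e x'' x' = 0 := fun x' hx' => by
    rw [← ha.2 x' (hAS hx')]
    refine Finset.sum_congr rfl fun x'' _ => ?_
    by_cases h : x'' ∈ A
    · rw [indicator_of_mem h]
    · rw [indicator_of_notMem h, zero_mul]
      by_cases h' : e x'' x' = 0
      · simp [h']
      · rw [ha.1 x'' fun hS' => h (hAopen x' hx' x'' hS' h'), zero_mul]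
  -- Pair the relation that consecutive incidences sum to zero with the restriction of `a` to `A`.
  -- Intermediate cells in `Z` give `a₀`, those in `A` contribute nothing by `h1`, and neither do
  -- any others.
  have h2 : ∑ x'', A.indicator a x'' * ∑ x', e x'' x' * e x' x = 0 := by simp [he]
  rw [← h2]
  simp only [Finset.mul_sum]
  rw [Finset.sum_comm]
  refine Finset.sum_congr rfl fun x' _ => ?_
  simp only [← mul_assoc]
  rw [← Finset.sum_mul]
  by_cases h3 : e x' x = 0
  · simp [h3]
  congr 1
  by_cases hx' : x' ∈ Z
  · exact ha₀ x' hx'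
  rw [ha₀0 x' hx']
  by_cases hA : x' ∈ A
  · exact (h1 x' hA).symm
  · refine (Finset.sum_eq_zero fun x'' _ => ?_).symm
    by_cases h4 : x'' ∈ A
    · by_cases h5 : e x'' x' = 0
      · rw [h5, mul_zero]
      · have h6 := hS x (hZS hx) x'' (hAS h4) x' h5 h3
        rcases hZA x hx x' h6 h3 x'' h4 h5 with h | h
        · exact absurd h hA
        · exact absurd h hx'
    · rw [indicator_of_notMem h4, zero_mul]

/-- `A` and `B` together form a subcomplex with quotient `Z`. The connecting map sends the class of
`Z` to one with nonzero `A`-component, because `a₀` is `a` on `A` composed with the boundary, and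
with opposite `B`-component, because `a` kills boundaries. So the homology of `S` is two lines
modulo an antidiagonal, and `a` detects it. -/
theorem HasAugmentation.of_cut (he : ∀ x'' x, ∑ x', e x'' x' * e x' x = 0)
    {A B Z S : Set X} {a aA aB a₀ : X → ℤ}
    (hABZ : S = A ∪ B ∪ Z) (hAB : Disjoint A B) (hAZ : Disjoint A Z) (hBZ : Disjoint B Z)
    (hS : IncidenceConvex e S)
    (hAo : ∀ x ∈ A, ∀ x' ∈ S, e x' x ≠ 0 → x' ∈ A)
    (hBo : ∀ x ∈ B, ∀ x' ∈ S, e x' x ≠ 0 → x' ∈ B)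
    (ha : IsCocycleOn e a S) (haA : ∀ x ∈ A, aA x = a x) (haB : ∀ x ∈ B, aB x = a x)
    (ha₀ : ∀ x ∈ Z, a₀ x = ∑ x', A.indicator a x' * e x' x)
    (hA : HasAugmentation e k aA A) (hB : HasAugmentation e k aB B)
    (hZ : HasAugmentation e k a₀ Z) : HasAugmentation e k a S := by
  classical
  have hAS : A ⊆ S := fun x hx => hABZ ▸ Or.inl (Or.inl hx)
  have hBS : B ⊆ S := fun x hx => hABZ ▸ Or.inl (Or.inr hx)
  have hZS : Z ⊆ S := fun x hx => hABZ ▸ Or.inr hx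
  have hsum : ∀ (T : Set X) (a' : X → ℤ), (∀ x ∈ T, a' x = a x) → ∀ g : X → k,
      (∀ x ∉ T, g x = 0) → ∑ x, (a' x : k) * g x = ∑ x, (a x : k) * g x := fun T a' hT g hg =>
    Finset.sum_congr rfl fun x _ => by
      by_cases hx : x ∈ T
      · rw [hT x hx]
      · simp [hg x hx]
  have hsplit : ∀ x ∈ S, x ∉ A → x ∉ B → x ∈ Z := fun x hx h1 h2 => by
    rcases hABZ ▸ hx with (h | h) | h
    exacts [absurd h h1, absurd h h2, h]
  -- the value of the augmentation of `Z` on `h` is that of `A` on the boundary of `h`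
  have hconn : ∀ h : X → k, (∀ x ∉ Z, h x = 0) →
      ∑ x, (a₀ x : k) * h x = ∑ x', ((A.indicator a x' : ℤ) : k) * bd e k h x' := by
    intro h hh
    rw [sum_mul_bd]
    refine Finset.sum_congr rfl fun x _ => ?_
    by_cases hx : x ∈ Z
    · rw [ha₀ x hx]
    · simp [hh x hx]
  have hAcoc : ∀ g : X → k, (∀ x ∉ A, g x = 0) →
      ∑ x', ((A.indicator a x' : ℤ) : k) * bd e k g x' = 0 := by
    intro g hg
    rw [← ha.sum_bd (f := g) fun x hx => hg x fun h => hx (hAS h)]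
    refine Finset.sum_congr rfl fun x _ => ?_
    by_cases hx : x ∈ A
    · rw [indicator_of_mem hx]
    · rw [indicator_of_notMem hx, Int.cast_zero, zero_mul]
      by_cases hxS : x ∈ S
      · rw [bd_eq_zero_of_incidence, mul_zero]
        intro y hy
        by_contra hne
        exact hx (hAo y (by_contra fun h => hy (hg y h)) x hxS hne)
      · rw [ha.1 x hxS, Int.cast_zero, zero_mul]
  have hzero : ∀ (T U : Set X), U ⊆ S → Disjoint T U →
      (∀ x ∈ T, ∀ x' ∈ S, e x' x ≠ 0 → x' ∈ T) → ∀ g : X → k, (∀ x ∉ T, g x = 0) →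
      ∀ x ∈ U, bd e k g x = 0 := fun T U hU hd ho g hg x hx =>
    bd_eq_zero_of_incidence fun y hy => by
      by_contra hne
      exact disjoint_left.1 hd (ho y (by_contra fun h => hy (hg y h)) x (hU hx) hne) hx
  refine ⟨fun f hf hbf haf => ?_, ?_⟩
  · have hdec : f = A.indicator f + B.indicator f + Z.indicator f := by
      ext x
      simp only [Pi.add_apply, indicator_apply]
      by_cases h1 : x ∈ A
      · simp [h1, disjoint_left.1 hAB h1, disjoint_left.1 hAZ h1]
      by_cases h2 : x ∈ B
      · simp [h1, h2, disjoint_left.1 hBZ h2]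
      by_cases h3 : x ∈ Z
      · simp [h1, h2, h3]
      · simp only [h1, h2, h3, if_false, add_zero]
        exact hf x fun hx => h3 (hsplit x hx h1 h2)
    have hi : ∀ (T : Set X) (g : X → k), ∀ x ∉ T, T.indicator g x = 0 :=
      fun T g x hx => indicator_of_notMem hx _
    have hbdec : ∀ x, bd e k f x = bd e k (A.indicator f) x + bd e k (B.indicator f) x +
        bd e k (Z.indicator f) x := fun x => by
      conv_lhs => rw [hdec]
      simp
    -- By `hconn` the augmentation of the `Z`-part of `f` is read off from its boundary on `A`.
    -- There it cancels the boundary of the `A`-part, on which `a` vanishes.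
    obtain ⟨g₀, hg₀, hbg₀⟩ := hZ.1 (Z.indicator f) (hi Z f) (fun x hx => by
      have := hbdec x
      rwa [hbf x (hZS hx), hzero A Z hZS hAZ hAo _ (hi A f) x hx,
        hzero B Z hZS hBZ hBo _ (hi B f) x hx, zero_add, zero_add, eq_comm] at this) (by
      rw [hconn _ (hi Z f)]
      have h1 : ∑ x', ((A.indicator a x' : ℤ) : k) * bd e k f x' = 0 :=
        Finset.sum_eq_zero fun x _ => by
          by_cases hx : x ∈ A
          · rw [hbf x (hAS hx), mul_zero]
          · simp [hx]
      have h2 : ∑ x', ((A.indicator a x' : ℤ) : k) * bd e k (B.indicator f) x' = 0 :=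
        Finset.sum_eq_zero fun x _ => by
          by_cases hx : x ∈ A
          · rw [hzero B A hAS hAB.symm hBo _ (hi B f) x hx, mul_zero]
          · simp [hx]
      simp only [hbdec, mul_add, Finset.sum_add_distrib, hAcoc _ (hi A f), h2, zero_add] at h1
      exact h1)
    obtain ⟨z, hz, hbz, hz1⟩ := hZ.2
    -- The choice of `g₀` leaves the augmentation `t` on `A`. Since `a₀` takes the value 1 on `z`,
    -- adding `t • z` removes it.
    set t := ∑ x, ((A.indicator a x : ℤ) : k) * (f - bd e k g₀) x with ht
    -- corrected preimage on `Z`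
    set g₁ := g₀ + t • z with hg₁
    have hg₁Z : ∀ x ∉ Z, g₁ x = 0 := fun x hx => by simp [hg₁, hg₀ x hx, hz x hx]
    have hbg₁ : ∀ x ∈ Z, bd e k g₁ x = f x := fun x hx => by
      simp [hg₁, hbg₀ x hx, hbz x hx, hx]
    set f₁ := S.indicator (f - bd e k g₁) with hf₁
    have hf₁S : ∀ x ∈ S, f₁ x = f x - bd e k g₁ x := fun x hx => by simp [hf₁, hx]
    have hf₁0 : ∀ x ∉ S, f₁ x = 0 := fun x hx => indicator_of_notMem hx _
    have hf₁Z : ∀ x ∈ Z, f₁ x = 0 := fun x hx => by rw [hf₁S x (hZS hx), hbg₁ x hx, sub_self]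
    have hg₁S : ∀ x ∉ S, g₁ x = 0 := fun x hx => hg₁Z x fun h => hx (hZS h)
    have hbf₁ : ∀ x ∈ S, bd e k f₁ x = 0 := by
      intro x hx
      have h1 : bd e k (f - f₁) x = 0 := bd_bd_restrict he hS hg₁S
        (fun y hy => by simp [hf₁S y hy]) (fun y hy => by simp [hf₁0 y hy, hf y hy]) hx
      rw [map_sub, Pi.sub_apply, hbf x hx, zero_sub, neg_eq_zero] at h1
      exact h1
    have haf₁ : ∑ x, (a x : k) * f₁ x = 0 := by
      have h1 : ∑ x, (a x : k) * f₁ x =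
          ∑ x, (a x : k) * f x - ∑ x, (a x : k) * bd e k g₁ x := by
        rw [← Finset.sum_sub_distrib]
        refine Finset.sum_congr rfl fun x _ => ?_
        by_cases hx : x ∈ S
        · rw [hf₁S x hx, mul_sub]
        · simp [ha.1 x hx]
      rw [h1, haf, ha.sum_bd hg₁S, sub_zero]
    have hA₁ : ∑ x, (a x : k) * A.indicator f₁ x = 0 := by
      have h1 : ∑ x, (a x : k) * A.indicator f₁ x =
          t - t * ∑ x, ((A.indicator a x : ℤ) : k) * bd e k z x := by
        rw [ht, Finset.mul_sum, ← Finset.sum_sub_distrib, ← ht]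
        refine Finset.sum_congr rfl fun x _ => ?_
        by_cases hx : x ∈ A
        · rw [indicator_of_mem hx, indicator_of_mem hx, hf₁S x (hAS hx)]
          simp only [hg₁, map_add, map_smul, Pi.add_apply, Pi.sub_apply, Pi.smul_apply, smul_eq_mul]
          ring
        · simp [hx]
      rw [h1, ← hconn z hz, hz1, mul_one, sub_self]
    have hf₁dec : f₁ = A.indicator f₁ + B.indicator f₁ := by
      ext x
      simp only [Pi.add_apply, indicator_apply]
      by_cases h1 : x ∈ A
      · simp [h1, disjoint_left.1 hAB h1]
      by_cases h2 : x ∈ B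
      · simp [h1, h2]
      simp only [h1, h2, if_false, add_zero]
      by_cases hx : x ∈ S
      · exact hf₁Z x (hsplit x hx h1 h2)
      · exact hf₁0 x hx
    -- The total augmentation and its `A`-part vanish, hence so does the `B`-part; this is where the
    -- vanishing of `a` on `f` is needed.
    have hB₁ : ∑ x, (a x : k) * B.indicator f₁ x = 0 := by
      have h1 : ∑ x, (a x : k) * f₁ x =
          ∑ x, (a x : k) * A.indicator f₁ x + ∑ x, (a x : k) * B.indicator f₁ x := by
        rw [← Finset.sum_add_distrib]
        refine Finset.sum_congr rfl fun x _ => ?_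
        conv_lhs => rw [hf₁dec]
        rw [Pi.add_apply, mul_add]
      rw [haf₁, hA₁, zero_add] at h1
      exact h1.symm
    have hbdec₁ : ∀ x, bd e k f₁ x = bd e k (A.indicator f₁) x + bd e k (B.indicator f₁) x :=
      fun x => by
        conv_lhs => rw [hf₁dec]
        simp
    obtain ⟨gA, hgA, hbgA⟩ := hA.1 (A.indicator f₁) (hi A f₁) (fun x hx => by
        have := hbdec₁ x
        rwa [hbf₁ x (hAS hx), hzero B A hAS hAB.symm hBo _ (hi B f₁) x hx, add_zero,
          eq_comm] at this) (by rw [hsum A aA haA _ (hi A f₁), hA₁])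
    obtain ⟨gB, hgB, hbgB⟩ := hB.1 (B.indicator f₁) (hi B f₁) (fun x hx => by
        have := hbdec₁ x
        rwa [hbf₁ x (hBS hx), hzero A B hBS hAB hAo _ (hi A f₁) x hx, zero_add,
          eq_comm] at this) (by rw [hsum B aB haB _ (hi B f₁), hB₁])
    refine ⟨g₁ + gA + gB, fun x hx => ?_, fun x hx => ?_⟩
    · simp [hg₁S x hx, hgA x fun h => hx (hAS h), hgB x fun h => hx (hBS h)]
    · simp only [map_add, Pi.add_apply]
      rcases hABZ ▸ hx with (h | h) | h
      · rw [hbgA x h, hzero B A hAS hAB.symm hBo _ hgB x h, indicator_of_mem h, hf₁S x hx]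
        ring
      · rw [hbgB x h, hzero A B hBS hAB hAo _ hgA x h, indicator_of_mem h, hf₁S x hx]
        ring
      · rw [hzero A Z hZS hAZ hAo _ hgA x h, hzero B Z hZS hBZ hBo _ hgB x h, hbg₁ x h]
        ring
  -- A cycle of the subcomplex `A` remains a cycle in `S`.
  · obtain ⟨z, hz, hbz, hz1⟩ := hA.2
    refine ⟨z, fun x hx => hz x fun h => hx (hAS h), fun x hx => ?_, ?_⟩
    · by_cases h : x ∈ A
      · exact hbz x h
      · refine bd_eq_zero_of_incidence fun y hy => ?_
        by_contra hne
        exact h (hAo y (by_contra fun h' => hy (hz y h')) x hx hne)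
    · rw [← hsum A aA haA z hz, hz1]

end Incidence

end

section

variable {E : Type*} [NormedAddCommGroup E] [NormedSpace ℝ E]

/-! ### Volume forms of oriented subspaces -/

section Orientation

/-- An alternating form on the ambient space that restricts on `L` to a volume form of the given
orientation. -/
def orientationForm (L : Submodule ℝ E) (o : Orientation ℝ L (Fin (finrank ℝ L))) (n : ℕ) :
    E [⋀^Fin n]→ₗ[ℝ] ℝ :=
  if h : finrank ℝ L = n then
    ((Module.Ray.someVector o).compLinearMap
      (LinearMap.exists_leftInverse_of_injective L.subtype L.ker_subtype).choose).domDomCongr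
        (finCongr h)
  else 0

variable {L L' : Submodule ℝ E} (o : Orientation ℝ L (Fin (finrank ℝ L)))

theorem orientationForm_apply {n : ℕ} (h : finrank ℝ L = n) (b : Fin n → E) (hb : ∀ i, b i ∈ L) :
    orientationForm L o n b = Module.Ray.someVector o fun j => ⟨b (Fin.cast h j), hb _⟩ := by
  rw [orientationForm, dif_pos h]
  simp only [AlternatingMap.domDomCongr_apply, AlternatingMap.compLinearMap_apply]
  congr 1
  ext j
  have h1 := LinearMap.congr_fun
    (LinearMap.exists_leftInverse_of_injective L.subtype L.ker_subtype).choose_spec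
    ⟨b (Fin.cast h j), hb _⟩
  exact congrArg Subtype.val h1

theorem orientationForm_ne_zero [FiniteDimensional ℝ E] {n : ℕ} (h : finrank ℝ L = n)
    {b : Fin n → E} (hb : ∀ i, b i ∈ L) (hli : LinearIndependent ℝ b) :
    orientationForm L o n b ≠ 0 := by
  subst h
  rw [orientationForm_apply o rfl b hb]
  have hli' : LinearIndependent ℝ fun j => (⟨b j, hb j⟩ : L) :=
    LinearIndependent.of_comp L.subtype hli
  let e := basisOfLinearIndependentOfCardEqFinrank' _ hli' (by simp)
  have he : (fun j => (⟨b j, hb j⟩ : L)) = e := by simp [e]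
  change Module.Ray.someVector o (fun j => (⟨b j, hb j⟩ : L)) ≠ 0
  rw [he, ne_eq, AlternatingMap.map_basis_eq_zero_iff]
  exact Module.Ray.someVector_ne_zero o

theorem form_eq_zero_of_finrank_lt [FiniteDimensional ℝ E] {n : ℕ} (f : E [⋀^Fin n]→ₗ[ℝ] ℝ)
    (h : finrank ℝ L < n) (b : Fin n → E) (hb : ∀ i, b i ∈ L) : f b = 0 := by
  refine f.map_linearDependent b fun hli => ?_
  have hli' : LinearIndependent ℝ fun j => (⟨b j, hb j⟩ : L) :=
    LinearIndependent.of_comp L.subtype hli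
  have := hli'.fintype_card_le_finrank
  simp at this
  omega

/-- Any `n + 1` vectors of `L` are dependent, so the form sees its first argument only modulo `L`.
-/
theorem form_cons_eq [FiniteDimensional ℝ E] {n : ℕ} (f : E [⋀^Fin (n + 1)]→ₗ[ℝ] ℝ)
    (h : finrank ℝ L = n) {b : Fin n → E} (hb : ∀ i, b i ∈ L) {u l : E} (hl : l ∈ L) (t : ℝ) :
    f (Matrix.vecCons (t • u + l) b) = t * f (Matrix.vecCons u b) := by
  rw [AlternatingMap.map_vecCons_add, AlternatingMap.map_vecCons_smul,
    form_eq_zero_of_finrank_lt f (L := L) (by omega) (Matrix.vecCons l b), add_zero, smul_eq_mul]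
  intro i
  refine Fin.cases ?_ (fun j => ?_) i
  · simpa using hl
  · simpa using hb j

/-- Replaces the existential definition by the sign of a number. The choices made there, of forms on
two rays and of points in the cells, only change that number by positive factors, since all outward
vectors are positive multiples of `u` modulo the smaller span. -/
theorem agreesWithInduced_iff [FiniteDimensional ℝ E] {τ τ' : Set E} {o : CellOrientation τ}
    {o' : CellOrientation τ'} (hle : vectorSpan ℝ τ ≤ vectorSpan ℝ τ') {n : ℕ}
    (hn : finrank ℝ (vectorSpan ℝ τ) = n) (hn' : finrank ℝ (vectorSpan ℝ τ') = n + 1)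
    (hne : τ.Nonempty) (hne' : τ'.Nonempty) {u : E} (hu : u ∈ vectorSpan ℝ τ')
    (hpos : ∀ x ∈ τ, ∀ x' ∈ τ', ∃ t : ℝ, 0 < t ∧ ∃ l ∈ vectorSpan ℝ τ, x - x' = t • u + l)
    {b : Fin n → E} (hb : ∀ i, b i ∈ vectorSpan ℝ τ)
    (hb0 : orientationForm _ o n b ≠ 0) :
    AgreesWithInduced τ' τ o' o ↔
      0 < orientationForm _ o n b * orientationForm _ o' (n + 1) (Matrix.vecCons u b) := by
  subst hn
  have hmem : ∀ w ∈ vectorSpan ℝ τ', ∀ i, (Matrix.vecCons w b : Fin ((finrank ℝ (vectorSpan ℝ τ)) + 1) → E) i ∈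
      vectorSpan ℝ τ' := fun w hw i => by
    refine Fin.cases ?_ (fun j => ?_) i
    · simpa using hw
    · simpa using hle (hb j)
  let bL : Fin (finrank ℝ (vectorSpan ℝ τ)) → vectorSpan ℝ τ := fun i => ⟨b i, hb i⟩
  have hcons : ∀ u₁ : vectorSpan ℝ τ', orientationForm _ o' ((finrank ℝ (vectorSpan ℝ τ)) + 1) (Matrix.vecCons (u₁ : E) b) =
      Module.Ray.someVector o' fun j => (Fin.cons u₁ (fun i => Submodule.inclusion hle (bL i)) :
          Fin ((finrank ℝ (vectorSpan ℝ τ)) + 1) → vectorSpan ℝ τ') (Fin.cast hn' j) := by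
    intro u₁
    rw [orientationForm_apply o' hn' _ (hmem _ u₁.2)]
    congr 1
    ext j
    generalize Fin.cast hn' j = j'
    refine Fin.cases ?_ (fun i => ?_) j'
    · simp
    · simp [bL]
  constructor
  · rintro ⟨hle', hdim, ω', hω', ω, hω, u₁, ho', ho, ⟨x, hx, x', hx', hxx⟩, hform⟩
    have h1 : SameRay ℝ ω (Module.Ray.someVector o) := by
      rw [← ray_eq_iff hω (Module.Ray.someVector_ne_zero o), ho, Module.Ray.someVector_ray]
    have h2 : SameRay ℝ ω' (Module.Ray.someVector o') := by
      rw [← ray_eq_iff hω' (Module.Ray.someVector_ne_zero o'), ho', Module.Ray.someVector_ray]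
    obtain ⟨r, hr, h1⟩ := h1.exists_pos_left hω (Module.Ray.someVector_ne_zero o)
    obtain ⟨r', hr', h2⟩ := h2.exists_pos_left hω' (Module.Ray.someVector_ne_zero o')
    obtain ⟨t, ht, l, hl, hxl⟩ := hpos x hx x' hx'
    have h3 := hform bL
    have h4 : orientationForm _ o (finrank ℝ (vectorSpan ℝ τ)) b = r * ω bL := by
      rw [orientationForm_apply o rfl b hb, ← h1]; rfl
    have h5 : orientationForm _ o' ((finrank ℝ (vectorSpan ℝ τ)) + 1) (Matrix.vecCons (u₁ : E) b) = r' * ω bL := by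
      rw [hcons, ← h2, h3]; rfl
    rw [hxx, hxl, form_cons_eq _ rfl hb hl] at h5
    have h6 : ω bL ≠ 0 := fun h => hb0 (by rw [h4, h, mul_zero])
    have h7 : orientationForm _ o' ((finrank ℝ (vectorSpan ℝ τ)) + 1) (Matrix.vecCons u b) = r' / t * ω bL := by
      field_simp
      linarith
    rw [h4, h7]
    have : 0 < ω bL * ω bL := mul_self_pos.2 h6
    have : r * ω bL * (r' / t * ω bL) = r * (r' / t) * (ω bL * ω bL) := by ring
    rw [this]
    positivity
  · intro h
    obtain ⟨x, hx⟩ := hne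
    obtain ⟨x', hx'⟩ := hne'
    obtain ⟨t, ht, l, hl, hxl⟩ := hpos x hx x' hx'
    have hxx : x - x' ∈ vectorSpan ℝ τ' := by
      rw [hxl]
      exact add_mem (Submodule.smul_mem _ _ hu) (hle hl)
    let u₁ : vectorSpan ℝ τ' := ⟨x - x', hxx⟩
    -- The form required on the smaller span: contract a form of `o'` with the outward vector `x -
    -- x'` and restrict.
    let ω : vectorSpan ℝ τ [⋀^Fin (finrank ℝ (vectorSpan ℝ τ))]→ₗ[ℝ] ℝ :=
      (((Module.Ray.someVector o').domDomCongr (finCongr hn')).curryLeft u₁).compLinearMap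
        (Submodule.inclusion hle)
    have hω : ∀ c : Fin (finrank ℝ (vectorSpan ℝ τ)) → vectorSpan ℝ τ, ω c = Module.Ray.someVector o' fun j =>
        (Fin.cons u₁ (fun i => Submodule.inclusion hle (c i)) :
          Fin ((finrank ℝ (vectorSpan ℝ τ)) + 1) → vectorSpan ℝ τ') (Fin.cast hn' j) := fun c => rfl
    have hωb : 0 < orientationForm _ o (finrank ℝ (vectorSpan ℝ τ)) b * ω bL := by
      rw [hω, ← hcons, show (u₁ : E) = t • u + l from hxl, form_cons_eq _ rfl hb hl]
      have : orientationForm _ o (finrank ℝ (vectorSpan ℝ τ)) b *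
          (t * orientationForm _ o' ((finrank ℝ (vectorSpan ℝ τ)) + 1) (Matrix.vecCons u b)) =
          t * (orientationForm _ o (finrank ℝ (vectorSpan ℝ τ)) b * orientationForm _ o' ((finrank ℝ (vectorSpan ℝ τ)) + 1) (Matrix.vecCons u b)) := by
        ring
      rw [this]
      exact mul_pos ht h
    have hω0 : ω ≠ 0 := fun h0 => by simp [h0] at hωb
    -- Volume forms are proportional to the determinant of `e`, so positivity of the product at `b`
    -- passes to `e` and puts `ω` on the ray of `o`.
    let e := Module.finBasis ℝ (vectorSpan ℝ τ)
    have e1 := AlternatingMap.eq_smul_basis_det e ω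
    have e2 := AlternatingMap.eq_smul_basis_det e (Module.Ray.someVector o)
    have e3 : orientationForm _ o (finrank ℝ (vectorSpan ℝ τ)) b = Module.Ray.someVector o e * e.det bL := by
      rw [orientationForm_apply o rfl b hb]
      exact congrArg (fun f => f bL) e2
    have e4 : ω bL = ω e * e.det bL := congrArg (fun f => f bL) e1
    have e5 : 0 < Module.Ray.someVector o e * ω e := by
      rw [e3, e4] at hωb
      have : Module.Ray.someVector o e * e.det bL * (ω e * e.det bL) =
        Module.Ray.someVector o e * ω e * (e.det bL * e.det bL) := by ring
      rw [this] at hωb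
      exact pos_of_mul_pos_left hωb (mul_self_nonneg _)
    refine ⟨hle, hn'.symm, Module.Ray.someVector o', Module.Ray.someVector_ne_zero o', ω, hω0, u₁,
      Module.Ray.someVector_ray _, ?_, ⟨x, hx, x', hx', rfl⟩, hω⟩
    rw [← Module.Ray.someVector_ray o, ray_eq_iff]
    have e6 : Module.Ray.someVector o e ≠ 0 := left_ne_zero_of_mul e5.ne'
    have e7 : ω = (ω e / Module.Ray.someVector o e) • Module.Ray.someVector o := by
      have e8 := congrArg (fun f => (ω e / Module.Ray.someVector o e) • f) e2
      rw [e8, smul_smul, div_mul_cancel₀ _ e6]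
      exact e1
    rw [e7]
    refine SameRay.sameRay_pos_smul_left _ ?_
    have : ω e / Module.Ray.someVector o e =
      (Module.Ray.someVector o e * ω e) / (Module.Ray.someVector o e) ^ 2 := by
      field_simp
    rw [this]
    positivity

end Orientation

end

section

/-! ### Arrangements of hyperplanes in an open convex set -/

/-- Finitely many affine functionals `n i - d i` on an open convex set `V`. -/
structure Arrangement (E : Type*) [NormedAddCommGroup E] [NormedSpace ℝ E] (I : Type*) where
  /-- the linear parts -/
  n : I → Dual ℝ E
  /-- the levels -/
  d : I → ℝ
  /-- the ambient open convex set -/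
  V : Set E
  isOpen : IsOpen V
  convex : Convex ℝ V

namespace Arrangement

variable {E : Type*} [NormedAddCommGroup E] [NormedSpace ℝ E] {I : Type*} (A : Arrangement E I)

/-- The sign vector of a point. -/
def signs (x : E) : I → SignType := fun i => SignType.sign (A.n i x - A.d i)

/-- The points of `V` with a given sign vector. -/
def cell (s : I → SignType) : Set E := {x | x ∈ A.V ∧ A.signs x = s}

/-- The sign vectors of nonempty cells. -/
def Realized : Type _ := {s : I → SignType // (A.cell s).Nonempty}

instance [Finite I] : Fintype A.Realized :=
  have : Finite A.Realized := Subtype.finite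
  Fintype.ofFinite _

/-- The direction of the cell of a sign vector. -/
def dir (s : I → SignType) : Submodule ℝ E where
  carrier := {v | ∀ i, s i = 0 → A.n i v = 0}
  zero_mem' := by simp
  add_mem' ha hb i hi := by rw [map_add, ha i hi, hb i hi, add_zero]
  smul_mem' c v hv i hi := by rw [map_smul, hv i hi, smul_zero]

theorem mem_dir {s : I → SignType} {v : E} : v ∈ A.dir s ↔ ∀ i, s i = 0 → A.n i v = 0 := Iff.rfl

/-- The sign vector reached from `s` by a small step in the direction `v`. -/
def move (s : I → SignType) (v : E) : I → SignType := fun i =>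
  if s i = 0 then SignType.sign (A.n i v) else s i

/-- The cell of `s` is a face of the cell of `s'`. -/
def Face (s s' : I → SignType) : Prop := ∀ i, s i ≠ 0 → s' i = s i

theorem Face.trans {s s' s'' : I → SignType} (h : Face s s') (h' : Face s' s'') : Face s s'' :=
  fun i hi => by rw [h' i (by rwa [h i hi]), h i hi]

theorem Face.dir_le {s s' : I → SignType} (h : Face s s') : A.dir s ≤ A.dir s' :=
  fun v hv i hi => hv i (by_contra fun h0 => h0 (by rw [← h i h0, hi]))

theorem face_move (s : I → SignType) (v : E) : Face s (A.move s v) := fun i hi => by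
  simp [move, hi]

theorem mem_dir_move (s : I → SignType) (v : E) : v ∈ A.dir (A.move s v) := fun i hi => by
  by_cases h : s i = 0
  · simpa [move, h, sign_eq_zero_iff] using hi
  · simp [move, h] at hi

theorem move_of_mem_dir {s : I → SignType} {v : E} (hv : v ∈ A.dir s) : A.move s v = s := by
  ext i
  by_cases h : s i = 0
  · simp [move, h, hv i h]
  · simp [move, h]

theorem move_smul_add {s : I → SignType} {v l : E} {t : ℝ} (ht : 0 < t) (hl : l ∈ A.dir s) :
    A.move s (t • v + l) = A.move s v := by
  ext i
  by_cases h : s i = 0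
  · simp [move, h, hl i h, sign_mul, sign_pos ht]
  · simp [move, h]

theorem signs_eq_zero_iff {x : E} {i : I} : A.signs x i = 0 ↔ A.n i x = A.d i := by
  rw [signs, sign_eq_zero_iff, sub_eq_zero]

/-- On hyperplanes through `x` the sign at `x'` is that of the difference, and the other signs are
inherited from the face. So a cell containing `s` in its closure is determined by a direction
pointing into it. -/
theorem eq_move {s s' : I → SignType} (h : Face s s') {x x' : E} (hx : x ∈ A.cell s)
    (hx' : x' ∈ A.cell s') : s' = A.move s (x' - x) := by
  funext i
  by_cases hi : s i = 0
  · have h1 : A.n i x = A.d i := A.signs_eq_zero_iff.1 (by rw [hx.2, hi])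
    rw [move, if_pos hi, map_sub, h1, ← hx'.2]
    rfl
  · rw [move, if_neg hi, h i hi]

theorem sub_mem_dir {s s' : I → SignType} (h : Face s s') {x x' : E} (hx : x ∈ A.cell s)
    (hx' : x' ∈ A.cell s') : x' - x ∈ A.dir s' := by
  rw [A.eq_move h hx hx']
  exact A.mem_dir_move _ _

/-- Nonzero signs are stable under small steps; on hyperplanes through `x` only the sign of the
direction counts. -/
theorem eventually_mem_cell_move [Finite I] {s : I → SignType} {x : E} (hx : x ∈ A.cell s)
    [FiniteDimensional ℝ E] (v : E) :
    ∀ᶠ t : ℝ in nhdsWithin 0 (Set.Ioi 0), x + t • v ∈ A.cell (A.move s v) := by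
  have hlim : Filter.Tendsto (fun t : ℝ => x + t • v) (nhdsWithin 0 (Set.Ioi 0)) (nhds x) := by
    have : Continuous fun t : ℝ => x + t • v := by fun_prop
    simpa using this.continuousWithinAt (s := Set.Ioi 0) (x := 0) |>.tendsto
  have h1 : ∀ i, ∀ᶠ t : ℝ in nhdsWithin 0 (Set.Ioi 0),
      A.signs (x + t • v) i = A.move s v i := by
    intro i
    have hxi : A.signs x i = s i := by rw [hx.2]
    have hc : Continuous fun y => A.n i y - A.d i :=
      (A.n i).continuous_of_finiteDimensional.sub continuous_const
    have hlim' := (hc.tendsto x).comp hlim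
    by_cases hi : s i = 0
    · have hd := A.signs_eq_zero_iff.1 (hxi.trans hi)
      filter_upwards [self_mem_nhdsWithin] with t (ht : 0 < t)
      simp [signs, move, hi, hd, sign_mul, sign_pos ht]
    · rw [move, if_neg hi]
      rcases lt_trichotomy (A.n i x - A.d i) 0 with h | h | h
      · filter_upwards [hlim'.eventually (gt_mem_nhds h)] with t (ht : A.n i (x + t • v) - A.d i < 0)
        rw [← hxi, signs, signs, sign_neg h, sign_neg ht]
      · exact absurd (hxi.symm.trans (by rw [signs, h, sign_zero])) hi
      · filter_upwards [hlim'.eventually (lt_mem_nhds h)] with t (ht : 0 < A.n i (x + t • v) - A.d i)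
        rw [← hxi, signs, signs, sign_pos h, sign_pos ht]
  filter_upwards [hlim.eventually (A.isOpen.mem_nhds hx.1), Filter.eventually_all.2 h1] with t ht ht'
  exact ⟨ht, funext ht'⟩

theorem cell_move_nonempty [Finite I] [FiniteDimensional ℝ E] {s : I → SignType}
    (hs : (A.cell s).Nonempty) (v : E) : (A.cell (A.move s v)).Nonempty := by
  obtain ⟨x, hx⟩ := hs
  obtain ⟨t, ht⟩ := (A.eventually_mem_cell_move hx v).exists
  exact ⟨_, ht⟩

/-- Cells are relatively open: a small step along `dir` stays inside, so each direction is a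
multiple of a difference of two points. -/
theorem vectorSpan_cell [Finite I] [FiniteDimensional ℝ E] {s : I → SignType}
    (hs : (A.cell s).Nonempty) : vectorSpan ℝ (A.cell s) = A.dir s := by
  apply le_antisymm
  · rw [vectorSpan_def, Submodule.span_le]
    rintro _ ⟨x, hx, y, hy, rfl⟩
    exact A.sub_mem_dir (fun _ _ => rfl) hy hx
  · intro v hv
    obtain ⟨x, hx⟩ := hs
    obtain ⟨t, ht, ht0⟩ := ((A.eventually_mem_cell_move hx v).and self_mem_nhdsWithin).exists
    rw [A.move_of_mem_dir hv] at ht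
    have h1 := vsub_mem_vectorSpan ℝ ht hx
    have h2 : v = t⁻¹ • ((x + t • v) -ᵥ x) := by
      rw [vsub_eq_sub, add_sub_cancel_left, smul_smul, inv_mul_cancel₀ (ne_of_gt ht0), one_smul]
    rw [h2]
    exact Submodule.smul_mem _ _ h1

/-! ### Incidence numbers as signs of volume forms -/

variable (O : ∀ τ : Set E, CellOrientation τ)

open Classical in
/-- The incidence numbers of the cells. -/
def inc (s' s : A.Realized) : ℤ :=
  if Face s.1 s'.1 ∧ finrank ℝ (A.dir s'.1) = finrank ℝ (A.dir s.1) + 1 then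
    incidenceSign (A.cell s'.1) (A.cell s.1) (O _) (O _)
  else 0

variable {A O} in
theorem inc_ne_zero {s' s : A.Realized} (h : A.inc O s' s ≠ 0) :
    Face s.1 s'.1 ∧ finrank ℝ (A.dir s'.1) = finrank ℝ (A.dir s.1) + 1 := by
  by_contra hn
  exact h (if_neg hn)

theorem inc_eq_one_or {s' s : A.Realized} (h : Face s.1 s'.1)
    (hd : finrank ℝ (A.dir s'.1) = finrank ℝ (A.dir s.1) + 1) :
    A.inc O s' s = 1 ∨ A.inc O s' s = -1 := by
  rw [inc, if_pos ⟨h, hd⟩, incidenceSign]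
  split_ifs
  · exact Or.inl rfl
  · exact Or.inr rfl

/-- The form attached to the orientation of a cell. -/
def form (s : A.Realized) (m : ℕ) : E [⋀^Fin m]→ₗ[ℝ] ℝ := orientationForm _ (O (A.cell s.1)) m

variable [FiniteDimensional ℝ E]

theorem _root_.Submodule.exists_smul_add_of_finrank {L L' : Submodule ℝ E} (hle : L ≤ L')
    (h : finrank ℝ L' = finrank ℝ L + 1) {v : E} (hv : v ∈ L') (hvL : v ∉ L) {w : E} (hw : w ∈ L') :
    ∃ t : ℝ, ∃ l ∈ L, w = t • v + l := by
  have h1 : L ⊔ Submodule.span ℝ {v} ≤ L' :=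
    sup_le hle ((Submodule.span_singleton_le_iff_mem _ _).2 hv)
  have h2 : L < L ⊔ Submodule.span ℝ {v} := by
    refine lt_of_le_of_ne le_sup_left fun h => hvL ?_
    rw [h]
    exact (le_sup_right : _ ≤ L ⊔ Submodule.span ℝ {v}) (Submodule.mem_span_singleton_self v)
  have h3 := Submodule.finrank_lt_finrank_of_lt h2
  have h4 : L ⊔ Submodule.span ℝ {v} = L' := Submodule.eq_of_le_of_finrank_le h1 (by omega)
  rw [← h4] at hw
  obtain ⟨l, hl, y, hy, rfl⟩ := Submodule.mem_sup.1 hw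
  obtain ⟨t, rfl⟩ := Submodule.mem_span_singleton.1 hy
  exact ⟨t, l, hl, add_comm _ _⟩

/-- Supplies the positivity needed in `agreesWithInduced_iff`: `v` points from the smaller cell into
the larger one, so `-v` points outward. -/
theorem exists_sub_eq {s s' : A.Realized} {v : E} (hv : s'.1 = A.move s.1 v)
    (hd : finrank ℝ (A.dir s'.1) = finrank ℝ (A.dir s.1) + 1) {x x' : E} (hx : x ∈ A.cell s.1)
    (hx' : x' ∈ A.cell s'.1) : ∃ t : ℝ, 0 < t ∧ ∃ l ∈ A.dir s.1, x - x' = t • (-v) + l := by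
  have hface : Face s.1 s'.1 := hv ▸ A.face_move _ _
  have hvs' : v ∈ A.dir s'.1 := hv ▸ A.mem_dir_move _ _
  have hvs : v ∉ A.dir s.1 := fun h => by
    rw [hv, A.move_of_mem_dir h] at hd
    omega
  obtain ⟨t, l, hl, htl⟩ := Submodule.exists_smul_add_of_finrank (hface.dir_le A) hd hvs' hvs
    (A.sub_mem_dir hface hx hx')
  refine ⟨t, ?_, -l, neg_mem hl, by rw [← neg_sub, htl]; simp [add_comm]⟩
  -- A hyperplane through the smaller cell that does not contain `v` determines the sign of `t`.
  obtain ⟨i, hi, hvi⟩ : ∃ i, s.1 i = 0 ∧ A.n i v ≠ 0 := by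
    simpa [mem_dir] using hvs
  have h1 := congrFun (A.eq_move hface hx hx') i
  rw [hv, htl, move, move, if_pos hi, if_pos hi, map_add, map_smul, hl i hi, add_zero, smul_eq_mul,
    sign_mul] at h1
  have h2 : SignType.sign (A.n i v) ≠ 0 := by rwa [ne_eq, sign_eq_zero_iff]
  by_contra hle
  rcases (not_lt.1 hle).eq_or_lt with h | h
  · rw [h, sign_zero, zero_mul] at h1
    exact h2 h1
  · rw [sign_neg h] at h1
    revert h1 h2
    generalize SignType.sign (A.n i v) = σ
    revert σ
    decide

variable [Finite I]

theorem form_ne_zero {s : A.Realized} {m : ℕ} (h : finrank ℝ (A.dir s.1) = m) {b : Fin m → E}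
    (hb : ∀ i, b i ∈ A.dir s.1) (hli : LinearIndependent ℝ b) : A.form O s m b ≠ 0 :=
  orientationForm_ne_zero _ (by rw [A.vectorSpan_cell s.2, h])
    (by rwa [A.vectorSpan_cell s.2]) hli

/-- The incidence number in terms of the forms of the cells. -/
theorem inc_eq_sign {s s' : A.Realized} {v : E} (hv : s'.1 = A.move s.1 v) {m : ℕ}
    (hm : finrank ℝ (A.dir s.1) = m) (hd : finrank ℝ (A.dir s'.1) = m + 1) {b : Fin m → E}
    (hb : ∀ i, b i ∈ A.dir s.1) (hli : LinearIndependent ℝ b) :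
    A.inc O s' s =
      (SignType.sign (A.form O s m b * A.form O s' (m + 1) (Matrix.vecCons (-v) b)) : ℤ) := by
  have hface : Face s.1 s'.1 := hv ▸ A.face_move _ _
  have hvs' : v ∈ A.dir s'.1 := hv ▸ A.mem_dir_move _ _
  have hvs : v ∉ A.dir s.1 := fun h => by
    rw [hv, A.move_of_mem_dir h] at hd
    omega
  have h1 := A.vectorSpan_cell s.2
  have h2 := A.vectorSpan_cell s'.2
  have hb0 := A.form_ne_zero O hm hb hli
  have hiff := agreesWithInduced_iff (o := O (A.cell s.1)) (o' := O (A.cell s'.1)) (u := -v)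
    (by rw [h1, h2]; exact hface.dir_le A)
    (by rw [h1, hm]) (by rw [h2, hd]) s.2 s'.2 (by rw [h2]; exact neg_mem hvs')
    (fun x hx x' hx' => by rw [h1]; exact A.exists_sub_eq hv (by omega) hx hx')
    (b := b) (by rwa [h1]) hb0
  have hli' : LinearIndependent ℝ (Matrix.vecCons (-v) b) := by
    refine linearIndependent_finCons.2 ⟨hli, fun h => hvs ?_⟩
    rw [← neg_mem_iff]
    exact Submodule.span_le.2 (Set.range_subset_iff.2 hb) h
  have hb1 : A.form O s' (m + 1) (Matrix.vecCons (-v) b) ≠ 0 := by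
    refine A.form_ne_zero O hd (fun i => ?_) hli'
    refine Fin.cases ?_ (fun j => ?_) i
    · simpa using hvs'
    · simpa using hface.dir_le A (hb j)
  rw [inc, if_pos ⟨hface, by omega⟩, incidenceSign]
  rcases lt_or_gt_of_ne (mul_ne_zero hb0 hb1) with h | h
  · rw [if_neg (fun h' => absurd (hiff.1 h') h.not_gt), sign_neg h]
    rfl
  · rw [if_pos (hiff.2 h), sign_pos h]
    rfl

end Arrangement

end

/-! ### The diamond property and the square of the differential -/

section

theorem sign_eq_sign_of_mul_pos {a b : ℝ} (h : 0 < a * b) : SignType.sign a = SignType.sign b := by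
  rcases pos_and_pos_or_neg_and_neg_of_mul_pos h with ⟨ha, hb⟩ | ⟨ha, hb⟩
  · rw [sign_pos ha, sign_pos hb]
  · rw [sign_neg ha, sign_neg hb]

/-- The least ratio `β i / (-α i)` over the decreasing functions is the first zero; the others stay
positive. -/
theorem exists_first_zero {I : Type*} {J : Finset I} {α β : I → ℝ} (hβ : ∀ i ∈ J, 0 < β i)
    (h : ∃ i ∈ J, α i < 0) :
    ∃ t : ℝ, 0 < t ∧ (∀ i ∈ J, 0 ≤ β i + t * α i) ∧ ∃ i ∈ J, α i < 0 ∧ β i + t * α i = 0 := by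
  classical
  obtain ⟨i₀, hi₀, hmin⟩ := (J.filter fun i => α i < 0).exists_min_image (fun i => β i / (-α i))
    (by obtain ⟨i, hi, h⟩ := h; exact ⟨i, Finset.mem_filter.2 ⟨hi, h⟩⟩)
  obtain ⟨hi₀J, hα⟩ := Finset.mem_filter.1 hi₀
  have ht : 0 < β i₀ / (-α i₀) := div_pos (hβ i₀ hi₀J) (by linarith)
  refine ⟨_, ht, fun i hi => ?_, i₀, hi₀J, hα, ?_⟩
  · rcases le_or_gt 0 (α i) with h | h
    · exact add_nonneg (hβ i hi).le (mul_nonneg ht.le h)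
    · have := (le_div_iff₀ (by linarith)).1 (hmin i (Finset.mem_filter.2 ⟨hi, h⟩))
      linarith
  · rw [div_neg, neg_mul, div_mul_cancel₀ _ hα.ne, add_neg_cancel]

namespace Arrangement

variable {E : Type*} [NormedAddCommGroup E] [NormedSpace ℝ E] {I : Type*} (A : Arrangement E I)
  [Finite I] [FiniteDimensional ℝ E]

/-- Between cells whose dimensions differ by two there are exactly two cells. -/
theorem exists_two_intermediate {s s'' : A.Realized} (hface : Face s.1 s''.1)
    (hd : finrank ℝ (A.dir s''.1) = finrank ℝ (A.dir s.1) + 2) :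
    ∃ v w : E, v ∈ A.dir s''.1 ∧ w ∈ A.dir s''.1 ∧ w ∉ A.dir s.1 ∧
      (∀ t : ℝ, ∀ l ∈ A.dir s.1, v ≠ t • w + l) ∧
      ∃ t₁ t₂ : ℝ, 0 < t₁ ∧ t₂ < 0 ∧
        (∀ t, t = t₁ ∨ t = t₂ → Face (A.move s.1 (v + t • w)) s''.1 ∧
          finrank ℝ (A.dir (A.move s.1 (v + t • w))) = finrank ℝ (A.dir s.1) + 1 ∧
          s''.1 = A.move (A.move s.1 (v + t • w)) v) ∧
        A.move s.1 (v + t₁ • w) ≠ A.move s.1 (v + t₂ • w) ∧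
        ∀ s' : A.Realized, Face s.1 s'.1 → Face s'.1 s''.1 →
          finrank ℝ (A.dir s'.1) = finrank ℝ (A.dir s.1) + 1 →
          s'.1 = A.move s.1 (v + t₁ • w) ∨ s'.1 = A.move s.1 (v + t₂ • w) := by
  classical
  cases nonempty_fintype I
  obtain ⟨x, hx⟩ := s.2
  obtain ⟨x'', hx''⟩ := s''.2
  -- Picture: a two-dimensional section of the tangent cone of the large cell along the small one.
  -- On the line `v + t • w`, where `φ` is constant, this cone cuts out an interval, and its two
  -- ends give the intermediate cells.
  set v := x'' - x with hvdef
  have hv : v ∈ A.dir s''.1 := A.sub_mem_dir hface hx hx''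
  have hmv : s''.1 = A.move s.1 v := A.eq_move hface hx hx''
  have hle := hface.dir_le A
  -- a functional that is positive on the tangent cone at the smaller cell
  let φ : Dual ℝ E := ∑ i with s.1 i = 0, A.n i v • A.n i
  have hφ : ∀ z, φ z = ∑ i with s.1 i = 0, A.n i v * A.n i z := fun z => by
    simp [φ, LinearMap.sum_apply]
  have hφs : ∀ l ∈ A.dir s.1, φ l = 0 := fun l hl => by
    rw [hφ]
    exact Finset.sum_eq_zero fun i hi => by rw [hl i (Finset.mem_filter.1 hi).2, mul_zero]
  have hvs : v ∉ A.dir s.1 := fun h => by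
    rw [A.move_of_mem_dir h] at hmv
    rw [hmv] at hd
    omega
  have hφv : 0 < φ v := by
    obtain ⟨i, hi, hvi⟩ : ∃ i, s.1 i = 0 ∧ A.n i v ≠ 0 := by simpa [mem_dir] using hvs
    rw [hφ]
    exact Finset.sum_pos' (fun j _ => mul_self_nonneg _)
      ⟨i, Finset.mem_filter.2 ⟨Finset.mem_univ _, hi⟩, mul_self_pos.2 hvi⟩
  -- the directions in the kernel of `φ`
  set H := LinearMap.ker φ ⊓ A.dir s''.1 with hH
  have hHs : A.dir s.1 ≤ H := le_inf (fun l hl => hφs l hl) hle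
  have hHd : finrank ℝ H = finrank ℝ (A.dir s.1) + 1 := by
    have h1 : H < A.dir s''.1 := lt_of_le_of_ne inf_le_right fun h => by
      rw [← h] at hv
      exact hφv.ne' hv.1
    have h2 := Submodule.finrank_lt_finrank_of_lt h1
    have h3 := LinearMap.finrank_range_add_finrank_ker (φ.domRestrict (A.dir s''.1))
    have h4 : finrank ℝ (LinearMap.range (φ.domRestrict (A.dir s''.1))) ≤ 1 := by
      simpa using Submodule.finrank_le (LinearMap.range (φ.domRestrict (A.dir s''.1)))
    have h5 : finrank ℝ (LinearMap.ker (φ.domRestrict (A.dir s''.1))) ≤ finrank ℝ H := by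
      rw [← Submodule.finrank_map_subtype_eq]
      refine Submodule.finrank_mono ?_
      rintro _ ⟨y, hy, rfl⟩
      exact ⟨by simpa using hy, y.2⟩
    omega
  obtain ⟨w, hwH, hws⟩ : ∃ w ∈ H, w ∉ A.dir s.1 := by
    by_contra! hcon
    have := Submodule.finrank_mono (show H ≤ A.dir s.1 from hcon)
    omega
  have hw : w ∈ A.dir s''.1 := hwH.2
  have hφw : φ w = 0 := hwH.1
  -- The constraints that bound the tangent cone: hyperplanes through the small cell that do not
  -- contain the large one.
  let J : Finset I := Finset.univ.filter fun i => s.1 i = 0 ∧ A.n i v ≠ 0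
  have hJ : ∀ i, i ∈ J ↔ s.1 i = 0 ∧ A.n i v ≠ 0 := fun i => by simp [J]
  have hs''0 : ∀ i, s.1 i = 0 → (s''.1 i = 0 ↔ A.n i v = 0) := fun i hi => by
    rw [hmv, move, if_pos hi, sign_eq_zero_iff]
  have hnotJ : ∀ z ∈ A.dir s''.1, ∀ i, s.1 i = 0 → A.n i v = 0 → A.n i z = 0 :=
    fun z hz i hi h => hz i ((hs''0 i hi).2 h)
  have hβ : ∀ i ∈ J, 0 < A.n i v * A.n i v := fun i hi => mul_self_pos.2 ((hJ i).1 hi).2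
  -- As this sum is zero but not all its terms are, constraints of both signs occur, and the line
  -- leaves the cone in both directions.
  have hφJ : ∑ i ∈ J, A.n i v * A.n i w = 0 := by
    rw [← hφw, hφ]
    refine Finset.sum_subset (fun i hi => Finset.mem_filter.2 ⟨Finset.mem_univ _, ((hJ i).1 hi).1⟩)
      fun i hi hiJ => ?_
    have : A.n i v = 0 := by
      by_contra h
      exact hiJ ((hJ i).2 ⟨(Finset.mem_filter.1 hi).2, h⟩)
    rw [this, zero_mul]
  obtain ⟨i₀, hi₀, hi₀w⟩ : ∃ i ∈ J, A.n i v * A.n i w ≠ 0 := by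
    obtain ⟨i, hi, hwi⟩ : ∃ i, s.1 i = 0 ∧ A.n i w ≠ 0 := by simpa [mem_dir] using hws
    have hvi : A.n i v ≠ 0 := fun h => hwi (hnotJ w hw i hi h)
    exact ⟨i, (hJ i).2 ⟨hi, hvi⟩, mul_ne_zero hvi hwi⟩
  have hneg : ∃ i ∈ J, A.n i v * A.n i w < 0 := by
    by_contra! hcon
    exact hi₀w ((Finset.sum_eq_zero_iff_of_nonneg hcon).1 hφJ i₀ hi₀)
  have hpos : ∃ i ∈ J, -(A.n i v * A.n i w) < 0 := by
    by_contra! hcon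
    exact hi₀w (neg_eq_zero.1 ((Finset.sum_eq_zero_iff_of_nonneg hcon).1
      (by rw [Finset.sum_neg_distrib, hφJ, neg_zero]) i₀ hi₀))
  obtain ⟨t₁, ht₁, hge₁, i₁, hi₁, hα₁, hz₁⟩ := exists_first_zero hβ hneg
  obtain ⟨t₂, ht₂, hge₂, i₂, hi₂, hα₂, hz₂⟩ := exists_first_zero hβ hpos
  have hexp : ∀ i t, A.n i v * A.n i (v + t • w) =
      A.n i v * A.n i v + t * (A.n i v * A.n i w) := fun i t => by
    rw [map_add, map_smul, smul_eq_mul]; ring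
  have hface' : ∀ t : ℝ, (∀ i ∈ J, 0 ≤ A.n i v * A.n i (v + t • w)) →
      Face (A.move s.1 (v + t • w)) s''.1 := by
    intro t ht i hi
    rw [hmv]
    by_cases h : s.1 i = 0
    · simp only [move, if_pos h] at hi ⊢
      rw [ne_eq, sign_eq_zero_iff] at hi
      have hvi : A.n i v ≠ 0 := fun h' =>
        hi (hnotJ _ (add_mem hv (Submodule.smul_mem _ t hw)) i h h')
      exact sign_eq_sign_of_mul_pos
        (lt_of_le_of_ne (ht i ((hJ i).2 ⟨h, hvi⟩)) (mul_ne_zero hvi hi).symm)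
    · simp [move, if_neg h]
  have hmv' : ∀ t : ℝ, Face (A.move s.1 (v + t • w)) s''.1 →
      s''.1 = A.move (A.move s.1 (v + t • w)) v := by
    intro t ht
    funext i
    by_cases h : A.move s.1 (v + t • w) i = 0
    · rw [move, if_pos h, hmv, move, if_pos]
      by_contra h'
      exact h' (by rwa [move, if_neg h'] at h)
    · rw [ht i h]
      exact (if_neg h).symm
  -- A vanishing constraint makes the cell smaller than the large one, and `φ v > 0` makes it larger
  -- than the small one; this pins down its dimension.
  have hdim : ∀ t : ℝ, (∃ i ∈ J, A.n i v * A.n i (v + t • w) = 0) →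
      Face (A.move s.1 (v + t • w)) s''.1 →
      finrank ℝ (A.dir (A.move s.1 (v + t • w))) = finrank ℝ (A.dir s.1) + 1 := by
    rintro t ⟨i, hi, hz⟩ hf
    have h1 : A.dir s.1 < A.dir (A.move s.1 (v + t • w)) := by
      refine lt_of_le_of_ne ((A.face_move _ _).dir_le A) fun h => ?_
      have h2 : v + t • w ∈ A.dir s.1 := h ▸ A.mem_dir_move _ _
      have h3 := hφs _ h2
      rw [map_add, map_smul, hφw, smul_zero, add_zero] at h3
      exact hφv.ne' h3
    have h2 : A.dir (A.move s.1 (v + t • w)) < A.dir s''.1 := by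
      refine lt_of_le_of_ne (hf.dir_le A) fun h => ?_
      rw [← h] at hv
      have h4 := (hJ i).1 hi
      refine h4.2 (hv i ?_)
      rw [move, if_pos h4.1, (mul_eq_zero.1 hz).resolve_left h4.2, sign_zero]
    have h3 := Submodule.finrank_lt_finrank_of_lt h1
    have h4 := Submodule.finrank_lt_finrank_of_lt h2
    omega
  have hz₁' : A.n i₁ v * A.n i₁ (v + t₁ • w) = 0 := by rw [hexp, hz₁]
  have hz₂' : A.n i₂ v * A.n i₂ (v + (-t₂) • w) = 0 := by rw [hexp]; linarith
  have hge₁' : ∀ i ∈ J, 0 ≤ A.n i v * A.n i (v + t₁ • w) := fun i hi => by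
    rw [hexp]; exact hge₁ i hi
  have hge₂' : ∀ i ∈ J, 0 ≤ A.n i v * A.n i (v + (-t₂) • w) := fun i hi => by
    rw [hexp]; linarith [hge₂ i hi]
  refine ⟨v, w, hv, hw, hws, ?_, t₁, -t₂, ht₁, by linarith, ?_, ?_, ?_⟩
  · intro t l hl h
    have := congrArg φ h
    rw [map_add, map_smul, hφw, hφs l hl, smul_zero, add_zero] at this
    exact hφv.ne' this
  · rintro t (rfl | rfl)
    · exact ⟨hface' _ hge₁', hdim _ ⟨i₁, hi₁, hz₁'⟩ (hface' _ hge₁'), hmv' _ (hface' _ hge₁')⟩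
    · exact ⟨hface' _ hge₂', hdim _ ⟨i₂, hi₂, hz₂'⟩ (hface' _ hge₂'), hmv' _ (hface' _ hge₂')⟩
  · intro h
    have h1 := congrFun h i₁
    obtain ⟨hs, hvi⟩ := (hJ i₁).1 hi₁
    rw [move, move, if_pos hs, if_pos hs, (mul_eq_zero.1 hz₁').resolve_left hvi, sign_zero,
      eq_comm, sign_eq_zero_iff] at h1
    have h2 := hexp i₁ (-t₂)
    rw [h1, mul_zero] at h2
    have h3 := hβ i₁ hi₁
    nlinarith
  · intro s' hs' hs'' hd'
    obtain ⟨x', hx'⟩ := s'.2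
    have hz := A.sub_mem_dir hs' hx hx'
    have hs'z := A.eq_move hs' hx hx'
    set z := x' - x
    have hzs'' : z ∈ A.dir s''.1 := hs''.dir_le A hz
    have hzs : z ∉ A.dir s.1 := fun h => by
      rw [A.move_of_mem_dir h] at hs'z
      rw [hs'z] at hd'
      omega
    have hvz : ∀ i, s.1 i = 0 → 0 ≤ A.n i v * A.n i z := by
      intro i hi
      by_cases h : A.n i z = 0
      · rw [h, mul_zero]
      · have h1 : s'.1 i = SignType.sign (A.n i z) := by rw [hs'z, move, if_pos hi]
        have h2 := hs'' i (by rw [h1]; rwa [ne_eq, sign_eq_zero_iff])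
        rw [h1, hmv, move, if_pos hi] at h2
        rcases lt_or_gt_of_ne h with h3 | h3
        · rw [sign_neg h3, sign_eq_neg_one_iff] at h2
          exact (mul_pos_of_neg_of_neg h2 h3).le
        · rw [sign_pos h3, sign_eq_one_iff] at h2
          exact (mul_pos h2 h3).le
    have hφz : 0 < φ z := by
      obtain ⟨i, hi, hzi⟩ : ∃ i, s.1 i = 0 ∧ A.n i z ≠ 0 := by simpa [mem_dir] using hzs
      rw [hφ]
      refine Finset.sum_pos' (fun j hj => hvz j (Finset.mem_filter.1 hj).2)
        ⟨i, Finset.mem_filter.2 ⟨Finset.mem_univ _, hi⟩, lt_of_le_of_ne (hvz i hi) ?_⟩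
      exact (mul_ne_zero (fun h => hzi (hnotJ z hzs'' i hi h)) hzi).symm
    -- Rescaled to the level of `φ v`, an intermediate direction lies on the line modulo the
    -- directions of the small cell.
    set a := φ z / φ v
    have ha : 0 < a := div_pos hφz hφv
    have hker : z - a • v ∈ H := by
      refine ⟨?_, sub_mem hzs'' (Submodule.smul_mem _ _ hv)⟩
      change φ (z - a • v) = 0
      rw [map_sub, map_smul, smul_eq_mul, div_mul_cancel₀ _ hφv.ne', sub_self]
    obtain ⟨c, l, hl, hcl⟩ := Submodule.exists_smul_add_of_finrank hHs hHd hwH hws hker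
    have hzeq : z = a • (v + (c / a) • w) + l := by
      rw [smul_add, smul_smul, mul_div_cancel₀ _ ha.ne', add_assoc, ← hcl]
      abel
    rw [hzeq, A.move_smul_add ha hl] at hs'z
    set t := c / a
    have hge : ∀ i ∈ J, 0 ≤ A.n i v * A.n i v + t * (A.n i v * A.n i w) := by
      intro i hi
      have h1 := ((hJ i).1 hi).1
      have h2 := hvz i h1
      rw [hzeq, map_add, hl i h1, add_zero, map_smul, smul_eq_mul] at h2
      rw [← hexp]
      refine (mul_nonneg_iff_of_pos_left ha).1 ?_
      linarith
    have hle₁ : t ≤ t₁ := by nlinarith [hge i₁ hi₁]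
    have hle₂ : -t₂ ≤ t := by nlinarith [hge i₂ hi₂]
    rcases hle₁.eq_or_lt with h1 | h1
    · left; rw [hs'z, h1]
    rcases hle₂.eq_or_lt with h2 | h2
    · right; rw [hs'z, h2]
    exfalso
    -- Strictly between the ends all constraints are strict, and the cell would be the large one
    -- itself.
    have hpos' : ∀ i ∈ J, 0 < A.n i v * A.n i (v + t • w) := by
      intro i hi
      rw [hexp]
      have h3 := hge₁ i hi
      have h4 := hge₂ i hi
      have h5 := hβ i hi
      rcases lt_trichotomy (A.n i v * A.n i w) 0 with h6 | h6 | h6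
      · nlinarith
      · rw [h6, mul_zero, add_zero]; exact h5
      · nlinarith
    have heq : s'.1 = s''.1 := by
      funext i
      rw [hs'z, hmv]
      by_cases hi : s.1 i = 0
      · rw [move, move, if_pos hi, if_pos hi]
        by_cases hvi : A.n i v = 0
        · rw [hvi, hnotJ _ (add_mem hv (Submodule.smul_mem _ t hw)) i hi hvi]
        · exact (sign_eq_sign_of_mul_pos (hpos' i ((hJ i).2 ⟨hi, hvi⟩))).symm
      · rw [move, move, if_neg hi, if_neg hi]
    rw [heq] at hd'
    omega

variable (O : ∀ τ : Set E, CellOrientation τ)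

/-- Only the two cells reached along `v + t • w` contribute. The form of such a cell enters squared,
so its orientation drops out. What remains is the sign of `t` times a common factor, and `t₁ > 0 >
t₂`. -/
theorem sum_inc_mul_inc (s'' s : A.Realized) : ∑ s', A.inc O s'' s' * A.inc O s' s = 0 := by
  classical
  by_cases hcase : Face s.1 s''.1 ∧ finrank ℝ (A.dir s''.1) = finrank ℝ (A.dir s.1) + 2
  swap
  · refine Finset.sum_eq_zero fun s' _ => ?_
    by_contra hne
    obtain ⟨h1, h2⟩ := inc_ne_zero (left_ne_zero_of_mul hne)
    obtain ⟨h3, h4⟩ := inc_ne_zero (right_ne_zero_of_mul hne)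
    exact hcase ⟨h3.trans h1, by omega⟩
  obtain ⟨hface, hd⟩ := hcase
  obtain ⟨v, w, hv, hw, hws, hvws, t₁, t₂, ht₁, ht₂, hprop, hne, huniq⟩ :=
    A.exists_two_intermediate hface hd
  let c : ℝ → A.Realized := fun t => ⟨A.move s.1 (v + t • w), A.cell_move_nonempty s.2 _⟩
  have hcne : c t₁ ≠ c t₂ := fun h => hne (congrArg Subtype.val h)
  have hsum : ∑ s', A.inc O s'' s' * A.inc O s' s =
      A.inc O s'' (c t₁) * A.inc O (c t₁) s + A.inc O s'' (c t₂) * A.inc O (c t₂) s := by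
    rw [← Finset.sum_pair (f := fun s' => A.inc O s'' s' * A.inc O s' s) hcne]
    symm
    refine Finset.sum_subset (Finset.subset_univ _) fun s' _ hs' => ?_
    by_contra hne'
    obtain ⟨h1, h2⟩ := inc_ne_zero (left_ne_zero_of_mul hne')
    obtain ⟨h3, h4⟩ := inc_ne_zero (right_ne_zero_of_mul hne')
    apply hs'
    simp only [Finset.mem_insert, Finset.mem_singleton]
    exact (huniq s' h3 h1 h4).imp Subtype.ext Subtype.ext
  rw [hsum]
  set m := finrank ℝ (A.dir s.1) with hm
  let bs := Module.finBasis ℝ (A.dir s.1)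
  let b : Fin m → E := fun i => bs i
  have hb : ∀ i, b i ∈ A.dir s.1 := fun i => (bs i).2
  have hli : LinearIndependent ℝ b := bs.linearIndependent.map' _ (Submodule.ker_subtype _)
  set F := A.form O s'' (m + 1 + 1)
  have hcomp : ∀ t, t = t₁ ∨ t = t₂ → A.inc O s'' (c t) * A.inc O (c t) s =
      (SignType.sign (A.form O s m b * (t * F (Matrix.vecCons v (Matrix.vecCons w b)))) : ℤ) := by
    intro t ht
    obtain ⟨h1, h2, h3⟩ := hprop t ht
    have hy : v + t • w ∉ A.dir s.1 := fun h => hvws (-t) _ h (by simp)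
    have hyc : v + t • w ∈ A.dir (c t).1 := A.mem_dir_move _ _
    have hb' : ∀ i, (Matrix.vecCons (-(v + t • w)) b) i ∈ A.dir (c t).1 := fun i => by
      refine Fin.cases ?_ (fun j => ?_) i
      · simpa using neg_mem hyc
      · simpa using (A.face_move _ _).dir_le A (hb j)
    have hli' : LinearIndependent ℝ (Matrix.vecCons (-(v + t • w)) b) := by
      refine linearIndependent_finCons.2 ⟨hli, fun h => hy ?_⟩
      rw [← neg_mem_iff]
      exact Submodule.span_le.2 (Set.range_subset_iff.2 hb) h
    have e1 := A.inc_eq_sign O (s := s) (s' := c t) rfl rfl h2 hb hli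
    have e2 := A.inc_eq_sign O (s := c t) (s' := s'') h3 h2 (by omega) hb' hli'
    have hne0 := A.form_ne_zero O (s := c t) h2 hb' hli'
    rw [e1, e2, ← SignType.coe_mul, ← sign_mul]
    congr 1
    -- By alternation only the `w`-term of `v + t • w` survives, and the two minus signs cancel.
    have e3 : F (Matrix.vecCons (-v) (Matrix.vecCons (-(v + t • w)) b)) =
        t * F (Matrix.vecCons v (Matrix.vecCons w b)) := by
      have key : ∀ y, F (Matrix.vecCons y (Matrix.vecCons y b)) = 0 := fun y =>
        F.map_eq_zero_of_eq _ (i := 0) (j := 1) rfl (by simp)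
      have hlin : ∀ (r : ℝ) (p q : E), F (Matrix.vecCons p (Matrix.vecCons (r • q) b)) =
          r * F (Matrix.vecCons p (Matrix.vecCons q b)) := by
        intro r p q
        have := (F.curryLeft p).map_vecCons_smul b r q
        simpa using this
      have hadd : ∀ (p q q' : E), F (Matrix.vecCons p (Matrix.vecCons (q + q') b)) =
          F (Matrix.vecCons p (Matrix.vecCons q b)) +
            F (Matrix.vecCons p (Matrix.vecCons q' b)) := by
        intro p q q'
        have := (F.curryLeft p).map_vecCons_add b q q'
        simpa using this
      have h5 : -(v + t • w) = (-1 : ℝ) • (v + t • w) := (neg_one_smul ℝ _).symm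
      have h6 : -v = (-1 : ℝ) • v := by simp
      rw [h5, hlin, hadd, hlin, h6, AlternatingMap.map_vecCons_smul,
        AlternatingMap.map_vecCons_smul, key]
      simp
    rw [e3]
    set P := A.form O (c t) (m + 1) (Matrix.vecCons (-(v + t • w)) b)
    rw [show P * (t * F (Matrix.vecCons v (Matrix.vecCons w b))) * (A.form O s m b * P) =
      (P * P) * (A.form O s m b * (t * F (Matrix.vecCons v (Matrix.vecCons w b)))) by ring,
      sign_mul, sign_pos (mul_self_pos.2 hne0), one_mul]
  rw [hcomp t₁ (Or.inl rfl), hcomp t₂ (Or.inr rfl)]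
  simp only [sign_mul, sign_pos ht₁, sign_neg ht₂]
  generalize SignType.sign (A.form O s m b) = p
  generalize SignType.sign (F (Matrix.vecCons v (Matrix.vecCons w b))) = q
  revert p q
  decide

end Arrangement

end

/-! ### One-dimensional homology of strata -/

section

theorem sign_lineMap {a b r : ℝ} {σ : SignType} (ha : SignType.sign a = σ)
    (hb : SignType.sign b = σ) (h0 : 0 ≤ r) (h1 : r ≤ 1) :
    SignType.sign (a + r * (b - a)) = σ := by
  cases σ
  · have ha' : a = 0 := sign_eq_zero_iff.1 ha
    have hb' : b = 0 := sign_eq_zero_iff.1 hb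
    simp [ha', hb']
  · have ha' : a < 0 := sign_eq_neg_one_iff.1 ha
    have hb' : b < 0 := sign_eq_neg_one_iff.1 hb
    refine sign_eq_neg_one_iff.2 ?_
    rcases h0.eq_or_lt with rfl | h0'
    · simpa using ha'
    · nlinarith [mul_neg_of_pos_of_neg h0' hb', mul_nonneg (sub_nonneg.2 h1) (neg_pos.2 ha').le]
  · have ha' : 0 < a := sign_eq_one_iff.1 ha
    have hb' : 0 < b := sign_eq_one_iff.1 hb
    refine sign_eq_one_iff.2 ?_
    rcases h0.eq_or_lt with rfl | h0'
    · simpa using ha'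
    · nlinarith [mul_pos h0' hb', mul_nonneg (sub_nonneg.2 h1) ha'.le]

namespace Arrangement

variable {E : Type*} [NormedAddCommGroup E] [NormedSpace ℝ E] {I : Type*} (A : Arrangement E I)

/-! ### Strata -/

/-- The cells whose signs on `G` are given by `t`. -/
def stratum (G : Finset I) (t : I → SignType) : Set A.Realized := {s | ∀ i ∈ G, s.1 i = t i}

/-- The direction of a stratum. -/
def stratumDir (G : Finset I) (t : I → SignType) : Submodule ℝ E where
  carrier := {v | ∀ i ∈ G, t i = 0 → A.n i v = 0}
  zero_mem' := by simp
  add_mem' ha hb i hG hi := by rw [map_add, ha i hG hi, hb i hG hi, add_zero]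
  smul_mem' c v hv i hG hi := by rw [map_smul, hv i hG hi, smul_zero]

variable {A} {G : Finset I} {t : I → SignType}

theorem dir_le_stratumDir {s : A.Realized} (hs : s ∈ A.stratum G t) :
    A.dir s.1 ≤ A.stratumDir G t := fun _ hv i hG hi => hv i (by rw [hs i hG, hi])

theorem move_mem_stratum [Finite I] [FiniteDimensional ℝ E] {s : A.Realized}
    (hs : s ∈ A.stratum G t) {v : E} (hv : v ∈ A.stratumDir G t) :
    (⟨A.move s.1 v, A.cell_move_nonempty s.2 v⟩ : A.Realized) ∈ A.stratum G t := by
  intro i hG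
  by_cases h : s.1 i = 0
  · have h0 : t i = 0 := by rw [← hs i hG, h]
    exact (if_pos h).trans (by rw [hv i hG h0, sign_zero, h0])
  · exact (if_neg h).trans (hs i hG)

theorem sub_mem_stratumDir {s s' : A.Realized} (hs : s ∈ A.stratum G t) (hs' : s' ∈ A.stratum G t)
    {x x' : E} (hx : x ∈ A.cell s.1) (hx' : x' ∈ A.cell s'.1) : x' - x ∈ A.stratumDir G t := by
  intro i hG hi
  have h1 : A.n i x = A.d i := A.signs_eq_zero_iff.1 (by rw [hx.2, hs i hG, hi])
  have h2 : A.n i x' = A.d i := A.signs_eq_zero_iff.1 (by rw [hx'.2, hs' i hG, hi])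
  rw [map_sub, h1, h2, sub_self]

/-- The segment joining points of the two cells meets the hyperplane; it stays in `V` by convexity,
and the signs on `G` are constant along it because they agree at its ends. -/
theorem exists_cut {i : I} {s₁ s₂ : A.Realized} (h₁ : s₁ ∈ A.stratum G t)
    (h₂ : s₂ ∈ A.stratum G t) (hlt : s₁.1 i < s₂.1 i) :
    ∃ s₀ ∈ A.stratum G t, s₀.1 i = 0 ∧ ∃ v ∈ A.stratumDir G t, 0 < A.n i v := by
  obtain ⟨x₁, hx₁⟩ := s₁.2
  obtain ⟨x₂, hx₂⟩ := s₂.2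
  have e₁ : SignType.sign (A.n i x₁ - A.d i) = s₁.1 i := congrFun hx₁.2 i
  have e₂ : SignType.sign (A.n i x₂ - A.d i) = s₂.1 i := congrFun hx₂.2 i
  have hlt' : A.n i x₁ - A.d i < A.n i x₂ - A.d i := by
    by_contra hle
    have := SignType.sign.monotone (not_lt.1 hle)
    rw [e₁, e₂] at this
    exact absurd hlt this.not_gt
  have hv : 0 < A.n i (x₂ - x₁) := by rw [map_sub]; linarith
  suffices h : ∃ s₀ ∈ A.stratum G t, s₀.1 i = 0 by
    obtain ⟨s₀, h1, h2⟩ := h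
    exact ⟨s₀, h1, h2, x₂ - x₁, sub_mem_stratumDir h₁ h₂ hx₁ hx₂, hv⟩
  by_cases h1 : s₁.1 i = 0
  · exact ⟨s₁, h₁, h1⟩
  by_cases h2 : s₂.1 i = 0
  · exact ⟨s₂, h₂, h2⟩
  have hs : s₁.1 i = -1 ∧ s₂.1 i = 1 := by
    revert hlt h1 h2
    generalize s₁.1 i = σ
    generalize s₂.1 i = σ'
    revert σ σ'
    decide
  rw [hs.1, sign_eq_neg_one_iff] at e₁
  rw [hs.2, sign_eq_one_iff] at e₂
  set r := (A.d i - A.n i x₁) / A.n i (x₂ - x₁) with hr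
  have hr0 : 0 ≤ r := div_nonneg (by linarith) hv.le
  have hr1 : r ≤ 1 := (div_le_one hv).2 (by rw [map_sub]; linarith)
  have hxV : x₁ + r • (x₂ - x₁) ∈ A.V := A.convex.add_smul_sub_mem hx₁.1 hx₂.1 ⟨hr0, hr1⟩
  have hval : ∀ j, A.n j (x₁ + r • (x₂ - x₁)) - A.d j =
      (A.n j x₁ - A.d j) + r * ((A.n j x₂ - A.d j) - (A.n j x₁ - A.d j)) := fun j => by
    simp only [map_add, map_smul, map_sub, smul_eq_mul]
    ring
  refine ⟨⟨A.signs (x₁ + r • (x₂ - x₁)), _, hxV, rfl⟩, fun j hj => ?_, ?_⟩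
  · change SignType.sign (A.n j (x₁ + r • (x₂ - x₁)) - A.d j) = t j
    rw [hval]
    refine sign_lineMap ?_ ?_ hr0 hr1
    · rw [← h₁ j hj]; exact congrFun hx₁.2 j
    · rw [← h₂ j hj]; exact congrFun hx₂.2 j
  · refine A.signs_eq_zero_iff.2 ?_
    rw [map_add, map_smul, smul_eq_mul, hr, div_mul_cancel₀ _ hv.ne']
    ring

variable {O : ∀ τ : Set E, CellOrientation τ}

/-- Along faces a sign can only change from zero to nonzero, so a sign that agrees at both ends is
constant in between. -/
theorem incidenceConvex_stratum : IncidenceConvex (A.inc O) (A.stratum G t) := by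
  intro s hs s'' hs'' s' h1 h2 i hG
  obtain ⟨h1, -⟩ := inc_ne_zero h1
  obtain ⟨h2, -⟩ := inc_ne_zero h2
  by_cases h : s.1 i = 0
  · by_contra h3
    have h4 : s'.1 i ≠ 0 := fun h0 => h3 (by rw [h0, ← hs i hG, h])
    exact h3 (by rw [← h1 i h4, hs'' i hG])
  · rw [h2 i h, hs i hG]

variable [Finite I] [FiniteDimensional ℝ E]

variable (O) in
-- A stratum is convex and relatively open, so its cells should carry a single class, in top degree.
-- Induction on the number of hyperplanes not in `G`: one that cuts the stratum divides it into two
-- open halves and a wall, each a stratum with one more fixed sign, and `HasAugmentation.of_cut`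
-- glues them. Units on the full-dimensional cells and zeros elsewhere are what the induction
-- reproduces on the wall.
theorem hasAugmentation_stratum {k : Type*} [Field k] (a : A.Realized → ℤ)
    (hne : (A.stratum G t).Nonempty) (ha : IsCocycleOn (A.inc O) a (A.stratum G t))
    (ha1 : ∀ s ∈ A.stratum G t, finrank ℝ (A.dir s.1) = finrank ℝ (A.stratumDir G t) →
      a s = 1 ∨ a s = -1)
    (ha0 : ∀ s ∈ A.stratum G t, finrank ℝ (A.dir s.1) ≠ finrank ℝ (A.stratumDir G t) →
      a s = 0) : HasAugmentation (A.inc O) k a (A.stratum G t) := by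
  classical
  cases nonempty_fintype I
  induction hc : Gᶜ.card generalizing G t a with
  | zero =>
    -- All signs are fixed, so the stratum is a single cell, on which `a` is a unit.
    have hG : G = Finset.univ := by simpa using hc
    obtain ⟨s, hs⟩ := hne
    have hst : s.1 = t := funext fun i => hs i (by simp [hG])
    have huniq : ∀ s', s' ∈ A.stratum G t ↔ s' = s := fun s' => by
      refine ⟨fun h => Subtype.ext (funext fun i => ?_), fun h => h ▸ hs⟩
      have hi : i ∈ G := by simp [hG]
      exact (h i hi).trans (hs i hi).symm
    have hdir : A.stratumDir G t = A.dir s.1 := by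
      ext v
      simp [stratumDir, mem_dir, hG, hst]
    have has := ha1 s hs (by rw [hdir])
    have hself : ∀ f : A.Realized → k, (∀ x ∉ A.stratum G t, f x = 0) →
        ∑ x, (a x : k) * f x = a s * f s := fun f hf => by
      refine Finset.sum_eq_single_of_mem s (Finset.mem_univ _) fun x _ hx => ?_
      rw [hf x fun h => hx ((huniq x).1 h), mul_zero]
    have has' : (a s : k) * a s = 1 := by
      rcases has with h | h <;> simp [h]
    refine ⟨fun f hf _ haf => ⟨0, fun _ _ => rfl, fun x hx => ?_⟩,
      fun x => if x = s then (a s : k) else 0, fun x hx => ?_, fun x hx => ?_, ?_⟩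
    · rw [hself f hf] at haf
      rw [(huniq x).1 hx, map_zero, Pi.zero_apply]
      have := congrArg (fun y => (a s : k) * y) haf
      simpa [← mul_assoc, has'] using this.symm
    · exact if_neg fun h => hx ((huniq x).2 h)
    · refine bd_eq_zero_of_incidence fun y hy => ?_
      have hys : y = s := by
        by_contra h
        exact hy (if_neg h)
      rw [(huniq x).1 hx, hys]
      by_contra h
      have := (inc_ne_zero h).2
      omega
    · rw [hself _ fun x hx => if_neg fun h => hx ((huniq x).2 h)]
      rw [if_pos rfl, has']
  | succ c ih =>
    obtain ⟨i, hi⟩ : ∃ i, i ∈ Gᶜ := Finset.card_pos.1 (by omega)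
    have hiG : i ∉ G := Finset.mem_compl.1 hi
    have hcard : (insert i G)ᶜ.card = c := by
      rw [Finset.compl_insert, Finset.card_erase_of_mem hi, hc]
      rfl
    have hupd : ∀ σ, ∀ j ∈ G, Function.update t i σ j = t j := fun σ j hj =>
      Function.update_of_ne (by rintro rfl; exact hiG hj) _ _
    have hmem : ∀ σ s, s ∈ A.stratum (insert i G) (Function.update t i σ) ↔
        s ∈ A.stratum G t ∧ s.1 i = σ := fun σ s => by
      constructor
      · refine fun h => ⟨fun j hj => ?_, ?_⟩
        · rw [h j (Finset.mem_insert_of_mem hj), hupd σ j hj]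
        · rw [h i (Finset.mem_insert_self _ _), Function.update_self]
      · rintro ⟨h, h'⟩ j hj
        rcases Finset.mem_insert.1 hj with rfl | hj
        · rw [h', Function.update_self]
        · rw [hupd σ j hj, h j hj]
    have hdirmem : ∀ σ v, v ∈ A.stratumDir (insert i G) (Function.update t i σ) ↔
        v ∈ A.stratumDir G t ∧ (σ = 0 → A.n i v = 0) := fun σ v => by
      constructor
      · refine fun h => ⟨fun j hj h0 => ?_, fun h0 => ?_⟩
        · exact h j (Finset.mem_insert_of_mem hj) (by rw [hupd σ j hj, h0])
        · exact h i (Finset.mem_insert_self _ _) (by rw [Function.update_self, h0])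
      · rintro ⟨h, h'⟩ j hj h0
        rcases Finset.mem_insert.1 hj with rfl | hj
        · exact h' (by rwa [Function.update_self] at h0)
        · exact h j hj (by rwa [hupd σ j hj] at h0)
    have hdir : ∀ σ, σ ≠ 0 → A.stratumDir (insert i G) (Function.update t i σ) =
        A.stratumDir G t := fun σ hσ => by
      ext v
      rw [hdirmem]
      exact ⟨fun h => h.1, fun h => ⟨h, fun h0 => absurd h0 hσ⟩⟩
    by_cases hcut : ∃ s₁ ∈ A.stratum G t, ∃ s₂ ∈ A.stratum G t, s₁.1 i < s₂.1 i
    swap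
    · -- the hyperplane does not cut the stratum
      obtain ⟨s, hs⟩ := hne
      have hconst : ∀ s' ∈ A.stratum G t, s'.1 i = s.1 i := by
        intro s' hs'
        by_contra hne'
        rcases lt_or_gt_of_ne hne' with h | h
        · exact hcut ⟨s', hs', s, hs, h⟩
        · exact hcut ⟨s, hs, s', hs', h⟩
      have heq : A.stratum (insert i G) (Function.update t i (s.1 i)) = A.stratum G t := by
        ext s'
        rw [hmem]
        exact ⟨fun h => h.1, fun h => ⟨h, hconst s' h⟩⟩
      -- If the constant sign is zero, small steps within the stratum keep it zero, so its
      -- directions already lie in the hyperplane.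
      have hdeq : A.stratumDir (insert i G) (Function.update t i (s.1 i)) =
          A.stratumDir G t := by
        ext v
        rw [hdirmem]
        refine ⟨fun h => h.1, fun h => ⟨h, fun h0 => ?_⟩⟩
        have h1 := hconst _ (move_mem_stratum hs h)
        have h2 : A.move s.1 v i = SignType.sign (A.n i v) := if_pos h0
        exact sign_eq_zero_iff.1 (h2.symm.trans (h1.trans h0))
      have := ih (G := insert i G) (t := Function.update t i (s.1 i)) a (by rw [heq]; exact ⟨s, hs⟩)
        (by rwa [heq]) (by rwa [heq, hdeq]) (by rwa [heq, hdeq]) hcard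
      rwa [heq] at this
    obtain ⟨s₁, h₁, s₂, h₂, hlt⟩ := hcut
    obtain ⟨s₀, hs₀, hs₀i, v, hv, hvi⟩ := exists_cut h₁ h₂ hlt
    have hsm := sum_inc_mul_inc A O
    have hconv : IncidenceConvex (A.inc O) (A.stratum G t) := incidenceConvex_stratum
    have hopen : ∀ σ, σ ≠ 0 → ∀ x ∈ A.stratum (insert i G) (Function.update t i σ),
        ∀ x' ∈ A.stratum G t, A.inc O x' x ≠ 0 →
          x' ∈ A.stratum (insert i G) (Function.update t i σ) := by
      intro σ hσ x hx x' hx' h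
      rw [hmem] at hx ⊢
      exact ⟨hx', by rw [(inc_ne_zero h).1 i (by rwa [hx.2]), hx.2]⟩
    have hdisj : ∀ σ σ', σ ≠ σ' → Disjoint (A.stratum (insert i G) (Function.update t i σ))
        (A.stratum (insert i G) (Function.update t i σ')) := by
      intro σ σ' hne'
      refine disjoint_left.2 fun x hx hx' => hne' ?_
      rw [← ((hmem _ _).1 hx).2, ((hmem _ _).1 hx').2]
    have hunion : A.stratum G t = A.stratum (insert i G) (Function.update t i 1) ∪
        A.stratum (insert i G) (Function.update t i (-1)) ∪
        A.stratum (insert i G) (Function.update t i 0) := by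
      ext x
      simp only [mem_union, hmem]
      refine ⟨fun h => ?_, ?_⟩
      · rcases hx : x.1 i with _ | _ | _
        · exact Or.inr ⟨h, rfl⟩
        · exact Or.inl (Or.inr ⟨h, rfl⟩)
        · exact Or.inl (Or.inl ⟨h, rfl⟩)
      · rintro ((h | h) | h) <;> exact h.1
    have hsub : ∀ σ, A.stratum (insert i G) (Function.update t i σ) ⊆ A.stratum G t :=
      fun σ x hx => ((hmem _ _).1 hx).1
    -- the open halves
    have hhalf : ∀ σ, σ ≠ 0 → (∃ u ∈ A.stratumDir G t, SignType.sign (A.n i u) = σ) →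
        HasAugmentation (A.inc O) k ((A.stratum (insert i G) (Function.update t i σ)).indicator a)
          (A.stratum (insert i G) (Function.update t i σ)) := by
      rintro σ hσ ⟨u, hu, hui⟩
      refine ih _ ⟨_, (hmem _ _).2 ⟨move_mem_stratum hs₀ hu, ?_⟩⟩
        ⟨fun x hx => indicator_of_notMem hx _, fun x hx => ?_⟩ (fun x hx h => ?_)
        (fun x hx h => ?_) hcard
      · exact (if_pos hs₀i).trans hui
      · rw [← ha.2 x (hsub σ hx)]
        refine Finset.sum_congr rfl fun x' _ => ?_
        by_cases h : x' ∈ A.stratum (insert i G) (Function.update t i σ)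
        · rw [indicator_of_mem h]
        · rw [indicator_of_notMem h, zero_mul]
          by_cases h' : A.inc O x' x = 0
          · rw [h', mul_zero]
          · rw [ha.1 x' fun h'' => h (hopen σ hσ x hx x' h'' h'), zero_mul]
      · rw [indicator_of_mem hx]
        exact ha1 x (hsub σ hx) (by rw [h, hdir σ hσ])
      · rw [indicator_of_mem hx]
        exact ha0 x (hsub σ hx) (by rwa [hdir σ hσ] at h)
    have hA := hhalf 1 one_ne_zero ⟨v, hv, sign_pos hvi⟩
    have hB := hhalf (-1) (by decide) ⟨-v, neg_mem hv, by
      rw [map_neg]; exact sign_neg (by linarith)⟩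
    -- the wall
    set P := A.stratum (insert i G) (Function.update t i 1) with hP
    set Z := A.stratum (insert i G) (Function.update t i 0) with hZ
    have hfin : finrank ℝ (A.stratumDir G t) =
        finrank ℝ (A.stratumDir (insert i G) (Function.update t i 0)) + 1 := by
      set L := A.stratumDir G t
      set L₀ := A.stratumDir (insert i G) (Function.update t i 0)
      have hle : L₀ ≤ L := fun w hw => ((hdirmem _ _).1 hw).1
      have hvL₀ : v ∉ L₀ := fun h => hvi.ne' (((hdirmem _ _).1 h).2 rfl)
      have h1 : L₀ < L := lt_of_le_of_ne hle fun h => hvL₀ (h ▸ hv)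
      have h2 := Submodule.finrank_lt_finrank_of_lt h1
      have h3 := LinearMap.finrank_range_add_finrank_ker ((A.n i).domRestrict L)
      have h4 : finrank ℝ (LinearMap.range ((A.n i).domRestrict L)) ≤ 1 := by
        simpa using Submodule.finrank_le (LinearMap.range ((A.n i).domRestrict L))
      have h5 : finrank ℝ (LinearMap.ker ((A.n i).domRestrict L)) ≤ finrank ℝ L₀ := by
        rw [← Submodule.finrank_map_subtype_eq]
        refine Submodule.finrank_mono ?_
        rintro _ ⟨y, hy, rfl⟩
        exact (hdirmem _ _).2 ⟨y.2, fun _ => by simpa using hy⟩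
      omega
    -- The connecting cocycle: the part of `a` on the positive side, composed with the boundary from
    -- the wall.
    let a₀ : A.Realized → ℤ := Z.indicator fun x => ∑ x', P.indicator a x' * A.inc O x' x
    have ha₀ : ∀ x ∈ Z, a₀ x = ∑ x', P.indicator a x' * A.inc O x' x := fun x hx =>
      indicator_of_mem hx _
    have hZ' : HasAugmentation (A.inc O) k a₀ Z := by
      refine ih a₀ ⟨s₀, (hmem _ _).2 ⟨hs₀, hs₀i⟩⟩
        (ha.connecting hsm (hsub 1) (hsub 0) hconv (hopen 1 one_ne_zero) ?_ ha₀
          fun x hx => indicator_of_notMem hx _) (fun x hx hd => ?_) (fun x hx hd => ?_) hcard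
      · intro x hx x' hx' _ x'' hx'' h
        by_cases h0 : x'.1 i = 0
        · exact Or.inr ((hmem _ _).2 ⟨hx', h0⟩)
        · refine Or.inl ((hmem _ _).2 ⟨hx', ?_⟩)
          rw [← (inc_ne_zero h).1 i h0, ((hmem _ _).1 hx'').2]
      · have hxW := ((hmem _ _).1 hx).1
        have hxi := ((hmem _ _).1 hx).2
        have hdirx : A.dir x.1 = A.stratumDir (insert i G) (Function.update t i 0) :=
          Submodule.eq_of_le_of_finrank_eq (dir_le_stratumDir hx) hd
        -- A full-dimensional cell of the wall has exactly one neighbour of one dimension more on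
        -- the positive side, reached along `v`; hence `a₀` is again a unit there.
        let y : A.Realized := ⟨A.move x.1 v, A.cell_move_nonempty x.2 v⟩
        have hyW : y ∈ A.stratum G t := move_mem_stratum hxW hv
        have hyP : y ∈ P := (hmem _ _).2 ⟨hyW, (if_pos hxi).trans (sign_pos hvi)⟩
        have hyd : finrank ℝ (A.dir y.1) = finrank ℝ (A.stratumDir G t) := by
          refine le_antisymm (Submodule.finrank_mono (dir_le_stratumDir hyW)) ?_
          have h1 : A.dir x.1 < A.dir y.1 :=
            lt_of_le_of_ne ((A.face_move _ _).dir_le A) fun h => by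
              have h2 : v ∈ A.dir x.1 := h ▸ A.mem_dir_move _ _
              exact hvi.ne' (h2 i hxi)
          have := Submodule.finrank_lt_finrank_of_lt h1
          omega
        have hsum : a₀ x = a y * A.inc O y x := by
          rw [ha₀ x hx, Finset.sum_eq_single_of_mem y (Finset.mem_univ _), indicator_of_mem hyP]
          intro x' _ hx'
          by_contra hne'
          have hx'P : x' ∈ P := by
            by_contra h
            exact left_ne_zero_of_mul hne' (indicator_of_notMem h _)
          obtain ⟨hf, hd'⟩ := inc_ne_zero (right_ne_zero_of_mul hne')
          apply hx'
          apply Subtype.ext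
          obtain ⟨p, hp⟩ := x.2
          obtain ⟨p', hp'⟩ := x'.2
          have hx'W := ((hmem _ _).1 hx'P).1
          have hz := sub_mem_stratumDir hxW hx'W hp hp'
          have hmv := A.eq_move hf hp hp'
          set z := p' - p
          have hzi : 0 < A.n i z := by
            have h1 := ((hmem _ _).1 hx'P).2
            rw [hmv, move, if_pos hxi, sign_eq_one_iff] at h1
            exact h1
          -- Modulo the directions of the wall cell, `z` is a positive multiple of `v`, so both lead
          -- to the same cell.
          have hl : z - (A.n i z / A.n i v) • v ∈ A.dir x.1 := by
            rw [hdirx, hdirmem]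
            refine ⟨sub_mem hz (Submodule.smul_mem _ _ hv), fun _ => ?_⟩
            rw [map_sub, map_smul, smul_eq_mul, div_mul_cancel₀ _ hvi.ne', sub_self]
          have hzeq : z = (A.n i z / A.n i v) • v + (z - (A.n i z / A.n i v) • v) := by abel
          rw [hmv, hzeq, A.move_smul_add (div_pos hzi hvi) hl]
        rw [hsum]
        rcases ha1 y hyW hyd with h1 | h1 <;>
          rcases A.inc_eq_one_or O (s' := y) (s := x) (A.face_move _ _) (by omega) with h2 | h2 <;>
          simp [h1, h2]
      -- A lower-dimensional cell of the wall is incident only to cells below full dimension, where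
      -- `a` vanishes.
      · rw [ha₀ x hx]
        refine Finset.sum_eq_zero fun x' _ => ?_
        by_contra hne'
        have hx'P : x' ∈ P := by
          by_contra h
          exact left_ne_zero_of_mul hne' (indicator_of_notMem h _)
        have h1 := left_ne_zero_of_mul hne'
        rw [indicator_of_mem hx'P] at h1
        obtain ⟨hf, hd'⟩ := inc_ne_zero (right_ne_zero_of_mul hne')
        refine hd ?_
        have h2 : finrank ℝ (A.dir x'.1) = finrank ℝ (A.stratumDir G t) := by
          by_contra h3
          exact h1 (ha0 x' (hsub 1 hx'P) h3)
        omega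
    exact HasAugmentation.of_cut hsm hunion (hdisj _ _ (by decide)) (hdisj _ _ (by decide))
      (hdisj _ _ (by decide)) hconv (hopen 1 one_ne_zero) (hopen (-1) (by decide)) ha
      (fun x hx => indicator_of_mem hx _) (fun x hx => indicator_of_mem hx _) ha₀ hA hB hZ'

end Arrangement

end

/-! ### Cells on the near side of several hyperplanes -/

section

namespace Arrangement

variable {E : Type*} [NormedAddCommGroup E] [NormedSpace ℝ E] {I : Type*} (A : Arrangement E I)
  (O : ∀ τ : Set E, CellOrientation τ)

/-- The cells in a stratum that lie on the negative side of the hyperplanes of `J`. -/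
def visible (G J : Finset I) (t : I → SignType) : Set A.Realized :=
  {s | s ∈ A.stratum G t ∧ ∀ j ∈ J, s.1 j ≠ 1}

variable {A} in
theorem incidenceConvex_visible {G J : Finset I} {t : I → SignType} :
    IncidenceConvex (A.inc O) (A.visible G J t) := by
  intro s hs s'' hs'' s' h1 h2
  refine ⟨incidenceConvex_stratum s hs.1 s'' hs''.1 s' h1 h2, fun j hj h => hs''.2 j hj ?_⟩
  rw [(inc_ne_zero h1).1 j (by rw [h]; decide), h]

theorem form_congr {s : A.Realized} {m m' : ℕ} (h : m = m') (b : Fin m' → E) :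
    A.form O s m' b = A.form O s m (fun i => b (Fin.cast h i)) := by
  subst h
  rfl

variable [FiniteDimensional ℝ E]

/-! ### Comparison of open cells with an orientation of the whole space -/

/-- The sign of the orientation of an open cell with respect to a fixed basis. -/
def topSign (s : A.Realized) : ℤ :=
  if finrank ℝ (A.dir s.1) = finrank ℝ E then
    (SignType.sign (A.form O s (finrank ℝ E) (Module.finBasis ℝ E)) : ℤ)
  else 0

variable [Finite I]

theorem topSign_eq_one_or {s : A.Realized} (h : finrank ℝ (A.dir s.1) = finrank ℝ E) :
    A.topSign O s = 1 ∨ A.topSign O s = -1 := by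
  have htop : A.dir s.1 = ⊤ := Submodule.eq_top_of_finrank_eq h
  have h1 := A.form_ne_zero O h (b := Module.finBasis ℝ E) (fun i => by rw [htop]; trivial)
    (Module.finBasis ℝ E).linearIndependent
  rw [topSign, if_pos h]
  rcases lt_or_gt_of_ne h1 with h2 | h2
  · rw [sign_neg h2]; exact Or.inr rfl
  · rw [sign_pos h2]; exact Or.inl rfl

/-- The form of the open cell occurs in both factors, so its orientation cancels from the product.
-/
theorem topSign_mul_inc {s : A.Realized} {m : ℕ} (hm : finrank ℝ (A.dir s.1) = m)
    (hE : finrank ℝ E = m + 1) {v : E} (hv : v ∉ A.dir s.1) {b : Fin m → E}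
    (hb : ∀ i, b i ∈ A.dir s.1) (hli : LinearIndependent ℝ b) {s' : A.Realized}
    (hs' : s'.1 = A.move s.1 v) :
    A.topSign O s' * A.inc O s' s = (SignType.sign (A.form O s m b *
      ((Module.finBasis ℝ E).reindex (finCongr hE)).det (Matrix.vecCons (-v) b)) : ℤ) := by
  have hd : finrank ℝ (A.dir s'.1) = m + 1 := by
    refine le_antisymm (hE ▸ Submodule.finrank_le _) ?_
    rw [← hm]
    refine Submodule.finrank_lt_finrank_of_lt (lt_of_le_of_ne ?_ fun h => hv ?_)
    · rw [hs']; exact (A.face_move _ _).dir_le A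
    · rw [h, hs']; exact A.mem_dir_move _ _
  set β := (Module.finBasis ℝ E).reindex (finCongr hE)
  set F := A.form O s' (m + 1)
  have h1 : A.form O s' (finrank ℝ E) (Module.finBasis ℝ E) = F β := by
    rw [A.form_congr O hE.symm]
    congr 1
    ext i
    simp [β]
  have h2 : F β ≠ 0 := by
    have htop : A.dir s'.1 = ⊤ := Submodule.eq_top_of_finrank_eq (by rw [hd, hE])
    exact A.form_ne_zero O hd (fun i => by rw [htop]; trivial) β.linearIndependent
  have h3 : F (Matrix.vecCons (-v) b) = F β * β.det (Matrix.vecCons (-v) b) :=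
    congrArg (fun f => f (Matrix.vecCons (-v) b)) (AlternatingMap.eq_smul_basis_det β F)
  rw [topSign, if_pos (by rw [hd, hE]), A.inc_eq_sign O hs' hm hd hb hli, ← SignType.coe_mul,
    ← sign_mul, h1]
  congr 1
  rw [h3, show F β * (A.form O s m b * (F β * β.det (Matrix.vecCons (-v) b))) =
    (F β * F β) * (A.form O s m b * β.det (Matrix.vecCons (-v) b)) by ring,
    sign_mul, sign_pos (mul_self_pos.2 h2), one_mul]

/-- A cell of codimension one has exactly two open neighbours, in the directions `v` and `-v`, and
by `topSign_mul_inc` their contributions are opposite. -/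
theorem sum_topSign_mul_inc (s : A.Realized) : ∑ s', A.topSign O s' * A.inc O s' s = 0 := by
  classical
  by_cases hE : finrank ℝ E = finrank ℝ (A.dir s.1) + 1
  swap
  · refine Finset.sum_eq_zero fun s' _ => ?_
    by_contra hne
    obtain ⟨-, h1⟩ := inc_ne_zero (right_ne_zero_of_mul hne)
    have h2 : finrank ℝ (A.dir s'.1) = finrank ℝ E := by
      by_contra h
      exact left_ne_zero_of_mul hne (if_neg h)
    omega
  obtain ⟨v, hv⟩ : ∃ v, v ∉ A.dir s.1 := by
    by_contra! hcon
    have : A.dir s.1 = ⊤ := Submodule.eq_top_iff'.2 hcon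
    rw [this, finrank_top] at hE
    omega
  obtain ⟨i, hi, hvi⟩ : ∃ i, s.1 i = 0 ∧ A.n i v ≠ 0 := by simpa [mem_dir] using hv
  let c : E → A.Realized := fun w => ⟨A.move s.1 w, A.cell_move_nonempty s.2 _⟩
  have hne : c v ≠ c (-v) := fun h => by
    have h1 : SignType.sign (A.n i v) = SignType.sign (A.n i (-v)) := by
      simpa [c, move, hi] using congrFun (congrArg Subtype.val h) i
    rw [map_neg, Left.sign_neg] at h1
    rcases lt_or_gt_of_ne hvi with h2 | h2
    · rw [sign_neg h2] at h1; exact absurd h1 (by decide)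
    · rw [sign_pos h2] at h1; exact absurd h1 (by decide)
  have hsum : ∑ s', A.topSign O s' * A.inc O s' s =
      A.topSign O (c v) * A.inc O (c v) s + A.topSign O (c (-v)) * A.inc O (c (-v)) s := by
    rw [← Finset.sum_pair (f := fun s' => A.topSign O s' * A.inc O s' s) hne]
    symm
    refine Finset.sum_subset (Finset.subset_univ _) fun s' _ hs' => ?_
    by_contra hne'
    obtain ⟨hf, hd⟩ := inc_ne_zero (right_ne_zero_of_mul hne')
    obtain ⟨x, hx⟩ := s.2
    obtain ⟨x', hx'⟩ := s'.2
    have hmv := A.eq_move hf hx hx'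
    obtain ⟨t, l, hl, htl⟩ := Submodule.exists_smul_add_of_finrank (le_top : A.dir s.1 ≤ ⊤)
      (by rw [finrank_top, hE]) trivial hv (w := x' - x) trivial
    apply hs'
    simp only [Finset.mem_insert, Finset.mem_singleton]
    rw [htl] at hmv
    rcases lt_trichotomy t 0 with ht | rfl | ht
    · right
      apply Subtype.ext
      rw [hmv, show t • v = (-t) • (-v) by simp, A.move_smul_add (by linarith) hl]
    · rw [zero_smul, zero_add, A.move_of_mem_dir hl] at hmv
      rw [hmv] at hd
      omega
    · left
      apply Subtype.ext
      rw [hmv, A.move_smul_add ht hl]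
  set m := finrank ℝ (A.dir s.1) with hm
  let bs := Module.finBasis ℝ (A.dir s.1)
  let b : Fin m → E := fun i => bs i
  have hb : ∀ i, b i ∈ A.dir s.1 := fun i => (bs i).2
  have hli : LinearIndependent ℝ b := bs.linearIndependent.map' _ (Submodule.ker_subtype _)
  rw [hsum, A.topSign_mul_inc O rfl hE hv hb hli rfl,
    A.topSign_mul_inc O (s' := c (-v)) rfl hE (fun h => hv (neg_mem_iff.1 h)) hb hli rfl]
  have h1 : ∀ β : Basis (Fin (m + 1)) ℝ E, β.det (Matrix.vecCons (-v) b) =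
      -β.det (Matrix.vecCons v b) := fun β => by
    have := β.det.map_vecCons_smul b (-1) v
    simpa using this
  rw [neg_neg, h1, mul_neg, Left.sign_neg]
  generalize SignType.sign (A.form O s m b * _) = p
  revert p
  decide

variable {A}

/-- With nonzero signs on `G` the stratum is open in `E`, and `topSign` provides the units that
`hasAugmentation_stratum` asks for. -/
theorem hasAugmentation_open (k : Type*) [Field k] {y : E} (hy : y ∈ A.V) {G : Finset I}
    (hG : ∀ i ∈ G, A.signs y i ≠ 0) :
    IsCocycleOn (A.inc O) ((A.stratum G (A.signs y)).indicator (A.topSign O))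
        (A.stratum G (A.signs y)) ∧
      HasAugmentation (A.inc O) k ((A.stratum G (A.signs y)).indicator (A.topSign O))
        (A.stratum G (A.signs y)) := by
  classical
  have hdir : finrank ℝ (A.stratumDir G (A.signs y)) = finrank ℝ E := by
    have : A.stratumDir G (A.signs y) = ⊤ :=
      Submodule.eq_top_iff'.2 fun v i hi h => absurd h (hG i hi)
    rw [this, finrank_top]
  have hcoc : IsCocycleOn (A.inc O) ((A.stratum G (A.signs y)).indicator (A.topSign O))
      (A.stratum G (A.signs y)) := by
    refine ⟨fun x hx => indicator_of_notMem hx _, fun x hx => ?_⟩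
    rw [← A.sum_topSign_mul_inc O x]
    refine Finset.sum_congr rfl fun x' _ => ?_
    by_cases h : x' ∈ A.stratum G (A.signs y)
    · rw [indicator_of_mem h]
    · rw [indicator_of_notMem h, zero_mul]
      by_cases h' : A.inc O x' x = 0
      · rw [h', mul_zero]
      · refine absurd (fun i hi => ?_) h
        rw [(inc_ne_zero h').1 i (by rw [hx i hi]; exact hG i hi), hx i hi]
  refine ⟨hcoc, hasAugmentation_stratum O _ ⟨⟨A.signs y, y, hy, rfl⟩, fun _ _ => rfl⟩ hcoc
    (fun s hs h => ?_) fun s hs h => ?_⟩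
  · rw [indicator_of_mem hs]
    exact A.topSign_eq_one_or O (by rw [h, hdir])
  · rw [indicator_of_mem hs]
    exact if_neg (by rwa [hdir] at h)

/-- An open stratum and its part beyond one hyperplane have the same top class, so removing that
part leaves an exact complex. Further hyperplanes are removed one at a time: what is cut off beyond
`j` is a visible set for the remaining ones. The point `y`, which lies beyond all of `J`, keeps the
pieces nonempty. -/
theorem acyclic_visible (k : Type*) [Field k] {y : E} (hy : y ∈ A.V) {G J : Finset I}
    (hG : ∀ i ∈ G, A.signs y i ≠ 0) (hJ : ∀ j ∈ J, A.signs y j = 1) (hne : J.Nonempty) :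
    Acyclic (A.inc O) k (A.visible G J (A.signs y)) := by
  classical
  have hsm := sum_inc_mul_inc A O
  induction hne using Finset.Nonempty.cons_induction generalizing G with
  | singleton j =>
    have hj : A.signs y j = 1 := hJ j (Finset.mem_singleton_self j)
    have hG' : ∀ i ∈ insert j G, A.signs y i ≠ 0 := fun i hi => by
      rcases Finset.mem_insert.1 hi with rfl | hi
      · rw [hj]; decide
      · exact hG i hi
    obtain ⟨h1, h2⟩ := hasAugmentation_open O k hy hG
    obtain ⟨-, h3⟩ := hasAugmentation_open O k hy hG'
    have hsub : A.stratum (insert j G) (A.signs y) ⊆ A.stratum G (A.signs y) :=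
      fun x hx i hi => hx i (Finset.mem_insert_of_mem hi)
    have hxj : ∀ x ∈ A.stratum (insert j G) (A.signs y), x.1 j = 1 := fun x hx => by
      rw [hx j (Finset.mem_insert_self _ _), hj]
    refine HasAugmentation.acyclic_sdiff hsm (A := A.stratum (insert j G) (A.signs y)) ?_ ?_
      incidenceConvex_stratum ?_ h1 (fun x hx => ?_) h2 h3
    · ext x
      simp only [visible, mem_union, Finset.mem_singleton, forall_eq, mem_ofPred_eq]
      refine ⟨fun hx => ?_, fun hx => ?_⟩
      · by_cases h : x.1 j = 1
        · left
          intro i hi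
          rcases Finset.mem_insert.1 hi with rfl | hi
          · rw [h, hj]
          · exact hx i hi
        · exact Or.inr ⟨hx, h⟩
      · rcases hx with h | h
        · exact hsub h
        · exact h.1
    · exact disjoint_left.2 fun x hx hx' => hx'.2 j (Finset.mem_singleton_self j) (hxj x hx)
    · intro x hx x' hx'
      by_contra h
      refine hx'.2 j (Finset.mem_singleton_self j) ?_
      rw [(inc_ne_zero h).1 j (by rw [hxj x hx]; decide), hxj x hx]
    · rw [indicator_of_mem hx, indicator_of_mem (hsub hx)]
  | cons j J hjJ hJne ih =>
    have hj : A.signs y j = 1 := hJ j (Finset.mem_cons_self j J)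
    have hG' : ∀ i ∈ insert j G, A.signs y i ≠ 0 := fun i hi => by
      rcases Finset.mem_insert.1 hi with rfl | hi
      · rw [hj]; decide
      · exact hG i hi
    have hJ' : ∀ j' ∈ J, A.signs y j' = 1 := fun j' h => hJ j' (Finset.mem_cons_of_mem h)
    have hxj : ∀ x ∈ A.visible (insert j G) J (A.signs y), x.1 j = 1 := fun x hx => by
      rw [hx.1 j (Finset.mem_insert_self _ _), hj]
    refine Acyclic.of_sdiff hsm (A := A.visible (insert j G) J (A.signs y))
      (S := A.visible G J (A.signs y)) ?_ ?_ (incidenceConvex_visible O) ?_ (ih hG hJ')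
      (ih hG' hJ')
    · ext x
      simp only [visible, mem_union, Finset.mem_cons, forall_eq_or_imp, mem_ofPred_eq]
      refine ⟨fun hx => ?_, fun hx => ?_⟩
      · by_cases h : x.1 j = 1
        · refine Or.inl ⟨fun i hi => ?_, hx.2⟩
          rcases Finset.mem_insert.1 hi with rfl | hi
          · rw [h, hj]
          · exact hx.1 i hi
        · exact Or.inr ⟨hx.1, h, hx.2⟩
      · rcases hx with h | h
        · exact ⟨fun i hi => h.1 i (Finset.mem_insert_of_mem hi), h.2⟩
        · exact ⟨h.1, h.2.2⟩
    · exact disjoint_left.2 fun x hx hx' => hx'.2 j (Finset.mem_cons_self j J) (hxj x hx)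
    · intro x hx x' hx'
      by_contra h
      refine hx'.2 j (Finset.mem_cons_self j J) ?_
      rw [(inc_ne_zero h).1 j (by rw [hxj x hx]; decide), hxj x hx]

end Arrangement

end

section

variable {E : Type*} [NormedAddCommGroup E] [NormedSpace ℝ E] {M : Submodule ℤ E}
  (C : ToricCone M)

instance : Finite C.normals := C.finite_normals.to_subtype

/-! ### The pairing of normals with lattice points, and levels of monomial modules -/

/-- The integral values of a normal on the lattice. -/
def ToricCone.pairing (n : C.normals) : M →+ ℤ where
  toFun m := (n.2.2.2.2.1 m m.2).choose
  map_zero' := by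
    have h := (n.2.2.2.2.1 (0 : M) (0 : M).2).choose_spec
    have e : n.1 ((0 : M) : E) = 0 := by simp
    exact_mod_cast h.symm.trans e
  map_add' a b := by
    have h := (n.2.2.2.2.1 _ (a + b).2).choose_spec
    have e : n.1 ((a + b : M) : E) = (n.2.2.2.2.1 a a.2).choose + (n.2.2.2.2.1 b b.2).choose := by
      rw [← (n.2.2.2.2.1 a a.2).choose_spec, ← (n.2.2.2.2.1 b b.2).choose_spec]
      exact map_add n.1 (a : E) b
    exact_mod_cast h.symm.trans e

theorem ToricCone.pairing_spec (n : C.normals) (m : M) : (C.pairing n m : ℝ) = n.1 m :=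
  ((n.2.2.2.2.1 m m.2).choose_spec).symm

variable {C} in
/-- The submodule `B` is spanned by the monomials whose exponents lie above the levels `q`. -/
def HasLevel {k : Type*} [Field k] (B : Submodule (ToricRing k C) (AddMonoidAlgebra k M))
    (q : C.normals → ℤ) : Prop :=
  ∀ f, f ∈ B ↔ ∀ m : M, f.coeff m ≠ 0 → ∀ n, q n ≤ C.pairing n m

/-- Every vector of integral levels is sharp at each normal separately, even if it comes from no
point of `E`. Levels are therefore determined by the module and can be compared, as in
`HasLevel.le_iff`. -/
theorem exists_pairing_eq (q : C.normals → ℤ) (n : C.normals) :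
    ∃ m : M, C.pairing n m = q n ∧ ∀ n', q n' ≤ C.pairing n' m := by
  classical
  obtain ⟨m, hm, h1, h2⟩ := C.exists_lattice_point n.2 (q n)
    fun n' => if h : n' ∈ C.normals then q ⟨n', h⟩ else 0
  have h3 : C.pairing n ⟨m, hm⟩ = q n := by
    have := C.pairing_spec n ⟨m, hm⟩
    rw [h1] at this
    exact_mod_cast this
  refine ⟨⟨m, hm⟩, h3, fun n' => ?_⟩
  by_cases h : n' = n
  · rw [h, h3]
  · have := h2 n'.1 n'.2 fun h' => h (Subtype.ext h')
    rw [dif_pos n'.2, ← C.pairing_spec n' ⟨m, hm⟩] at this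
    exact_mod_cast this

variable {C} in
theorem single_mem_iff {k : Type*} [Field k] {B : Submodule (ToricRing k C) (AddMonoidAlgebra k M)}
    {q : C.normals → ℤ} (hB : HasLevel B q) (m : M) :
    AddMonoidAlgebra.single m (1 : k) ∈ B ↔ ∀ n, q n ≤ C.pairing n m := by
  classical
  rw [hB]
  refine ⟨fun h => h m (by simp), fun h m' hm' => ?_⟩
  have : m' = m := by
    by_contra hne
    apply hm'
    simp [Ne.symm hne]
  rwa [this]

variable {C} in
theorem HasLevel.eq_of_eq {k : Type*} [Field k] {B B' : Submodule (ToricRing k C) (AddMonoidAlgebra k M)}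
    {q : C.normals → ℤ} (hB : HasLevel B q) (hB' : HasLevel B' q) : B = B' := by
  ext f
  rw [hB, hB']

variable {C} in
theorem HasLevel.le_iff {k : Type*} [Field k] {B B' : Submodule (ToricRing k C) (AddMonoidAlgebra k M)}
    {q q' : C.normals → ℤ} (hB : HasLevel B q) (hB' : HasLevel B' q') :
    B ≤ B' ↔ ∀ n, q' n ≤ q n := by
  constructor
  · intro h n
    obtain ⟨m, h1, h2⟩ := exists_pairing_eq C q n
    rw [← h1]
    exact (single_mem_iff hB' m).1 (h ((single_mem_iff hB m).2 h2)) n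
  · intro h f hf
    rw [hB'] at ⊢
    rw [hB] at hf
    exact fun m hm n => (h n).trans (hf m hm n)

section Level

variable [FiniteDimensional ℝ E] [DiscreteTopology M] [IsZLattice ℝ M]

theorem sub_mem_cone_iff (m : M) (v : E) :
    (m : E) - v ∈ C.cone ↔ ∀ n : C.normals, ⌈n.1 v⌉ ≤ C.pairing n m := by
  rw [C.mem_cone_iff]
  simp only [map_sub, sub_nonneg, Int.ceil_le, C.pairing_spec, Subtype.forall]

theorem sub_mem_interior_iff (m : M) (v : E) :
    (m : E) - v ∈ interior (C.cone : Set E) ↔ ∀ n : C.normals, ⌊n.1 v⌋ + 1 ≤ C.pairing n m := by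
  rw [C.mem_interior_iff]
  simp only [map_sub, sub_pos, Int.add_one_le_iff, Int.floor_lt, C.pairing_spec, Subtype.forall]

variable (k : Type*) [Field k]

theorem hasLevel_conic (v : E) : HasLevel (conic k C v) fun n => ⌈n.1 v⌉ :=
  fun _ => forall_congr' fun m => imp_congr_right fun _ => sub_mem_cone_iff C m v

theorem hasLevel_openConic (v : E) : HasLevel (openConic k C v) fun n => ⌊n.1 v⌋ + 1 :=
  fun _ => forall_congr' fun m => imp_congr_right fun _ => sub_mem_interior_iff C m v

theorem mem_chamber_of_ceil {v w : E} (h : ∀ n : C.normals, ⌈n.1 w⌉ = ⌈n.1 v⌉) :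
    w ∈ C.chamber v := fun m hm => by
  rw [sub_mem_cone_iff C ⟨m, hm⟩, sub_mem_cone_iff C ⟨m, hm⟩]
  simp only [h]

/-- Every open conic module is a conic module. -/
theorem exists_openConic_eq_conic (x : E) : ∃ v : E, openConic k C x = conic k C v ∧
    ∀ n : C.normals, ⌈n.1 v⌉ = ⌊n.1 x⌋ + 1 := by
  -- A short step into the interior raises all normals a little, so that the ceiling becomes `⌊n x⌋
  -- + 1` even where `n x` is an integer.
  obtain ⟨u, -, hu⟩ := C.exists_interior_point
  have hev : ∀ᶠ t : ℝ in nhdsWithin 0 (Set.Ioi 0), ∀ n : C.normals,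
      ⌈n.1 (x + t • u)⌉ = ⌊n.1 x⌋ + 1 := by
    rw [Filter.eventually_all]
    intro n
    have hlim : Filter.Tendsto (fun t : ℝ => n.1 x + t * n.1 u) (nhdsWithin 0 (Set.Ioi 0))
        (nhds (n.1 x)) := by
      have : Continuous fun t : ℝ => n.1 x + t * n.1 u := by fun_prop
      simpa using this.continuousWithinAt (s := Set.Ioi 0) (x := 0) |>.tendsto
    filter_upwards [hlim.eventually (gt_mem_nhds (Int.lt_floor_add_one (n.1 x))),
      self_mem_nhdsWithin] with t h1 (h2 : 0 < t)
    rw [Int.ceil_eq_iff, map_add, map_smul, smul_eq_mul]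
    push_cast
    have := mul_pos h2 (hu n.1 n.2)
    exact ⟨by linarith [Int.floor_le (n.1 x)], h1.le⟩
  obtain ⟨t, ht⟩ := hev.exists
  refine ⟨x + t • u, (hasLevel_openConic C k x).eq_of_eq ?_, ht⟩
  have := hasLevel_conic C k (x + t • u)
  simpa only [ht] using this

end Level

/-! ### The arrangement of a chamber -/

section Chamber

variable {C} in
theorem Cell.point_mem {p : E} {i : ℕ} (τ : Cell C p i) : τ.point ∈ τ.1 := τ.2.1.1.some_mem

variable [FiniteDimensional ℝ E]

/-- The hyperplanes `n = ⌈n p⌉`, cutting the region bounded by the other walls of the chamber. -/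
def chamberArrangement (p : E) : Arrangement E C.normals where
  n i := i.1
  d i := ⌈i.1 p⌉
  V := {x | ∀ i : C.normals, (⌈i.1 p⌉ : ℝ) - 1 < i.1 x}
  isOpen := by
    simp only [Set.ofPred_forall]
    exact isOpen_iInter_of_finite fun i =>
      isOpen_lt continuous_const i.1.continuous_of_finiteDimensional
  convex := by
    simp only [Set.ofPred_forall]
    exact convex_iInter fun i => convex_halfSpace_gt i.1.isLinear _

variable {C} {p : E}

theorem signs_of_mem_openCell {Ω : Set (Dual ℝ E)} {x : E} (hx : x ∈ C.openCell p Ω)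
    (n : C.normals) : (n.1 ∈ Ω → (chamberArrangement C p).signs x n = -1) ∧
      (n.1 ∉ Ω → (chamberArrangement C p).signs x n = 0) := by
  obtain ⟨h1, h2⟩ := hx n.1 n.2
  exact ⟨fun h => sign_eq_neg_one_iff.2 (sub_neg.2 (h1 h).2),
    fun h => sign_eq_zero_iff.2 (sub_eq_zero.2 (h2 h))⟩

theorem mem_V_of_mem_openCell {Ω : Set (Dual ℝ E)} {x : E} (hx : x ∈ C.openCell p Ω) :
    x ∈ (chamberArrangement C p).V := fun n => by
  obtain ⟨h1, h2⟩ := hx n.1 n.2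
  by_cases h : n.1 ∈ Ω
  · exact (h1 h).1
  · rw [h2 h]; linarith

/-- The bounds `d n - 1 < n x` are built into `V`, so an open cell of the chamber is described by
signs at the upper walls alone. -/
theorem cell_eq_openCell {s : C.normals → SignType} {Ω : Set (Dual ℝ E)}
    (h1 : ∀ n : C.normals, n.1 ∈ Ω → s n = -1) (h0 : ∀ n : C.normals, n.1 ∉ Ω → s n = 0) :
    (chamberArrangement C p).cell s = C.openCell p Ω := by
  ext x
  constructor
  · rintro ⟨hV, hs⟩ n hn
    refine ⟨fun h => ⟨hV ⟨n, hn⟩, ?_⟩, fun h => ?_⟩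
    · have := congrFun hs ⟨n, hn⟩
      rw [h1 ⟨n, hn⟩ h] at this
      exact sub_neg.1 (sign_eq_neg_one_iff.1 this)
    · have := congrFun hs ⟨n, hn⟩
      rw [h0 ⟨n, hn⟩ h] at this
      exact sub_eq_zero.1 (sign_eq_zero_iff.1 this)
  · intro hx
    refine ⟨mem_V_of_mem_openCell hx, funext fun n => ?_⟩
    by_cases h : n.1 ∈ Ω
    · rw [(signs_of_mem_openCell hx n).1 h, h1 n h]
    · rw [(signs_of_mem_openCell hx n).2 h, h0 n h]

theorem Cell.cell_signs {i : ℕ} (τ : Cell C p i) :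
    (chamberArrangement C p).cell ((chamberArrangement C p).signs τ.point) = τ.1 := by
  obtain ⟨Ω, -, hΩ⟩ := τ.2.1.2.2
  have hx : τ.point ∈ C.openCell p Ω := hΩ ▸ τ.point_mem
  rw [hΩ]
  exact cell_eq_openCell (fun n => (signs_of_mem_openCell hx n).1)
    fun n => (signs_of_mem_openCell hx n).2

/-- The sign vector of a cell of the chamber. -/
def Cell.index {i : ℕ} (τ : Cell C p i) : (chamberArrangement C p).Realized :=
  ⟨(chamberArrangement C p).signs τ.point, by rw [τ.cell_signs]; exact ⟨_, τ.point_mem⟩⟩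

theorem Cell.cell_index {i : ℕ} (τ : Cell C p i) :
    (chamberArrangement C p).cell τ.index.1 = τ.1 := τ.cell_signs

theorem Cell.index_injective {i : ℕ} :
    Function.Injective (Cell.index : Cell C p i → (chamberArrangement C p).Realized) :=
  fun τ τ' h => Subtype.ext (by rw [← τ.cell_index, ← τ'.cell_index, h])

theorem Cell.index_ne_one {i : ℕ} (τ : Cell C p i) (n : C.normals) : τ.index.1 n ≠ 1 := by
  obtain ⟨Ω, -, hΩ⟩ := τ.2.1.2.2
  have hx : τ.point ∈ C.openCell p Ω := hΩ ▸ τ.point_mem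
  by_cases h : n.1 ∈ Ω
  · exact fun h1 => absurd (((signs_of_mem_openCell hx n).1 h).symm.trans h1) (by decide)
  · exact fun h1 => absurd (((signs_of_mem_openCell hx n).2 h).symm.trans h1) (by decide)

theorem Cell.finrank_dir {i : ℕ} (τ : Cell C p i) :
    finrank ℝ ((chamberArrangement C p).dir τ.index.1) + i = finrank ℝ E := by
  rw [← Arrangement.vectorSpan_cell _ τ.index.2, τ.cell_index]
  exact τ.2.2

theorem openCell_subset_chamber [DiscreteTopology M] [IsZLattice ℝ M] (Ω : Set (Dual ℝ E)) :
    C.openCell p Ω ⊆ C.chamber p := fun x hx => mem_chamber_of_ceil C fun n => by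
  obtain ⟨h1, h2⟩ := hx n.1 n.2
  rw [Int.ceil_eq_iff]
  by_cases h : n.1 ∈ Ω
  · exact ⟨(h1 h).1, (h1 h).2.le⟩
  · rw [h2 h]; exact ⟨by linarith, le_rfl⟩

theorem exists_cell_index_eq [DiscreteTopology M] [IsZLattice ℝ M]
    {s : (chamberArrangement C p).Realized} (hs : ∀ n, s.1 n ≠ 1) {i : ℕ}
    (hi : finrank ℝ ((chamberArrangement C p).dir s.1) + i = finrank ℝ E) :
    ∃ τ : Cell C p i, τ.index = s := by
  let Ω : Set (Dual ℝ E) := {n | ∃ h : n ∈ C.normals, s.1 ⟨n, h⟩ = -1}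
  have hΩ : (chamberArrangement C p).cell s.1 = C.openCell p Ω := by
    refine cell_eq_openCell (fun n hn => hn.2) fun n hn => ?_
    have h1 := hs n
    have h2 : s.1 n ≠ -1 := fun h => hn ⟨n.2, h⟩
    revert h1 h2
    generalize s.1 n = σ
    revert σ
    decide
  let τ : Cell C p i := ⟨(chamberArrangement C p).cell s.1,
    ⟨s.2, by rw [hΩ]; exact openCell_subset_chamber Ω, Ω, fun n hn => hn.1, hΩ⟩, by
      rwa [Arrangement.vectorSpan_cell _ s.2]⟩
  exact ⟨τ, Subtype.ext τ.point_mem.2⟩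

/-- Levels of open conic modules are floors plus one: `d + 1` on a wall `n = d`, and `d` strictly
between `d - 1` and `d`. -/
theorem hasLevel_cellModule [DiscreteTopology M] [IsZLattice ℝ M] (k : Type*) [Field k] {i : ℕ}
    (τ : Cell C p i) : HasLevel (cellModule k C τ)
      fun n => if τ.index.1 n = 0 then ⌈n.1 p⌉ + 1 else ⌈n.1 p⌉ := by
  have h := hasLevel_openConic C k τ.point
  convert h using 2 with n
  have hx : τ.point ∈ (chamberArrangement C p).cell τ.index.1 := τ.cell_index ▸ τ.point_mem
  have hV := hx.1 n
  have hne := τ.index_ne_one n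
  split_ifs with h0
  · have h1 : n.1 τ.point = ⌈n.1 p⌉ := (Arrangement.signs_eq_zero_iff _).1 h0
    rw [h1, Int.floor_intCast]
  · have h1 : τ.index.1 n = -1 := by
      revert hne h0
      generalize τ.index.1 n = σ
      revert σ
      decide
    have h2 : n.1 τ.point < ⌈n.1 p⌉ := sub_neg.1 (sign_eq_neg_one_iff.1 h1)
    have h3 : ⌊n.1 τ.point⌋ = ⌈n.1 p⌉ - 1 := by
      rw [Int.floor_eq_iff]
      push_cast
      exact ⟨hV.le, by linarith⟩
    rw [h3, sub_add_cancel]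

/-- Comparing levels, an inclusion means that every wall through `τ'` contains `τ`; in the absence
of positive signs this is the face relation. -/
theorem cellModule_le_iff [DiscreteTopology M] [IsZLattice ℝ M] (k : Type*) [Field k] {i j : ℕ}
    (τ : Cell C p i) (τ' : Cell C p j) :
    cellModule k C τ ≤ cellModule k C τ' ↔ Arrangement.Face τ.index.1 τ'.index.1 := by
  rw [(hasLevel_cellModule k τ).le_iff (hasLevel_cellModule k τ')]
  refine forall_congr' fun n => ?_
  have h1 := τ.index_ne_one n
  have h2 := τ'.index_ne_one n
  revert h1 h2
  generalize τ.index.1 n = σ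
  generalize τ'.index.1 n = σ'
  generalize ⌈n.1 p⌉ = z
  cases σ <;> cases σ' <;> simp

/-- Orientations of the cells of the chamber, extended to all sets. -/
def totalOrientation (o : ∀ (i : ℕ) (τ : Cell C p i), CellOrientation τ.1) (τ : Set E) :
    CellOrientation τ :=
  open Classical in
  if h : ∃ i, τ ∈ C.cells p ∧ finrank ℝ (vectorSpan ℝ τ) + i = finrank ℝ E then
    o h.choose ⟨τ, h.choose_spec⟩
  else (Module.finBasis ℝ (vectorSpan ℝ τ)).orientation

theorem totalOrientation_eq (o : ∀ (i : ℕ) (τ : Cell C p i), CellOrientation τ.1) {i : ℕ}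
    (τ : Cell C p i) : totalOrientation o τ.1 = o i τ := by
  have h : ∃ i, τ.1 ∈ C.cells p ∧ finrank ℝ (vectorSpan ℝ τ.1) + i = finrank ℝ E := ⟨i, τ.2⟩
  rw [totalOrientation, dif_pos h]
  have key : ∀ (j : ℕ) (_ : j = i)
      (h' : τ.1 ∈ C.cells p ∧ finrank ℝ (vectorSpan ℝ τ.1) + j = finrank ℝ E),
      o j ⟨τ.1, h'⟩ = o i τ := by
    rintro j rfl h'
    rfl
  refine key _ ?_ _
  have h1 := h.choose_spec.2
  have h2 := τ.2.2
  omega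

open Classical in
/-- The matrix of the differential of the complex of the chamber. -/
def Kcoeff (k : Type*) [Field k] (o : ∀ (i : ℕ) (τ : Cell C p i), CellOrientation τ.1) {i : ℕ}
    (τ' : Cell C p i) (τ : Cell C p (i + 1)) : ℤ :=
  if cellModule k C τ ≤ cellModule k C τ' then incidenceSign τ'.1 τ.1 (o i τ') (o (i + 1) τ)
  else 0

/-- A small step from `y` against the interior of the cone leaves all hyperplanes. The point reached
lies beyond exactly the walls whose level `y` exceeds, and is the base point for `acyclic_visible`.
-/
theorem exists_generic_point {y : E} (hy : ∀ n : C.normals, ⌈n.1 p⌉ ≤ ⌈n.1 y⌉) :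
    ∃ y' ∈ (chamberArrangement C p).V, ∀ n : C.normals,
      (chamberArrangement C p).signs y' n = if ⌈n.1 p⌉ = ⌈n.1 y⌉ then -1 else 1 := by
  obtain ⟨u, -, hu⟩ := C.exists_interior_point
  have hev : ∀ᶠ t : ℝ in nhdsWithin 0 (Set.Ioi 0), ∀ n : C.normals,
      (⌈n.1 p⌉ : ℝ) - 1 < n.1 (y - t • u) ∧
      (chamberArrangement C p).signs (y - t • u) n = if ⌈n.1 p⌉ = ⌈n.1 y⌉ then -1 else 1 := by
    rw [Filter.eventually_all]
    intro n
    have hlim : Filter.Tendsto (fun t : ℝ => n.1 (y - t • u)) (nhdsWithin 0 (Set.Ioi 0))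
        (nhds (n.1 y)) := by
      have : Continuous fun t : ℝ => n.1 y - t * n.1 u := by fun_prop
      simpa using this.continuousWithinAt (s := Set.Ioi 0) (x := 0) |>.tendsto
    have h1 : (⌈n.1 p⌉ : ℝ) - 1 < n.1 y := by
      have := Int.ceil_lt_add_one (n.1 y)
      have h2 : (⌈n.1 p⌉ : ℝ) ≤ ⌈n.1 y⌉ := by exact_mod_cast hy n
      linarith
    by_cases h : ⌈n.1 p⌉ = ⌈n.1 y⌉
    · filter_upwards [hlim.eventually (lt_mem_nhds h1), self_mem_nhdsWithin] with t ht (ht0 : 0 < t)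
      refine ⟨ht, ?_⟩
      rw [if_pos h]
      refine sign_eq_neg_one_iff.2 (sub_neg.2 ?_)
      change n.1 (y - t • u) < (⌈n.1 p⌉ : ℝ)
      rw [map_sub, map_smul, smul_eq_mul, h]
      have := mul_pos ht0 (hu n.1 n.2)
      linarith [Int.le_ceil (n.1 y)]
    · have h2 : (⌈n.1 p⌉ : ℝ) < n.1 y := Int.lt_ceil.1 (lt_of_le_of_ne (hy n) h)
      filter_upwards [hlim.eventually (lt_mem_nhds h1), hlim.eventually (lt_mem_nhds h2)]
        with t ht ht'
      refine ⟨ht, ?_⟩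
      rw [if_neg h]
      exact sign_eq_one_iff.2 (sub_pos.2 ht')
  obtain ⟨t, ht⟩ := hev.exists
  exact ⟨y - t • u, fun n => (ht n).1, fun n => (ht n).2⟩

variable [DiscreteTopology M] [IsZLattice ℝ M] (k : Type*) [Field k]
  (o : ∀ (i : ℕ) (τ : Cell C p i), CellOrientation τ.1)

/-- Identifies the complex of the chamber with the cells without positive signs in the complex of
the arrangement. -/
theorem Kcoeff_eq_inc {i : ℕ} (τ' : Cell C p i) (τ : Cell C p (i + 1)) :
    Kcoeff k o τ' τ = (chamberArrangement C p).inc (totalOrientation o) τ'.index τ.index := by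
  have h1 := τ.finrank_dir
  have h2 := τ'.finrank_dir
  classical
  rw [Arrangement.inc, τ.cell_index, τ'.cell_index, totalOrientation_eq, totalOrientation_eq]
  unfold Kcoeff
  refine if_congr ?_ rfl rfl
  rw [cellModule_le_iff]
  exact ⟨fun h => ⟨h, by omega⟩, fun h => h.1⟩

theorem sum_Kcoeff_mul {i : ℕ} (τ'' : Cell C p i) (τ : Cell C p (i + 1 + 1)) :
    ∑ τ' : Cell C p (i + 1), Kcoeff k o τ'' τ' * Kcoeff k o τ' τ = 0 := by
  rw [← (chamberArrangement C p).sum_inc_mul_inc (totalOrientation o) τ''.index τ.index]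
  refine Fintype.sum_of_injective Cell.index Cell.index_injective _ _ (fun x hx => ?_)
    fun τ' => by rw [Kcoeff_eq_inc, Kcoeff_eq_inc]
  by_contra hne
  obtain ⟨h1, h2⟩ := Arrangement.inc_ne_zero (left_ne_zero_of_mul hne)
  have h3 := τ''.finrank_dir
  obtain ⟨τ', h⟩ := exists_cell_index_eq (s := x) (i := i + 1)
    (fun n hn => τ''.index_ne_one n (by rw [h1 n (by rw [hn]; decide), hn])) (by omega)
  exact hx ⟨τ', h⟩

/-- Sums over cells of the chamber compute the differential of the arrangement. -/
theorem sum_Kcoeff_index {i : ℕ} (τ' : Cell C p i) (g : (chamberArrangement C p).Realized → k) :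
    ∑ τ : Cell C p (i + 1), (Kcoeff k o τ' τ : k) * g τ.index =
      bd ((chamberArrangement C p).inc (totalOrientation o)) k g τ'.index := by
  rw [bd_apply]
  refine Fintype.sum_of_injective Cell.index Cell.index_injective _ _ (fun x hx => ?_)
    fun τ => by rw [Kcoeff_eq_inc]
  by_contra hne
  obtain ⟨h1, h2⟩ := Arrangement.inc_ne_zero (fun h => hne (by rw [h, Int.cast_zero, zero_mul]))
  have h3 := τ'.finrank_dir
  obtain ⟨τ, h⟩ := exists_cell_index_eq (s := x) (i := i + 1)
    (fun n hn => τ'.index_ne_one n (by rw [h1 n (by rw [hn]; decide), hn])) (by omega)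
  exact hx ⟨τ, h⟩

/-- The degree given by the levels `q` occurs in the module of the cell. -/
def Admissible (q : C.normals → ℤ) {i : ℕ} (τ : Cell C p i) : Prop :=
  ∀ n, (if τ.index.1 n = 0 then ⌈n.1 p⌉ + 1 else ⌈n.1 p⌉) ≤ q n

/-- The part of the complex of the chamber in a degree different from that of the simple module
is exact. -/
theorem exists_Kcoeff_preimage {y : E} (hy : ∀ n : C.normals, ⌈n.1 p⌉ ≤ ⌈n.1 y⌉)
    (hne : ∃ n : C.normals, ⌈n.1 p⌉ ≠ ⌈n.1 y⌉) {i : ℕ} (a : Cell C p i → k)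
    (ha : ∀ τ, ¬ Admissible (fun n => ⌈n.1 y⌉) τ → a τ = 0)
    (hda : ∀ (j : ℕ) (h : j + 1 = i) (τ' : Cell C p j),
      ∑ τ : Cell C p (j + 1), (Kcoeff k o τ' τ : k) * a (h ▸ τ) = 0) :
    ∃ b : Cell C p (i + 1) → k, (∀ τ, ¬ Admissible (fun n => ⌈n.1 y⌉) τ → b τ = 0) ∧
      ∀ τ : Cell C p i, ∑ ρ : Cell C p (i + 1), (Kcoeff k o τ ρ : k) * b ρ = a τ := by
  classical
  cases nonempty_fintype C.normals
  obtain ⟨y', hy', hsigns⟩ := exists_generic_point hy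
  set A := chamberArrangement C p with hA
  -- On `G` the degree has the lowest possible level, which rules out cells on these walls; the
  -- walls in `J` impose nothing on cells of the chamber. So admissible cells are the visible ones.
  let G : Finset C.normals := Finset.univ.filter fun n => ⌈n.1 p⌉ = ⌈n.1 y⌉
  let J : Finset C.normals := Finset.univ.filter fun n => ⌈n.1 p⌉ ≠ ⌈n.1 y⌉
  have hG : ∀ n ∈ G, A.signs y' n = -1 := fun n hn => by
    rw [hsigns, if_pos (Finset.mem_filter.1 hn).2]
  have hacyc := Arrangement.acyclic_visible (A := A) (totalOrientation o) k hy' (G := G) (J := J)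
    (fun n hn => by rw [hG n hn]; decide)
    (fun n hn => by rw [hsigns, if_neg (Finset.mem_filter.1 hn).2])
    (by obtain ⟨n, hn⟩ := hne; exact ⟨n, Finset.mem_filter.2 ⟨Finset.mem_univ _, hn⟩⟩)
  have hvis : ∀ {j : ℕ} (τ : Cell C p j), Admissible (fun n => ⌈n.1 y⌉) τ ↔
      τ.index ∈ A.visible G J (A.signs y') := by
    intro j τ
    constructor
    · refine fun h => ⟨fun n hn => ?_, fun n _ => τ.index_ne_one n⟩
      have h1 := τ.index_ne_one n
      have h2 : τ.index.1 n ≠ 0 := fun h0 => by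
        have : (if τ.index.1 n = 0 then ⌈n.1 p⌉ + 1 else ⌈n.1 p⌉) ≤ ⌈n.1 y⌉ := h n
        rw [if_pos h0, (Finset.mem_filter.1 hn).2] at this
        omega
      rw [hG n hn]
      revert h1 h2
      generalize τ.index.1 n = σ
      revert σ
      decide
    · intro h n
      split_ifs with h0
      · have hn : ⌈n.1 p⌉ ≠ ⌈n.1 y⌉ := fun hn => by
          have h1 := h.1 n (Finset.mem_filter.2 ⟨Finset.mem_univ _, hn⟩)
          rw [hG n (Finset.mem_filter.2 ⟨Finset.mem_univ _, hn⟩), h0] at h1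
          exact absurd h1 (by decide)
        exact Int.add_one_le_of_lt (lt_of_le_of_ne (hy n) hn)
      · exact hy n
  -- The complex of the arrangement is not split by codimension, so `a` is extended by zero. Its
  -- boundary lives in codimension `i - 1`, where `hda` applies; for `i = 0` there is no such cell.
  set f : A.Realized → k := Function.extend Cell.index a 0 with hf
  have hfa : ∀ τ : Cell C p i, f τ.index = a τ := fun τ =>
    Cell.index_injective.extend_apply a 0 τ
  have hf0 : ∀ x, (∀ τ : Cell C p i, τ.index ≠ x) → f x = 0 := fun x hx =>
    Function.extend_apply' _ _ _ fun ⟨τ, h⟩ => hx τ h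
  obtain ⟨g, hg, hbg⟩ := hacyc f (fun x hx => by
      by_cases h : ∃ τ : Cell C p i, τ.index = x
      · obtain ⟨τ, rfl⟩ := h
        rw [hfa]
        exact ha τ fun h => hx ((hvis τ).1 h)
      · exact hf0 x fun τ hτ => h ⟨τ, hτ⟩) (fun x hx => by
      by_contra hne'
      obtain ⟨x', -, hx'⟩ := Finset.exists_ne_zero_of_sum_ne_zero hne'
      have hfx' := right_ne_zero_of_mul hx'
      obtain ⟨h1, h2⟩ := Arrangement.inc_ne_zero
        (fun h => hx' (by rw [h, Int.cast_zero, zero_mul]))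
      obtain ⟨τ, rfl⟩ : ∃ τ : Cell C p i, τ.index = x' := by
        by_contra h
        exact hfx' (hf0 x' fun τ hτ => h ⟨τ, hτ⟩)
      have h3 : finrank ℝ (A.dir τ.index.1) + i = finrank ℝ E := τ.finrank_dir
      have h4 := Submodule.finrank_le (A.dir x.1)
      obtain ⟨j, rfl⟩ : ∃ j, j + 1 = i := ⟨i - 1, by omega⟩
      have hx1 : ∀ n, x.1 n ≠ 1 := fun n => by
        by_cases hn : n ∈ J
        · exact hx.2 n hn
        · have : n ∈ G := by
            simp only [J, G, Finset.mem_filter, Finset.mem_univ, true_and, not_not, ne_eq] at hn ⊢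
            exact hn
          rw [hx.1 n this, hG n this]
          decide
      obtain ⟨τ', rfl⟩ := exists_cell_index_eq (s := x) (i := j) hx1
        (by change finrank ℝ (A.dir x.1) + j = _; omega)
      apply hne'
      rw [← sum_Kcoeff_index]
      simpa only [hfa] using hda j rfl τ')
  refine ⟨fun ρ => g ρ.index, fun ρ hρ => hg _ fun h => hρ ((hvis ρ).2 h), fun τ => ?_⟩
  rw [sum_Kcoeff_index]
  by_cases hτ : Admissible (fun n => ⌈n.1 y⌉) τ
  · rw [hbg _ ((hvis τ).1 hτ), hfa]
  · rw [ha τ hτ]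
    -- Signs `-1` on `G` are inherited by larger cells, so a cell of the chamber in the boundary of
    -- a visible chain is admissible.
    refine bd_eq_zero_of_incidence fun x hx => ?_
    by_contra h
    obtain ⟨h1, -⟩ := Arrangement.inc_ne_zero h
    have hxv : x ∈ A.visible G J (A.signs y') := by
      by_contra h2
      exact hx (hg x h2)
    refine hτ ((hvis τ).2 ⟨fun n hn => ?_, fun n _ => τ.index_ne_one n⟩)
    rw [h1 n (by rw [hxv.1 n hn, hG n hn]; decide), hxv.1 n hn]

end Chamber

end

section

/-! ### Homomorphisms between monomial modules are multiplications -/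

theorem exists_coeff_ne_zero_of_mul {E : Type*} [AddCommGroup E] {M : Submodule ℤ E} {k : Type*} [Field k] {f g : AddMonoidAlgebra k M} {m : M}
    (h : (f * g).coeff m ≠ 0) : ∃ a b, a + b = m ∧ f.coeff a ≠ 0 ∧ g.coeff b ≠ 0 := by
  classical
  obtain ⟨a, ha, b, hb, hab⟩ :=
    Finset.mem_add.1 (AddMonoidAlgebra.support_coeff_mul_subset f g (Finsupp.mem_support_iff.2 h))
  exact ⟨a, b, hab, Finsupp.mem_support_iff.1 ha, Finsupp.mem_support_iff.1 hb⟩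

theorem single_mul_inv {E : Type*} [AddCommGroup E] {M : Submodule ℤ E} {k : Type*} [Field k] (m : M) {a : k} (ha : a ≠ 0)
    (f : AddMonoidAlgebra k M) :
    AddMonoidAlgebra.single m a * (AddMonoidAlgebra.single (-m) a⁻¹ * f) = f := by
  rw [← mul_assoc, AddMonoidAlgebra.single_mul_single, add_neg_cancel, mul_inv_cancel₀ ha,
    ← AddMonoidAlgebra.one_def, one_mul]

variable {E : Type*} [NormedAddCommGroup E] [NormedSpace ℝ E] {M : Submodule ℤ E}

theorem exists_le_pairing (C : ToricCone M) (q : C.normals → ℤ) :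
    ∃ m : M, ∀ n, q n ≤ C.pairing n m := by
  cases isEmpty_or_nonempty C.normals with
  | inl h => exact ⟨0, fun n => h.elim n⟩
  | inr h =>
    obtain ⟨m, -, hm⟩ := exists_pairing_eq C q h.some
    exact ⟨m, hm⟩

variable {k : Type*} [Field k] {C : ToricCone M}

section Mod

variable {B B' : Submodule (ToricRing k C) (AddMonoidAlgebra k M)}

/-- An element of the Laurent ring that lies in `B`, as an element of the module `B`. -/
def Mod.mk (f : AddMonoidAlgebra k M) (hf : f ∈ B) : Mod B := (⟨f, hf⟩ : B)

@[simp] theorem Mod.val_mk (f : AddMonoidAlgebra k M) (hf : f ∈ B) : Mod.val (Mod.mk f hf) = f :=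
  rfl

theorem Mod.val_mem (f : Mod B) : Mod.val f ∈ B := Subtype.property (p := (· ∈ B)) f

theorem Mod.ext {f g : Mod B} (h : Mod.val f = Mod.val g) : f = g := Subtype.ext h

@[simp] theorem Mod.val_inclusion (h : B ≤ B') (f : Mod B) :
    Mod.val (Mod.inclusion h f) = Mod.val f := rfl

theorem toricRing_smul (a : ToricRing k C) (f : AddMonoidAlgebra k M) :
    a • f = (show toricAlgebra k C from a).1 * f := rfl

/-- Multiplication by a Laurent polynomial, as a homomorphism of modules. -/
def mulHom (h : AddMonoidAlgebra k M) (hh : ∀ f ∈ B, h * f ∈ B') :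
    Mod B →ₗ[ToricRing k C] Mod B' where
  toFun f := Mod.mk (h * Mod.val f) (hh _ f.val_mem)
  map_add' f g := Mod.ext (by simp [mul_add])
  map_smul' a f := Mod.ext (by
    simp only [Mod.val_mk, map_smul, RingHom.id_apply, toricRing_smul]
    exact mul_left_comm _ _ _)

@[simp] theorem val_mulHom (h : AddMonoidAlgebra k M) (hh : ∀ f ∈ B, h * f ∈ B') (f : Mod B) :
    Mod.val (mulHom h hh f) = h * Mod.val f := rfl

theorem HasLevel.mul_mem {q q' : C.normals → ℤ} (hB : HasLevel B q) (hB' : HasLevel B' q')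
    {h : AddMonoidAlgebra k M} (hh : ∀ m, h.coeff m ≠ 0 → ∀ n, q' n ≤ C.pairing n m + q n) :
    ∀ f ∈ B, h * f ∈ B' := by
  intro f hf
  rw [hB']
  intro m hm n
  obtain ⟨a, b, rfl, ha, hb⟩ := exists_coeff_ne_zero_of_mul hm
  have h1 := hh a ha n
  have h2 := (hB f).1 hf b hb n
  rw [map_add]
  omega

variable [FiniteDimensional ℝ E] [DiscreteTopology M] [IsZLattice ℝ M]

/-- A monomial `x^t` moves `B` into the toric algebra. Then `(x^t g) f = (x^t f) g` relates two
scalar multiples in `B`; apply the linear map and cancel `x^t`. So homomorphisms are multiplications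
by fractions, which `symbol` computes at a monomial. -/
theorem HasLevel.mul_map_comm {q : C.normals → ℤ} (hB : HasLevel B q)
    (φ : Mod B →ₗ[ToricRing k C] AddMonoidAlgebra k M) (f g : Mod B) :
    Mod.val g * φ f = Mod.val f * φ g := by
  obtain ⟨t, ht⟩ := exists_le_pairing C fun n => -q n
  have hmem : ∀ f : Mod B, AddMonoidAlgebra.single t 1 * Mod.val f ∈ toricAlgebra k C := by
    intro f m hm
    obtain ⟨a, b, rfl, ha, hb⟩ := exists_coeff_ne_zero_of_mul hm
    have hat : a = t := by
      by_contra hne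
      exact ha (by simp [Ne.symm hne])
    subst hat
    rw [C.mem_cone_iff]
    intro n hn
    have h1 := ht ⟨n, hn⟩
    have h2 := (hB _).1 f.val_mem b hb ⟨n, hn⟩
    rw [← C.pairing_spec ⟨n, hn⟩, map_add]
    have h3 : 0 ≤ C.pairing ⟨n, hn⟩ a + C.pairing ⟨n, hn⟩ b := by omega
    exact_mod_cast h3
  let α : Mod B → ToricRing k C := fun f => (⟨_, hmem f⟩ : toricAlgebra k C)
  have h1 : α g • f = α f • g := by
    apply Mod.ext
    rw [map_smul, map_smul]
    change AddMonoidAlgebra.single t 1 * Mod.val g * Mod.val f =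
      AddMonoidAlgebra.single t 1 * Mod.val f * Mod.val g
    ring
  have h2 := congrArg φ h1
  rw [map_smul, map_smul] at h2
  change AddMonoidAlgebra.single t 1 * Mod.val g * φ f =
      AddMonoidAlgebra.single t 1 * Mod.val f * φ g at h2
  have h3 := congrArg (fun x => AddMonoidAlgebra.single (-t) (1 : k) * x) h2
  simp only [← mul_assoc, AddMonoidAlgebra.single_mul_single, neg_add_cancel, mul_one,
    ← AddMonoidAlgebra.one_def, one_mul] at h3
  exact h3

variable (k C) in
theorem exists_monomial_mem_conic (w : E) :
    ∃ a : M, AddMonoidAlgebra.single a (1 : k) ∈ conic k C w := by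
  obtain ⟨a, ha⟩ := exists_le_pairing C fun n => ⌈n.1 w⌉
  exact ⟨a, (single_mem_iff (hasLevel_conic C k w) a).2 ha⟩

/-- The Laurent polynomial by which a homomorphism of monomial modules multiplies. -/
def symbol {w : E} : (Mod (conic k C w) →ₗ[ToricRing k C] Mod B) →+ AddMonoidAlgebra k M where
  toFun φ := AddMonoidAlgebra.single (-(exists_monomial_mem_conic k C w).choose) 1 *
    Mod.val (φ (Mod.mk _ (exists_monomial_mem_conic k C w).choose_spec))
  map_zero' := by simp
  map_add' φ ψ := by simp [mul_add]

theorem val_eq_symbol_mul {w : E} (φ : Mod (conic k C w) →ₗ[ToricRing k C] Mod B)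
    (f : Mod (conic k C w)) : Mod.val (φ f) = symbol φ * Mod.val f := by
  have h := (hasLevel_conic C k w).mul_map_comm (Mod.val ∘ₗ φ) f
    (Mod.mk _ (exists_monomial_mem_conic k C w).choose_spec)
  simp only [Mod.val_mk, LinearMap.comp_apply] at h
  change _ = AddMonoidAlgebra.single (-(exists_monomial_mem_conic k C w).choose) 1 *
    Mod.val (φ (Mod.mk _ (exists_monomial_mem_conic k C w).choose_spec)) * _
  rw [mul_assoc, mul_comm (Mod.val (φ _)), ← h, ← mul_assoc, AddMonoidAlgebra.single_mul_single,
    neg_add_cancel, mul_one, ← AddMonoidAlgebra.one_def, one_mul]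

theorem symbol_eq {w : E} {φ : Mod (conic k C w) →ₗ[ToricRing k C] Mod B}
    {h : AddMonoidAlgebra k M} (hφ : ∀ f, Mod.val (φ f) = h * Mod.val f) : symbol φ = h := by
  change AddMonoidAlgebra.single (-(exists_monomial_mem_conic k C w).choose) 1 *
    Mod.val (φ (Mod.mk _ (exists_monomial_mem_conic k C w).choose_spec)) = h
  rw [hφ, Mod.val_mk, mul_comm h, ← mul_assoc, AddMonoidAlgebra.single_mul_single,
    neg_add_cancel, mul_one, ← AddMonoidAlgebra.one_def, one_mul]

/-- The inequality at `n` comes from a monomial lying exactly on the level of `n`. -/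
theorem level_le_of_symbol_ne_zero {w : E} {q : C.normals → ℤ} (hB : HasLevel B q)
    (φ : Mod (conic k C w) →ₗ[ToricRing k C] Mod B) {m : M} (hm : (symbol φ).coeff m ≠ 0)
    (n : C.normals) : q n ≤ C.pairing n m + ⌈n.1 w⌉ := by
  obtain ⟨a, ha, ha'⟩ := exists_pairing_eq C (fun n => ⌈n.1 w⌉) n
  have h1 := (hB _).1 (φ (Mod.mk _ ((single_mem_iff (hasLevel_conic C k w) a).2 ha'))).val_mem
    (m + a)
  rw [val_eq_symbol_mul, Mod.val_mk, AddMonoidAlgebra.coeff_mul_single_apply] at h1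
  have h2 := h1 (by simpa using hm) n
  rw [map_add, ha] at h2
  exact h2

end Mod

/-! ### Coordinates of homomorphisms from a sum of conic modules -/

section Coordinates

variable [FiniteDimensional ℝ E] [DiscreteTopology M] [IsZLattice ℝ M]
  {ι : Type*} {c : ι → E} {r : ι → ℕ}
  {B B' : Submodule (ToricRing k C) (AddMonoidAlgebra k M)}

open Classical in
variable (k C c r) in
/-- The inclusion of a summand of a sum of conic modules. -/
def summand (s : Σ i, Fin (r i)) :
    Mod (conic k C (c s.1)) →ₗ[ToricRing k C] ConicSum k C c r :=
  LinearMap.single (ToricRing k C) (fun t : Σ i, Fin (r i) => Mod (conic k C (c t.1))) s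

/-- The coordinates of a homomorphism from a sum of conic modules. -/
def coord : (ConicSum k C c r →ₗ[ToricRing k C] Mod B) →+ ((Σ i, Fin (r i)) → AddMonoidAlgebra k M)
    where
  toFun φ s := symbol (φ ∘ₗ summand k C c r s)
  map_zero' := by ext1 s; simp
  map_add' φ ψ := by ext1 s; simp [LinearMap.add_comp]

theorem level_le_of_coord_ne_zero {q : C.normals → ℤ} (hB : HasLevel B q)
    (φ : ConicSum k C c r →ₗ[ToricRing k C] Mod B) {s : Σ i, Fin (r i)} {m : M}
    (hm : (coord φ s).coeff m ≠ 0) (n : C.normals) : q n ≤ C.pairing n m + ⌈n.1 (c s.1)⌉ :=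
  level_le_of_symbol_ne_zero hB (φ ∘ₗ summand k C c r s) hm n

variable [Fintype ι]

theorem val_eq_sum_coord (φ : ConicSum k C c r →ₗ[ToricRing k C] Mod B) (f : ConicSum k C c r) :
    Mod.val (φ f) = ∑ s, coord φ s * Mod.val (f s) := by
  classical
  have h : f = ∑ s, Pi.single s (f s) := (Finset.univ_sum_single f).symm
  conv_lhs => rw [h]
  rw [map_sum, map_sum]
  refine Finset.sum_congr rfl fun s _ => ?_
  have := val_eq_symbol_mul (φ ∘ₗ summand k C c r s) (f s)
  refine Eq.trans ?_ this
  rw [LinearMap.comp_apply, summand, LinearMap.single_apply]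

theorem coord_eq {φ : ConicSum k C c r →ₗ[ToricRing k C] Mod B}
    {h : (Σ i, Fin (r i)) → AddMonoidAlgebra k M}
    (hφ : ∀ f, Mod.val (φ f) = ∑ s, h s * Mod.val (f s)) : coord φ = h := by
  classical
  ext1 s
  refine symbol_eq fun f => ?_
  rw [LinearMap.comp_apply, hφ, Finset.sum_eq_single s]
  · simp [summand]
  · intro t _ hts
    simp [summand, hts]
  · simp

theorem coord_injective :
    Function.Injective (coord : (ConicSum k C c r →ₗ[ToricRing k C] Mod B) → _) := by
  intro φ ψ h
  ext1 f
  apply Mod.ext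
  rw [val_eq_sum_coord, val_eq_sum_coord, h]

theorem coord_comp (φ : ConicSum k C c r →ₗ[ToricRing k C] Mod B)
    (a : Module.End (ToricRing k C) (ConicSum k C c r)) (s : Σ i, Fin (r i)) :
    coord (φ ∘ₗ a) s = ∑ t, coord φ t * coord (LinearMap.proj t ∘ₗ a) s := by
  refine congrFun (coord_eq (h := fun s => ∑ t, coord φ t * coord (LinearMap.proj t ∘ₗ a) s)
    fun f => ?_) s
  rw [LinearMap.comp_apply, val_eq_sum_coord]
  simp only [Finset.sum_mul]
  rw [Finset.sum_comm]
  refine Finset.sum_congr rfl fun t _ => ?_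
  have := val_eq_sum_coord (LinearMap.proj t ∘ₗ a) f
  rw [LinearMap.comp_apply, LinearMap.proj_apply] at this
  rw [this, Finset.mul_sum]
  exact Finset.sum_congr rfl fun s _ => (mul_assoc _ _ _).symm

/-- A homomorphism with given coordinates. -/
theorem exists_coord_eq {q : C.normals → ℤ} (hB : HasLevel B q)
    {h : (Σ i, Fin (r i)) → AddMonoidAlgebra k M}
    (hh : ∀ s m, (h s).coeff m ≠ 0 → ∀ n, q n ≤ C.pairing n m + ⌈n.1 (c s.1)⌉) :
    ∃ φ : ConicSum k C c r →ₗ[ToricRing k C] Mod B, coord φ = h := by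
  refine ⟨∑ s, mulHom (h s) ((hasLevel_conic C k (c s.1)).mul_mem hB (hh s)) ∘ₗ LinearMap.proj s,
    coord_eq fun f => ?_⟩
  simp [LinearMap.sum_apply]

end Coordinates

end

section

/-! ### Gradings detected by coordinates -/

/-- The additive coordinates `Φ` with values in a group algebra exhibit the family `𝒳` as the
grading of `X` by exponents. -/
structure HasCoordinates {G : Type*} [AddCommGroup G] {k : Type*} [Field k] {X T : Type*}
    [AddCommGroup X] (Φ : X →+ (T → AddMonoidAlgebra k G)) (𝒳 : G → AddSubgroup X) : Prop where
  injective : Function.Injective Φ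
  mem_iff : ∀ g x, x ∈ 𝒳 g ↔ ∀ t m, (Φ x t).coeff m ≠ 0 → m = g
  exists_truncation : ∀ x g, ∃ y, ∀ t, Φ y t = AddMonoidAlgebra.single g ((Φ x t).coeff g)

namespace HasCoordinates

variable {G : Type*} [AddCommGroup G] {k : Type*} [Field k] {X T : Type*} [AddCommGroup X]
  {Φ : X →+ (T → AddMonoidAlgebra k G)} {𝒳 : G → AddSubgroup X}

theorem truncation_mem (h : HasCoordinates Φ 𝒳) {x y : X} {g : G}
    (hy : ∀ t, Φ y t = AddMonoidAlgebra.single g ((Φ x t).coeff g)) : y ∈ 𝒳 g := by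
  rw [h.mem_iff]
  intro t m hm
  rw [hy] at hm
  by_contra hne
  exact hm (by simp [Ne.symm hne])

theorem eq_single (h : HasCoordinates Φ 𝒳) {x : X} {g : G} (hx : x ∈ 𝒳 g) (t : T) :
    Φ x t = AddMonoidAlgebra.single g ((Φ x t).coeff g) := by
  classical
  ext m
  rw [AddMonoidAlgebra.coeff_single, Finsupp.single_apply]
  split_ifs with hm
  · rw [hm]
  · by_contra hne
    exact hm ((h.mem_iff g x).1 hx t m hne).symm

/-- Every element is the sum of its truncations. -/
theorem exists_eq_sum [Finite T] (h : HasCoordinates Φ 𝒳) (x : X) :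
    ∃ (s : Finset G) (y : G → X), (∀ g t, Φ (y g) t = AddMonoidAlgebra.single g ((Φ x t).coeff g)) ∧
      x = ∑ g ∈ s, y g := by
  classical
  cases nonempty_fintype T
  choose y hy using h.exists_truncation x
  refine ⟨Finset.univ.biUnion fun t => (Φ x t).coeff.support, y, hy, h.injective ?_⟩
  rw [map_sum]
  ext t m
  simp only [Finset.sum_apply, hy, AddMonoidAlgebra.coeff_sum, Finsupp.finsetSum_apply,
    AddMonoidAlgebra.coeff_single, Finsupp.single_apply]
  rw [Finset.sum_ite_eq' _ m fun g => (Φ x t).coeff g]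
  split_ifs with hm
  · rfl
  · by_contra hne
    exact hm (Finset.mem_biUnion.2 ⟨t, Finset.mem_univ _, Finsupp.mem_support_iff.2 hne⟩)

/-- The coefficient at `g` of a sum of homogeneous elements sees only the component of degree `g`,
which gives uniqueness; truncations give existence. -/
theorem isGrading [Finite T] (h : HasCoordinates Φ 𝒳) : IsGrading 𝒳 := by
  classical
  constructor
  · rw [injective_iff_map_eq_zero]
    intro z hz
    have key : ∀ (z : DirectSum G fun g => 𝒳 g) (t : T) (g : G),
        (Φ (DirectSum.coeAddMonoidHom 𝒳 z) t).coeff g = (Φ (z g) t).coeff g := by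
      intro z t g
      induction z using DirectSum.induction_on with
      | zero => simp
      | of i x =>
        rw [DirectSum.coeAddMonoidHom_of]
        by_cases hi : i = g
        · subst hi
          rw [DirectSum.of_eq_same]
        · rw [DirectSum.of_eq_of_ne _ _ _ (Ne.symm hi)]
          by_contra hne
          rw [ZeroMemClass.coe_zero, map_zero] at hne
          exact hi ((h.mem_iff i x).1 x.2 t g hne).symm
      | add a b ha hb =>
        simp only [map_add, Pi.add_apply, AddMonoidAlgebra.coeff_add, Finsupp.add_apply, ha, hb,
          DirectSum.add_apply, AddSubgroup.coe_add]
    refine DFinsupp.ext fun g => Subtype.ext (h.injective ?_)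
    ext t m
    by_contra hne
    have hm : m = g := by
      refine (h.mem_iff g (z g)).1 (z g).2 t m fun h0 => hne ?_
      simpa using h0
    subst hm
    apply hne
    have := key z t m
    rw [hz] at this
    simpa using this.symm
  · intro x
    obtain ⟨s, y, hy, hx⟩ := h.exists_eq_sum x
    refine ⟨∑ g ∈ s, DirectSum.of (fun g => 𝒳 g) g ⟨y g, h.truncation_mem (hy g)⟩, ?_⟩
    rw [map_sum]
    refine Eq.trans ?_ hx.symm
    exact Finset.sum_congr rfl fun g _ => DirectSum.coeAddMonoidHom_of _ _ _

variable {Λ : Type*} [Ring Λ] [Module Λ X]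

/-- A submodule cut out by the vanishing of coefficients is graded. -/
theorem isGradedSubmodule [Finite T] (h : HasCoordinates Φ 𝒳) {N : Submodule Λ X}
    {P : T → G → Prop} (hN : ∀ x, x ∈ N ↔ ∀ t m, P t m → (Φ x t).coeff m = 0) :
    IsGradedSubmodule 𝒳 N := by
  classical
  refine le_antisymm (Submodule.span_le.2 fun x hx => hx.1) fun x hx => ?_
  obtain ⟨s, y, hy, hxy⟩ := h.exists_eq_sum x
  rw [hxy]
  refine Submodule.sum_mem _ fun g _ => Submodule.subset_span ⟨?_, g, h.truncation_mem (hy g)⟩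
  rw [hN]
  intro t m ht
  rw [hy, AddMonoidAlgebra.coeff_single, Finsupp.single_apply]
  split_ifs with hm
  · rw [hm]
    exact (hN x).1 hx t m ht
  · rfl

/-- The grading of the quotient by a submodule cut out by the vanishing of coefficients. -/
theorem isGrading_quotient [Finite T] (h : HasCoordinates Φ 𝒳) {N : Submodule Λ X}
    {P : T → G → Prop} (hN : ∀ x, x ∈ N ↔ ∀ t m, P t m → (Φ x t).coeff m = 0) :
    IsGrading (quotientGrading 𝒳 N) := by
  classical
  -- `F` keeps just the coefficients that have to vanish on `N`. Its kernel is `N`, so it induces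
  -- coordinates on the quotient.
  let F : X →+ (T → AddMonoidAlgebra k G) :=
    { toFun x t := .ofCoeff ((Φ x t).coeff.filter (P t))
      map_zero' := by
        ext t m
        simp [Finsupp.filter_apply]
      map_add' x y := by
        ext t m
        simp [Finsupp.filter_apply] }
  have hF : ∀ x t m, (F x t).coeff m = if P t m then (Φ x t).coeff m else 0 := fun x t m =>
    Finsupp.filter_apply _ _ _
  have hF0 : ∀ x, F x = 0 ↔ x ∈ N := by
    intro x
    rw [hN]
    constructor
    · intro h0 t m hP
      have := hF x t m
      rw [h0, if_pos hP] at this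
      exact this.symm
    · intro h0
      ext t m
      rw [hF]
      split_ifs with hP
      · exact h0 t m hP
      · rfl
  let Φ' : (X ⧸ N) →+ (T → AddMonoidAlgebra k G) :=
    QuotientAddGroup.lift N.toAddSubgroup F fun x hx => (hF0 x).2 hx
  have hΦ' : ∀ x, Φ' (N.mkQ x) = F x := fun x => rfl
  have htr : ∀ x g, ∃ y ∈ 𝒳 g, ∀ t, F y t = AddMonoidAlgebra.single g ((F x t).coeff g) := by
    intro x g
    obtain ⟨y, hy⟩ := h.exists_truncation x g
    refine ⟨y, h.truncation_mem hy, fun t => ?_⟩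
    ext m
    rw [hF, hF, hy, AddMonoidAlgebra.coeff_single, Finsupp.single_apply, AddMonoidAlgebra.coeff_single, Finsupp.single_apply]
    by_cases hm : g = m
    · subst hm
      simp
    · simp [hm]
  refine HasCoordinates.isGrading (Φ := Φ') ⟨?_, fun g x => ?_, fun x g => ?_⟩
  · rw [injective_iff_map_eq_zero]
    intro x
    obtain ⟨x, rfl⟩ := N.mkQ_surjective x
    intro hx
    exact (Submodule.Quotient.mk_eq_zero N).2 ((hF0 x).1 hx)
  · constructor
    · rintro ⟨x, hx, rfl⟩ t m hm
      change (F x t).coeff m ≠ 0 at hm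
      rw [hF] at hm
      exact (h.mem_iff g x).1 hx t m fun h0 => hm (by rw [h0, ite_self])
    · obtain ⟨x, rfl⟩ := N.mkQ_surjective x
      intro hx
      obtain ⟨y, hy, hyx⟩ := htr x g
      refine ⟨y, hy, ?_⟩
      change N.mkQ y = N.mkQ x
      rw [← sub_eq_zero, ← map_sub]
      refine (Submodule.Quotient.mk_eq_zero N).2 ((hF0 _).1 ?_)
      rw [map_sub, sub_eq_zero]
      ext t m
      rw [hyx, AddMonoidAlgebra.coeff_single, Finsupp.single_apply]
      split_ifs with hm
      · rw [hm]
      · by_contra hne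
        exact hm (hx t m (Ne.symm hne)).symm
  · obtain ⟨x, rfl⟩ := N.mkQ_surjective x
    obtain ⟨y, -, hyx⟩ := htr x g
    exact ⟨N.mkQ y, hyx⟩

end HasCoordinates

/-! ### The gradings of modules of homomorphisms -/

theorem mem_homGrading_piGrading {G R : Type*} [AddCommGroup G] [CommRing R] {X T : Type*}
    {Y : T → Type*} [AddCommGroup X] [∀ t, AddCommGroup (Y t)] [Module R X] [∀ t, Module R (Y t)]
    {𝒳 : G → AddSubgroup X} {𝒴 : ∀ t, G → AddSubgroup (Y t)} {g : G} {φ : X →ₗ[R] ∀ t, Y t} :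
    φ ∈ homGrading 𝒳 (piGrading 𝒴) g ↔ ∀ t, LinearMap.proj t ∘ₗ φ ∈ homGrading 𝒳 (𝒴 t) g :=
  ⟨fun h t m x hx => h m x hx t trivial, fun h m x hx t _ => h t m x hx⟩

section Coordinates

variable {E : Type*} [NormedAddCommGroup E] [NormedSpace ℝ E] {M : Submodule ℤ E}
  {k : Type*} [Field k] {C : ToricCone M}
  {ι : Type*} {c : ι → E} {r : ι → ℕ}
  {B : Submodule (ToricRing k C) (AddMonoidAlgebra k M)}

theorem smul_mem_homGrading {Y : Type*} [AddCommGroup Y] [Module (ToricRing k C) Y]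
    {𝒴 : M → AddSubgroup Y} {g h : M} {a : EndRing k C c r}
    {φ : ConicSum k C c r →ₗ[ToricRing k C] Y}
    (ha : a ∈ endGrading (R := ToricRing k C) (conicSumGrading k C c r) g)
    (hφ : φ ∈ homGrading (conicSumGrading k C c r) 𝒴 h) :
    a • φ ∈ homGrading (conicSumGrading k C c r) 𝒴 (g + h) := by
  intro m x hx
  have := hφ _ _ (ha m x hx)
  rwa [add_assoc] at this

variable [FiniteDimensional ℝ E] [DiscreteTopology M] [IsZLattice ℝ M] [Fintype ι]

theorem mem_homGrading_iff {φ : ConicSum k C c r →ₗ[ToricRing k C] Mod B} {g : M} :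
    φ ∈ homGrading (conicSumGrading k C c r) (monomialGrading B) g ↔
      ∀ s m, (coord φ s).coeff m ≠ 0 → m = g := by
  classical
  constructor
  · intro h s m hm
    obtain ⟨a, ha⟩ := exists_monomial_mem_conic k C (c s.1)
    have h1 := h a (summand k C c r s (Mod.mk _ ha)) fun t _ m' hm' => by
      by_cases hts : t = s
      · subst hts
        by_contra hne
        exact hm' (by simp [summand, Ne.symm hne])
      · exact absurd (by simp [summand, hts]) hm'
    have h2 := h1 (m + a)
    have h3 := val_eq_symbol_mul (φ ∘ₗ summand k C c r s) (Mod.mk _ ha)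
    rw [LinearMap.comp_apply] at h3
    rw [h3, Mod.val_mk, AddMonoidAlgebra.coeff_mul_single_apply, mul_one, add_neg_cancel_right,
      add_comm] at h2
    exact add_left_cancel (h2 hm)
  · intro h m f hf m' hm'
    rw [val_eq_sum_coord, AddMonoidAlgebra.coeff_sum, Finsupp.finsetSum_apply] at hm'
    obtain ⟨s, -, hs⟩ := Finset.exists_ne_zero_of_sum_ne_zero hm'
    obtain ⟨a, b, rfl, ha, hb⟩ := exists_coeff_ne_zero_of_mul hs
    rw [h s a ha, hf s trivial b hb, add_comm]

/-- The level condition concerns each monomial separately, so truncated coordinates again belong to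
a homomorphism. -/
theorem hasCoordinates_hom {q : C.normals → ℤ} (hB : HasLevel B q) :
    HasCoordinates (coord : (ConicSum k C c r →ₗ[ToricRing k C] Mod B) →+ _)
      (homGrading (conicSumGrading k C c r) (monomialGrading B)) where
  injective := coord_injective
  mem_iff _ _ := mem_homGrading_iff
  exists_truncation φ g := by
    classical
    obtain ⟨ψ, hψ⟩ := exists_coord_eq (r := r) hB
      (h := fun s => AddMonoidAlgebra.single g ((coord φ s).coeff g)) fun s m hm n => by
        rw [AddMonoidAlgebra.coeff_single, Finsupp.single_apply] at hm
        have hg : g = m := by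
          by_contra hne
          exact hm (if_neg hne)
        rw [if_pos hg, hg] at hm
        exact level_le_of_coord_ne_zero hB φ hm n
    exact ⟨ψ, congrFun hψ⟩

variable {T : Type*} {D : T → Submodule (ToricRing k C) (AddMonoidAlgebra k M)}

/-- The coordinates of a homomorphism from a sum of conic modules to a product. -/
def coordPi : (ConicSum k C c r →ₗ[ToricRing k C] ∀ t, Mod (D t)) →+
    (T × (Σ i, Fin (r i)) → AddMonoidAlgebra k M) where
  toFun φ t := coord (LinearMap.proj t.1 ∘ₗ φ) t.2
  map_zero' := by
    ext1 t
    rw [LinearMap.comp_zero, map_zero]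
    rfl
  map_add' φ ψ := by
    ext1 t
    rw [LinearMap.comp_add, map_add]
    rfl

theorem hasCoordinates_hom_pi {q : T → C.normals → ℤ} (hD : ∀ t, HasLevel (D t) (q t)) :
    HasCoordinates (coordPi : (ConicSum k C c r →ₗ[ToricRing k C] ∀ t, Mod (D t)) →+ _)
      (homGrading (conicSumGrading k C c r) (piGrading fun t => monomialGrading (D t))) where
  injective φ ψ h := by
    refine LinearMap.ext fun x => funext fun t => ?_
    refine LinearMap.congr_fun (f := LinearMap.proj t ∘ₗ φ) (g := LinearMap.proj t ∘ₗ ψ) ?_ x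
    exact coord_injective (funext fun s => congrFun h (t, s))
  mem_iff g φ := by
    rw [mem_homGrading_piGrading]
    simp only [mem_homGrading_iff, Prod.forall]
    rfl
  exists_truncation φ g := by
    choose ψ hψ using fun t => (hasCoordinates_hom (c := c) (r := r) (hD t)).exists_truncation
      (LinearMap.proj t ∘ₗ φ) g
    exact ⟨LinearMap.pi ψ, fun t => hψ t.1 t.2⟩

variable (k C c r)

theorem isRingGrading_end : IsRingGrading (endGrading (R := ToricRing k C)
    (conicSumGrading k C c r)) where
  isGrading := by
    have h := hasCoordinates_hom_pi (c := c) (r := r) (D := fun s : Σ i, Fin (r i) =>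
      conic k C (c s.1)) fun s => hasLevel_conic C k (c s.1)
    refine HasCoordinates.isGrading (T := (Σ i, Fin (r i)) × (Σ i, Fin (r i)))
      (Φ := (coordPi (D := fun s : Σ i, Fin (r i) => conic k C (c s.1))).comp
        (MulOpposite.opAddEquiv.symm.toAddMonoidHom :
          EndRing k C c r →+ Module.End (ToricRing k C) (ConicSum k C c r))) ⟨?_, ?_, ?_⟩
    · exact h.injective.comp MulOpposite.opAddEquiv.symm.injective
    · exact fun g x => h.mem_iff g x.unop
    · intro x g
      obtain ⟨y, hy⟩ := h.exists_truncation x.unop g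
      exact ⟨MulOpposite.op y, hy⟩
  one_mem m x hx := by simpa using hx
  -- In the opposite ring `a * b` applies `a` first.
  mul_mem {g h a b} ha hb m x hx := by
    have := hb _ _ (ha m x hx)
    rwa [add_assoc] at this

end Coordinates

end

section

variable {E : Type*} [NormedAddCommGroup E] [NormedSpace ℝ E] {M : Submodule ℤ E}
  {k : Type*} [Field k] {C : ToricCone M}
  {ι : Type*} {c : ι → E} {r : ι → ℕ}

/-! ### The radical of a projective module -/

variable (C) in
/-- Multiplication by `x^m` is an isomorphism from the conic module of `w` to that of `v`. -/
def IsUnitDegree (w v : E) (m : M) : Prop := ∀ n : C.normals, C.pairing n m + ⌈n.1 w⌉ = ⌈n.1 v⌉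

theorem IsUnitDegree.symm {w v : E} {m : M} (h : IsUnitDegree C w v m) :
    IsUnitDegree C v w (-m) := fun n => by
  have := h n
  rw [map_neg]
  omega

theorem EndRing.smul_def {Y : Type*} [AddCommGroup Y] [Module (ToricRing k C) Y]
    (a : EndRing k C c r) (φ : ConicSum k C c r →ₗ[ToricRing k C] Y) :
    a • φ = φ ∘ₗ a.unop := rfl

theorem single_coeff_ne_zero {G : Type*} [AddCommGroup G] {k : Type*} [Field k] {g m : G} {a : k}
    (h : (AddMonoidAlgebra.single g a).coeff m ≠ 0) : m = g := by
  by_contra hne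
  exact h (by simp [Ne.symm hne])

variable [FiniteDimensional ℝ E] [DiscreteTopology M] [IsZLattice ℝ M]

theorem IsUnitDegree.single_mul_mem {w v : E} {m : M} (h : IsUnitDegree C w v m) (a : k) :
    ∀ f ∈ conic k C w, AddMonoidAlgebra.single m a * f ∈ conic k C v :=
  (hasLevel_conic C k w).mul_mem (hasLevel_conic C k v) fun m' hm' n => by
    rw [single_coeff_ne_zero hm', h n]

/-- The symbols of an isomorphism and its inverse have product 1, so they contain opposite
exponents. The two level inequalities for these are opposite as well, hence equalities. -/
theorem exists_isUnitDegree (hA : IsCompleteSum k C c r) (v : E) :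
    ∃ (s : Σ i, Fin (r i)) (m : M), IsUnitDegree C (c s.1) v m := by
  obtain ⟨j, ⟨e⟩, -⟩ := hA.existsUnique v
  have h1 : symbol e.symm.toLinearMap * symbol e.toLinearMap = 1 := by
    have h2 : symbol (e.symm.toLinearMap ∘ₗ e.toLinearMap) = 1 :=
      symbol_eq fun f => by simp
    rw [← h2]
    refine (symbol_eq fun f => ?_).symm
    rw [LinearMap.comp_apply, val_eq_symbol_mul, val_eq_symbol_mul, mul_assoc]
  have h3 : (symbol e.symm.toLinearMap * symbol e.toLinearMap).coeff 0 ≠ 0 := by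
    rw [h1]
    simp
  obtain ⟨a, b, hab, ha, hb⟩ := exists_coeff_ne_zero_of_mul h3
  refine ⟨⟨j, ⟨0, hA.mult_pos j⟩⟩, a, fun n => ?_⟩
  have h4 := level_le_of_symbol_ne_zero (hasLevel_conic C k v) _ ha n
  have h5 := level_le_of_symbol_ne_zero (hasLevel_conic C k (c j)) _ hb n
  have h6 : C.pairing n a + C.pairing n b = 0 := by rw [← map_add, hab, map_zero]
  dsimp only at h4 h5 ⊢
  omega

/-- Every conic module is a direct summand of a complete sum. -/
theorem exists_retraction (hA : IsCompleteSum k C c r)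
    {B : Submodule (ToricRing k C) (AddMonoidAlgebra k M)} {v : E} (hB : B = conic k C v) :
    ∃ (e : Mod B →ₗ[ToricRing k C] ConicSum k C c r)
      (q : ConicSum k C c r →ₗ[ToricRing k C] Mod B), q ∘ₗ e = LinearMap.id := by
  subst hB
  obtain ⟨s, m, hm⟩ := exists_isUnitDegree hA v
  refine ⟨summand k C c r s ∘ₗ mulHom _ (hm.symm.single_mul_mem (1 : k)⁻¹),
    mulHom _ (hm.single_mul_mem 1) ∘ₗ LinearMap.proj s, LinearMap.ext fun f => Mod.ext ?_⟩
  simp only [LinearMap.comp_apply, val_mulHom, summand, LinearMap.single_apply,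
    LinearMap.proj_apply, Pi.single_eq_same, LinearMap.id_apply]
  exact single_mul_inv m one_ne_zero _

/-- Open conic modules are conic and hence retracts of the complete sum, so `Hom` into a finite
product of them is a retract of a free module. -/
theorem projective_homK (hA : IsCompleteSum k C c r) (p : E) (i : ℕ) :
    Module.Projective (EndRing k C c r) (HomK k C c r p i) := by
  have hret : ∀ τ : Cell C p i, ∃ (e : Mod (cellModule k C τ) →ₗ[ToricRing k C] ConicSum k C c r)
      (q : ConicSum k C c r →ₗ[ToricRing k C] Mod (cellModule k C τ)), q ∘ₗ e = LinearMap.id :=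
    fun τ => by
      obtain ⟨v, hv, -⟩ := exists_openConic_eq_conic C k τ.point
      exact exists_retraction hA hv
  choose e q hqe using hret
  let f : HomK k C c r p i →ₗ[EndRing k C c r] (Cell C p i → EndRing k C c r) :=
    { toFun φ τ := MulOpposite.op (e τ ∘ₗ LinearMap.proj τ ∘ₗ φ)
      map_add' φ ψ := by
        ext1 τ
        rw [LinearMap.comp_add, LinearMap.comp_add]
        rfl
      map_smul' a φ := rfl }
  let g : (Cell C p i → EndRing k C c r) →ₗ[EndRing k C c r] HomK k C c r p i :=
    { toFun a := LinearMap.pi fun τ => q τ ∘ₗ (a τ).unop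
      map_add' a b := by
        ext1 x
        funext τ
        exact map_add (q τ) _ _
      map_smul' a b := rfl }
  have : Module.Projective (EndRing k C c r) (Cell C p i → EndRing k C c r) :=
    Module.Projective.of_free
  refine Module.Projective.of_split f g (LinearMap.ext fun φ => LinearMap.ext fun x =>
    funext fun τ => ?_)
  exact LinearMap.congr_fun (hqe τ) (φ x τ)

variable [Fintype ι]

variable (k C c r) in
/-- The homomorphisms to a conic module none of whose components is a sum that involves an
isomorphism. -/
def nonunits (v : E) : Submodule (EndRing k C c r) (ProjMod k C c r v) where
  carrier := {φ | ∀ s m, IsUnitDegree C (c s.1) v m → (coord φ s).coeff m = 0}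
  zero_mem' s m _ := by simp
  add_mem' ha hb s m hm := by simp [ha s m hm, hb s m hm]
  smul_mem' a φ hφ s m hm := by
    rw [EndRing.smul_def, coord_comp]
    by_contra hne
    rw [AddMonoidAlgebra.coeff_sum, Finsupp.finsetSum_apply] at hne
    obtain ⟨t, -, ht⟩ := Finset.exists_ne_zero_of_sum_ne_zero hne
    obtain ⟨m1, m2, rfl, h1, h2⟩ := exists_coeff_ne_zero_of_mul ht
    -- If `m1 + m2` is the degree of an isomorphism, the level inequalities for `m1` and `m2` are
    -- both equalities, and `m1` is one too.
    refine h1 (hφ t m1 fun n => ?_)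
    have h3 := level_le_of_coord_ne_zero (hasLevel_conic C k v) φ h1 n
    have h4 := level_le_of_coord_ne_zero (hasLevel_conic C k (c t.1)) _ h2 n
    have h5 := hm n
    rw [map_add] at h5
    omega

theorem mem_nonunits {v : E} {φ : ProjMod k C c r v} : φ ∈ nonunits k C c r v ↔
    ∀ s m, IsUnitDegree C (c s.1) v m → (coord φ s).coeff m = 0 := Iff.rfl

variable (k C c r) in
theorem hasCoordinates_proj (v : E) :
    HasCoordinates (coord : ProjMod k C c r v →+ _) (projGrading k C c r v) :=
  hasCoordinates_hom (hasLevel_conic C k v)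

theorem isGradedSubmodule_nonunits (v : E) :
    IsGradedSubmodule (projGrading k C c r v) (nonunits k C c r v) :=
  (hasCoordinates_proj k C c r v).isGradedSubmodule (P := fun s => IsUnitDegree C (c s.1) v)
    fun _ => mem_nonunits

/-- A homogeneous element outside of the radical generates. -/
theorem exists_comp_eq {v : E} {x : ProjMod k C c r v} {g : M} (hx : x ∈ projGrading k C c r v g)
    (hxn : x ∉ nonunits k C c r v) (φ : ProjMod k C c r v) :
    ∃ a : EndRing k C c r, a • x = φ := by
  rw [mem_nonunits] at hxn
  push Not at hxn
  obtain ⟨s, m, hm, hne⟩ := hxn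
  -- By homogeneity the coordinate at `s` is a single monomial of degree `m`, so `x` restricts to an
  -- isomorphism on that summand.
  obtain rfl : m = g := ((hasCoordinates_proj k C c r v).mem_iff g x).1 hx s m hne
  have h1 := (hasCoordinates_proj k C c r v).eq_single hx s
  have h2 : (x ∘ₗ summand k C c r s) ∘ₗ
      mulHom _ (hm.symm.single_mul_mem ((coord x s).coeff m)⁻¹) = LinearMap.id := by
    refine LinearMap.ext fun f => Mod.ext ?_
    have h3 : symbol (x ∘ₗ summand k C c r s) = coord x s := rfl
    rw [LinearMap.comp_apply, val_eq_symbol_mul, h3, val_mulHom]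
    conv_lhs => enter [1]; rw [h1]
    exact single_mul_inv m hne _
  refine ⟨MulOpposite.op (summand k C c r s ∘ₗ
    mulHom _ (hm.symm.single_mul_mem ((coord x s).coeff m)⁻¹) ∘ₗ φ), ?_⟩
  rw [EndRing.smul_def, MulOpposite.unop_op, ← LinearMap.comp_assoc, ← LinearMap.comp_assoc, h2,
    LinearMap.id_comp]

/-- A proper graded submodule is spanned by homogeneous elements, none of which generates the whole
module; by `exists_comp_eq` they all lie in `nonunits`. -/
theorem projRadical_eq (v : E) (hne : nonunits k C c r v ≠ ⊤) :
    projRadical k C c r v = nonunits k C c r v := by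
  refine le_antisymm (sSup_le ?_) (le_sSup ⟨isGradedSubmodule_nonunits v, hne⟩)
  rintro N ⟨hN, hNtop⟩
  rw [← hN]
  refine Submodule.span_le.2 ?_
  rintro x ⟨hxN, g, hxg⟩
  by_contra hx
  refine hNtop (eq_top_iff.2 fun φ _ => ?_)
  obtain ⟨a, rfl⟩ := exists_comp_eq hxg hx φ
  exact N.smul_mem a hxN

theorem nonunits_ne_top (hA : IsCompleteSum k C c r) (v : E) : nonunits k C c r v ≠ ⊤ := by
  classical
  intro h
  obtain ⟨s, m, hm⟩ := exists_isUnitDegree hA v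
  obtain ⟨φ, hφ⟩ := exists_coord_eq (r := r) (hasLevel_conic C k v)
    (h := Pi.single s (AddMonoidAlgebra.single m (1 : k))) fun t m' hm' n => by
      by_cases hts : t = s
      · subst hts
        rw [Pi.single_eq_same] at hm'
        rw [single_coeff_ne_zero hm', hm n]
      · exact absurd (by simp [hts]) hm'
  have h1 := mem_nonunits.1 (h ▸ Submodule.mem_top : φ ∈ nonunits k C c r v) s m hm
  rw [hφ] at h1
  simp at h1

theorem mem_projRadical_iff (hA : IsCompleteSum k C c r) {v : E} {φ : ProjMod k C c r v} :
    φ ∈ projRadical k C c r v ↔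
      ∀ s m, IsUnitDegree C (c s.1) v m → (coord φ s).coeff m = 0 := by
  rw [projRadical_eq v (nonunits_ne_top hA v), mem_nonunits]

theorem isGradedSimple_simpleMod (hA : IsCompleteSum k C c r) (v : E) :
    IsGradedSimple (EndRing k C c r) (simpleGrading k C c r v) := by
  have hrad := projRadical_eq v (nonunits_ne_top hA v)
  refine ⟨Submodule.Quotient.nontrivial_iff.2 (hrad ▸ nonunits_ne_top hA v), fun N hN => ?_⟩
  by_contra! hcon
  obtain ⟨h0, h1⟩ := hcon
  refine h0 ?_
  rw [← hN, Submodule.span_eq_bot]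
  rintro _ ⟨hxN, g, x, hx, rfl⟩
  by_contra hx0
  have hxr : x ∉ nonunits k C c r v := fun h =>
    hx0 ((Submodule.Quotient.mk_eq_zero _).2 (hrad ▸ h))
  refine h1 (eq_top_iff.2 fun y _ => ?_)
  obtain ⟨φ, rfl⟩ := (projRadical k C c r v).mkQ_surjective y
  obtain ⟨a, rfl⟩ := exists_comp_eq hx hxr φ
  rw [map_smul]
  exact N.smul_mem a hxN

theorem isModuleGrading_simpleMod (hA : IsCompleteSum k C c r) (v : E) :
    IsModuleGrading (endGrading (R := ToricRing k C) (conicSumGrading k C c r))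
      (simpleGrading k C c r v) where
  isGrading := (hasCoordinates_proj k C c r v).isGrading_quotient
    (P := fun s => IsUnitDegree C (c s.1) v) fun _ => mem_projRadical_iff hA
  smul_mem := by
    rintro g h a _ ha ⟨x, hx, rfl⟩
    exact ⟨a • x, smul_mem_homGrading ha hx, map_smul (projRadical k C c r v).mkQ a x⟩

/-! ### The terms of the resolution -/

theorem isModuleGrading_homK (p : E) (i : ℕ) :
    IsModuleGrading (endGrading (R := ToricRing k C) (conicSumGrading k C c r))
      (homKGrading k C c r p i) where
  isGrading := (hasCoordinates_hom_pi fun τ : Cell C p i => hasLevel_cellModule k τ).isGrading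
  smul_mem ha hx := smul_mem_homGrading ha hx

end

section

variable {E : Type*} [NormedAddCommGroup E] [NormedSpace ℝ E] {M : Submodule ℤ E}
  {k : Type*} [Field k] {C : ToricCone M} {p : E}

/-! ### The differential in coordinates -/

theorem val_Kd (o : ∀ (i : ℕ) (τ : Cell C p i), CellOrientation τ.1) {i : ℕ}
    (f : K k C p (i + 1)) (τ' : Cell C p i) :
    Mod.val (Kd k C o i f τ') = ∑ τ, Kcoeff k o τ' τ • Mod.val (f τ) := by
  classical
  simp only [Kd, LinearMap.pi_apply, LinearMap.sum_apply, map_sum, LinearMap.comp_apply,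
    LinearMap.proj_apply]
  refine Finset.sum_congr rfl fun τ _ => ?_
  unfold Kcoeff
  split_ifs with h
  · rw [LinearMap.smul_apply, map_zsmul, Mod.val_inclusion]
  · simp

theorem val_KzeroTo (f : K k C p 0) : Mod.val (KzeroTo k C p f) = ∑ τ, Mod.val (f τ) := by
  simp [KzeroTo, LinearMap.sum_apply]

variable {ι : Type*} {c : ι → E} {r : ι → ℕ}

/-- The component of a homomorphism at a cell. -/
def component {i : ℕ} (f : HomK k C c r p i) (τ : Cell C p i) :
    ConicSum k C c r →ₗ[ToricRing k C] Mod (cellModule k C τ) := LinearMap.proj τ ∘ₗ f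

theorem component_apply {i : ℕ} (f : HomK k C c r p i) (τ : Cell C p i) (x : ConicSum k C c r) :
    component f τ x = f x τ := rfl

theorem component_zero {i : ℕ} (τ : Cell C p i) : component (0 : HomK k C c r p i) τ = 0 := rfl

theorem ceil_add_eq (m : M) (w : E) (n : C.normals) :
    ⌈n.1 (m + w)⌉ = C.pairing n m + ⌈n.1 w⌉ := by
  rw [map_add, ← C.pairing_spec, Int.ceil_intCast_add]

theorem isUnitDegree_iff {w : E} {m : M} :
    IsUnitDegree C w p m ↔ ∀ n : C.normals, ⌈n.1 p⌉ = ⌈n.1 (m + w)⌉ := by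
  refine forall_congr' fun n => ?_
  rw [ceil_add_eq]
  exact eq_comm

theorem Cell.neg_one_of_ne_zero [FiniteDimensional ℝ E] {i : ℕ} (τ : Cell C p i) {n : C.normals}
    (h : τ.index.1 n ≠ 0) : τ.index.1 n = -1 := by
  have h1 := τ.index_ne_one n
  revert h1 h
  generalize τ.index.1 n = σ
  revert σ
  decide

/-! ### The cell of codimension zero -/

/-- A cell of codimension zero has all directions, and no normal vanishes on all of them. -/
theorem Cell.index_zero [FiniteDimensional ℝ E] (τ : Cell C p 0) (n : C.normals) : τ.index.1 n = -1 := by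
  refine τ.neg_one_of_ne_zero fun h0 => ?_
  have h1 : (chamberArrangement C p).dir τ.index.1 = ⊤ :=
    Submodule.eq_top_of_finrank_eq τ.finrank_dir
  have h2 : ∀ x : E, x ∈ (chamberArrangement C p).dir τ.index.1 := fun x => h1 ▸ trivial
  have h3 : ∀ x, n.1 x = 0 := fun x => ((chamberArrangement C p).mem_dir).1 (h2 x) n h0
  exact n.2.2.1 (LinearMap.ext h3)

theorem Cell.eq_zero_of_index [FiniteDimensional ℝ E] {i : ℕ} (τ : Cell C p i) (h : ∀ n, τ.index.1 n ≠ 0) : i = 0 := by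
  have h1 := τ.finrank_dir
  have h2 : (chamberArrangement C p).dir τ.index.1 = ⊤ :=
    eq_top_iff.2 fun x _ => ((chamberArrangement C p).mem_dir).2 fun n hn => absurd hn (h n)
  rw [h2, finrank_top] at h1
  omega

/-- At the lowest levels a contributing cell lies on no wall. This is why the degrees of the simple
module occur only in homological degree zero. -/
theorem Cell.eq_zero_of_admissible [FiniteDimensional ℝ E] {i : ℕ} (τ : Cell C p i) {q : C.normals → ℤ}
    (hq : ∀ n, ⌈n.1 p⌉ = q n) (h : Admissible q τ) : i = 0 := by
  refine τ.eq_zero_of_index fun n hn => ?_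
  have := h n
  rw [if_pos hn, hq] at this
  omega

theorem Admissible.le [FiniteDimensional ℝ E] {q : C.normals → ℤ} {i : ℕ} {τ : Cell C p i} (h : Admissible q τ)
    (n : C.normals) : ⌈n.1 p⌉ ≤ q n := by
  have := h n
  split_ifs at this <;> omega

variable [FiniteDimensional ℝ E] [DiscreteTopology M] [IsZLattice ℝ M]

theorem Kd_comp_Kd (o : ∀ (i : ℕ) (τ : Cell C p i), CellOrientation τ.1) (i : ℕ) :
    Kd k C o i ∘ₗ Kd k C o (i + 1) = 0 := by
  refine LinearMap.ext fun f => funext fun τ'' => Mod.ext ?_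
  rw [LinearMap.comp_apply, val_Kd]
  simp only [val_Kd, Finset.smul_sum, smul_smul]
  rw [Finset.sum_comm]
  simp only [← Finset.sum_smul, sum_Kcoeff_mul, zero_smul, Finset.sum_const_zero]
  simp

instance : Subsingleton (Cell C p 0) :=
  ⟨fun τ τ' => Cell.index_injective (Subtype.ext (funext fun n => by
    rw [τ.index_zero, τ'.index_zero]))⟩

instance : Nonempty (Cell C p 0) := by
  obtain ⟨y, hy, hs⟩ := exists_generic_point (C := C) (p := p) (y := p) fun n => le_rfl
  have hs' : ∀ n, (chamberArrangement C p).signs y n = -1 := fun n => by rw [hs, if_pos rfl]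
  let s : (chamberArrangement C p).Realized := ⟨(chamberArrangement C p).signs y, y, hy, rfl⟩
  have h2 : (chamberArrangement C p).dir s.1 = ⊤ :=
    eq_top_iff.2 fun x _ => ((chamberArrangement C p).mem_dir).2 fun n hn =>
      absurd ((hs' n).symm.trans hn) (by decide)
  obtain ⟨τ, -⟩ := exists_cell_index_eq (s := s) (i := 0)
    (fun n h => absurd ((hs' n).symm.trans h) (by decide)) (by rw [h2, finrank_top, add_zero])
  exact ⟨τ⟩

theorem cellModule_zero (τ : Cell C p 0) : cellModule k C τ = conic k C p := by
  refine (hasLevel_cellModule k τ).eq_of_eq ?_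
  have := hasLevel_conic C k p
  convert this using 2 with n
  rw [if_neg (by rw [τ.index_zero]; decide)]

variable (k C p) in
/-- The term of degree zero is the conic module of the chamber. -/
theorem exists_KzeroTo_section :
    ∃ g : Mod (conic k C p) →ₗ[ToricRing k C] K k C p 0,
      KzeroTo k C p ∘ₗ g = LinearMap.id := by
  refine ⟨LinearMap.pi fun τ => Mod.inclusion (cellModule_zero τ).ge, LinearMap.ext fun f =>
    Mod.ext ?_⟩
  obtain ⟨τ⟩ : Nonempty (Cell C p 0) := inferInstance
  rw [LinearMap.comp_apply, val_KzeroTo, Fintype.sum_subsingleton _ τ]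
  rfl

theorem coord_eq_zero_of_not_admissible {i : ℕ} (f : HomK k C c r p i) (τ : Cell C p i)
    {s : Σ i, Fin (r i)} {m : M} (h : ¬ Admissible (fun n => ⌈n.1 (m + c s.1)⌉) τ) :
    (coord (component f τ) s).coeff m = 0 := by
  by_contra hne
  refine h fun n => ?_
  have := level_le_of_coord_ne_zero (hasLevel_cellModule k τ) (component f τ) hne n
  exact this.trans_eq (ceil_add_eq m (c s.1) n).symm

/-! ### Exactness in each degree -/

variable [Fintype ι]

theorem coord_Kd_comp (o : ∀ (i : ℕ) (τ : Cell C p i), CellOrientation τ.1) {i : ℕ}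
    (f : HomK k C c r p (i + 1)) (τ' : Cell C p i) (s : Σ i, Fin (r i)) (m : M) :
    (coord (component (homKd k C c r o i f) τ') s).coeff m =
      ∑ τ, (Kcoeff k o τ' τ : k) * (coord (component f τ) s).coeff m := by
  have h : coord (component (homKd k C c r o i f) τ') =
      ∑ τ, Kcoeff k o τ' τ • coord (component f τ) := by
    refine coord_eq fun x => ?_
    change Mod.val (Kd k C o i (f x) τ') = _
    rw [val_Kd]
    simp only [Finset.sum_apply, Finset.sum_mul, Pi.smul_apply]
    rw [Finset.sum_comm]
    refine Finset.sum_congr rfl fun τ _ => ?_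
    have := val_eq_sum_coord (component f τ) x
    rw [component_apply] at this
    rw [this, Finset.smul_sum]
    simp only [smul_mul_assoc]
  rw [h, Finset.sum_apply, AddMonoidAlgebra.coeff_sum, Finsupp.finsetSum_apply]
  refine Finset.sum_congr rfl fun τ _ => ?_
  rw [Pi.smul_apply, AddMonoidAlgebra.coeff_smul, Finsupp.smul_apply, zsmul_eq_mul]

theorem coord_KzeroTo_comp (f : HomK k C c r p 0) (s : Σ i, Fin (r i)) (m : M) :
    (coord (KzeroTo k C p ∘ₗ f) s).coeff m =
      ∑ τ, (coord (component f τ) s).coeff m := by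
  have h : coord (KzeroTo k C p ∘ₗ f) = ∑ τ, coord (component f τ) := by
    refine coord_eq fun x => ?_
    rw [LinearMap.comp_apply, val_KzeroTo]
    simp only [Finset.sum_apply, Finset.sum_mul]
    rw [Finset.sum_comm]
    exact Finset.sum_congr rfl fun τ _ => val_eq_sum_coord (component f τ) x
  rw [h, Finset.sum_apply, AddMonoidAlgebra.coeff_sum, Finsupp.finsetSum_apply]

/-- Preimages under the differential can be found degree by degree. -/
theorem exists_homKd_eq (o : ∀ (i : ℕ) (τ : Cell C p i), CellOrientation τ.1) {i : ℕ}
    (f : HomK k C c r p i)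
    (hf : ∀ (s : Σ i, Fin (r i)) (m : M), ∃ b : Cell C p (i + 1) → k,
      (∀ τ, ¬ Admissible (fun n => ⌈n.1 (m + c s.1)⌉) τ → b τ = 0) ∧
      ∀ τ : Cell C p i, ∑ ρ : Cell C p (i + 1), (Kcoeff k o τ ρ : k) * b ρ =
        (coord (component f τ) s).coeff m) :
    ∃ g : HomK k C c r p (i + 1), homKd k C c r o i g = f := by
  classical
  -- The preimage is taken to be zero wherever the target is, so that the chosen coefficients have
  -- finite support in `m`.
  have hf' : ∀ (s : Σ i, Fin (r i)) (m : M), ∃ b : Cell C p (i + 1) → k,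
      (∀ τ, ¬ Admissible (fun n => ⌈n.1 (m + c s.1)⌉) τ → b τ = 0) ∧
      (∀ τ : Cell C p i, ∑ ρ : Cell C p (i + 1), (Kcoeff k o τ ρ : k) * b ρ =
        (coord (component f τ) s).coeff m) ∧
      ((∀ τ, (coord (component f τ) s).coeff m = 0) → b = 0) := by
    intro s m
    by_cases h0 : ∀ τ, (coord (component f τ) s).coeff m = 0
    · exact ⟨0, by simp, by simp [h0], fun _ => rfl⟩
    · obtain ⟨b, h1, h2⟩ := hf s m
      exact ⟨b, h1, h2, fun h => absurd h h0⟩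
  choose b hadm hb hzero using hf'
  let F : Cell C p (i + 1) → (Σ i, Fin (r i)) → AddMonoidAlgebra k M := fun ρ s =>
    .ofCoeff (Finsupp.onFinset
      (Finset.univ.biUnion fun τ => (coord (component f τ) s).coeff.support)
      (fun m => b s m ρ) fun m hm => by
        by_contra h
        refine hm (congrFun (hzero s m fun τ => ?_) ρ)
        by_contra hne
        exact h (Finset.mem_biUnion.2 ⟨τ, Finset.mem_univ _, Finsupp.mem_support_iff.2 hne⟩))
  have hF : ∀ ρ s m, (F ρ s).coeff m = b s m ρ := fun _ _ _ => rfl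
  choose g hg using fun ρ : Cell C p (i + 1) =>
    exists_coord_eq (c := c) (r := r) (hasLevel_cellModule k ρ) (h := F ρ) fun s m hm n => by
      by_contra h
      refine hm (hadm s m ρ fun hadm' => h ?_)
      have := hadm' n
      exact this.trans_eq (ceil_add_eq m (c s.1) n)
  refine ⟨LinearMap.pi g, (hasCoordinates_hom_pi fun τ : Cell C p i =>
    hasLevel_cellModule k τ).injective (funext fun t => ?_)⟩
  ext m
  change (coord (component (homKd k C c r o i (LinearMap.pi g)) t.1) t.2).coeff m = _
  rw [coord_Kd_comp]
  refine Eq.trans (Finset.sum_congr rfl fun ρ _ => ?_) (hb t.2 m t.1)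
  change _ * (coord (g ρ) t.2).coeff m = _
  rw [hg, hF]

/-- In degrees below some level all terms vanish, and in the degrees of the simple module all terms
of positive codimension do; the remaining degrees are covered by `exists_Kcoeff_preimage`. -/
theorem exact_homKd_succ (o : ∀ (i : ℕ) (τ : Cell C p i), CellOrientation τ.1) (i : ℕ) :
    Function.Exact (homKd k C c r o (i + 1)) (homKd k C c r o i) := by
  intro f
  constructor
  · intro hf
    refine exists_homKd_eq o f fun s m => ?_
    by_cases hle : ∀ n : C.normals, ⌈n.1 p⌉ ≤ ⌈n.1 (m + c s.1)⌉
    · by_cases hne : ∃ n : C.normals, ⌈n.1 p⌉ ≠ ⌈n.1 (m + c s.1)⌉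
      · refine exists_Kcoeff_preimage k o hle hne _
          (fun τ => coord_eq_zero_of_not_admissible f τ) ?_
        intro j hj τ'
        obtain rfl : j = i := by omega
        have := coord_Kd_comp o f τ' s m
        rw [hf, component_zero, map_zero] at this
        exact this.symm
      · push Not at hne
        refine ⟨0, by simp, fun τ => ?_⟩
        rw [coord_eq_zero_of_not_admissible f τ fun h =>
          absurd (τ.eq_zero_of_admissible hne h) (by omega)]
        simp
    · refine ⟨0, by simp, fun τ => ?_⟩
      rw [coord_eq_zero_of_not_admissible f τ fun h => hle h.le]
      simp
  · rintro ⟨g, rfl⟩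
    have := Kd_comp_Kd (k := k) o i
    change Kd k C o i ∘ₗ (Kd k C o (i + 1) ∘ₗ g) = 0
    rw [← LinearMap.comp_assoc, this, LinearMap.zero_comp]

theorem homKaug_eq_zero_iff (hA : IsCompleteSum k C c r) (f : HomK k C c r p 0) : homKaug k C c r p f = 0 ↔
    ∀ s m, IsUnitDegree C (c s.1) p m → (coord (KzeroTo k C p ∘ₗ f) s).coeff m = 0 := by
  rw [← mem_projRadical_iff hA]
  exact Submodule.Quotient.mk_eq_zero _

/-- In the degrees of isomorphisms only the open cell contributes, and the augmentation detects
exactly its coefficients there. In the other degrees every element of the term of degree zero is a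
boundary. -/
theorem exact_homKd_zero (hA : IsCompleteSum k C c r) (o : ∀ (i : ℕ) (τ : Cell C p i), CellOrientation τ.1) :
    Function.Exact (homKd k C c r o 0) (homKaug k C c r p) := by
  intro f
  rw [homKaug_eq_zero_iff hA]
  constructor
  · intro hf
    refine exists_homKd_eq o f fun s m => ?_
    by_cases hle : ∀ n : C.normals, ⌈n.1 p⌉ ≤ ⌈n.1 (m + c s.1)⌉
    · by_cases hne : ∃ n : C.normals, ⌈n.1 p⌉ ≠ ⌈n.1 (m + c s.1)⌉
      · exact exists_Kcoeff_preimage k o hle hne _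
          (fun τ => coord_eq_zero_of_not_admissible f τ) fun j hj => by omega
      · push Not at hne
        refine ⟨0, by simp, fun τ => ?_⟩
        have := hf s m (isUnitDegree_iff.2 hne)
        rw [coord_KzeroTo_comp, Fintype.sum_subsingleton _ τ] at this
        rw [this]
        simp
    · refine ⟨0, by simp, fun τ => ?_⟩
      rw [coord_eq_zero_of_not_admissible f τ fun h => hle h.le]
      simp
  · rintro ⟨g, rfl⟩ s m hm
    rw [coord_KzeroTo_comp]
    refine Finset.sum_eq_zero fun τ _ => ?_
    rw [coord_Kd_comp]
    refine Finset.sum_eq_zero fun ρ _ => ?_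
    rw [coord_eq_zero_of_not_admissible g ρ fun h =>
      absurd (ρ.eq_zero_of_admissible (isUnitDegree_iff.1 hm) h) (by omega), mul_zero]

theorem isGradedProjectiveResolution_homK (hA : IsCompleteSum k C c r)
    (o : ∀ (i : ℕ) (τ : Cell C p i), CellOrientation τ.1) :
    IsGradedProjectiveResolution (endGrading (R := ToricRing k C) (conicSumGrading k C c r))
      (homKGrading k C c r p) (homKd k C c r o) (simpleGrading k C c r p)
      (homKaug k C c r p) where
  isResolution :=
    { projective := projective_homK hA p
      surjective := by
        intro x
        obtain ⟨φ, rfl⟩ := (projRadical k C c r p).mkQ_surjective x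
        obtain ⟨g, hg⟩ := exists_KzeroTo_section k C p
        refine ⟨g ∘ₗ φ, ?_⟩
        change (projRadical k C c r p).mkQ (KzeroTo k C p ∘ₗ (g ∘ₗ φ)) = _
        rw [← LinearMap.comp_assoc, hg, LinearMap.id_comp]
      exact_zero := exact_homKd_zero hA o
      exact_succ := exact_homKd_succ o }
  ring_graded := isRingGrading_end k C c r
  module_graded := isModuleGrading_homK p
  target_graded := isModuleGrading_simpleMod hA p
  map_mem i g x hx := by
    refine mem_homGrading_piGrading.2 fun τ' => mem_homGrading_iff.2 fun s m hm => ?_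
    change (coord (component (homKd k C c r o i x) τ') s).coeff m ≠ 0 at hm
    rw [coord_Kd_comp] at hm
    obtain ⟨τ, -, hτ⟩ := Finset.exists_ne_zero_of_sum_ne_zero hm
    exact mem_homGrading_iff.1 (mem_homGrading_piGrading.1 hx τ) s m (right_ne_zero_of_mul hτ)
  augmentation_mem g x hx := by
    refine ⟨_, mem_homGrading_iff.2 fun s m hm => ?_, rfl⟩
    change (coord (KzeroTo k C p ∘ₗ x) s).coeff m ≠ 0 at hm
    rw [coord_KzeroTo_comp] at hm
    obtain ⟨τ, -, hτ⟩ := Finset.exists_ne_zero_of_sum_ne_zero hm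
    exact mem_homGrading_iff.1 (mem_homGrading_piGrading.1 hx τ) s m hτ

end

section

/-! ### Comparison of projective resolutions -/

theorem exists_dependent_seq {S : ℕ → Type*} (R : ∀ i, S i → S (i + 1) → Prop) (s₀ : S 0)
    (h : ∀ i s, ∃ s', R i s s') : ∃ s : ∀ i, S i, s 0 = s₀ ∧ ∀ i, R i (s i) (s (i + 1)) := by
  choose next hnext using h
  exact ⟨fun i => Nat.rec s₀ next i, rfl, fun i => hnext i _⟩

section Comparison

variable {Λ : Type*} [Ring Λ]

theorem exists_lift_of_exact {P X Y Z : Type*} [AddCommGroup P] [AddCommGroup X] [AddCommGroup Y]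
    [AddCommGroup Z] [Module Λ P] [Module Λ X] [Module Λ Y] [Module Λ Z] (hP : Module.Projective Λ P)
    {d : X →ₗ[Λ] Y} {e : Y →ₗ[Λ] Z} (hde : Function.Exact d e) {t : P →ₗ[Λ] Y}
    (ht : e ∘ₗ t = 0) : ∃ s : P →ₗ[Λ] X, d ∘ₗ s = t := by
  obtain ⟨s, hs⟩ := Module.projective_lifting_property d.rangeRestrict
    (t.codRestrict (LinearMap.range d) fun x => (hde (t x)).1 (LinearMap.congr_fun ht x))
    d.surjective_rangeRestrict
  exact ⟨s, LinearMap.ext fun x => congrArg Subtype.val (LinearMap.congr_fun hs x)⟩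

variable {P Q : ℕ → Type*} [∀ i, AddCommGroup (P i)] [∀ i, Module Λ (P i)]
  [∀ i, AddCommGroup (Q i)] [∀ i, Module Λ (Q i)]
  {dP : ∀ i, P (i + 1) →ₗ[Λ] P i} {dQ : ∀ i, Q (i + 1) →ₗ[Λ] Q i}
  {S : Type*} [AddCommGroup S] [Module Λ S] {εP : P 0 →ₗ[Λ] S} {εQ : Q 0 →ₗ[Λ] S}

namespace IsProjectiveResolution

theorem d_comp_d (hP : IsProjectiveResolution Λ dP εP) (i : ℕ) : dP i ∘ₗ dP (i + 1) = 0 :=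
  LinearMap.ext fun x => (hP.exact_succ i).apply_apply_eq_zero x

/-- Projective resolutions of the same module are related by chain maps. -/
theorem exists_chainMap (hP : IsProjectiveResolution Λ dP εP)
    (hQ : IsProjectiveResolution Λ dQ εQ) : ∃ f : ∀ i, P i →ₗ[Λ] Q i,
      εQ ∘ₗ f 0 = εP ∧ ∀ i, dQ i ∘ₗ f (i + 1) = f i ∘ₗ dP i := by
  have := hP.projective
  obtain ⟨f0, hf0⟩ := Module.projective_lifting_property εQ εP hQ.surjective
  obtain ⟨f1, hf1⟩ := exists_lift_of_exact (hP.projective 1) hQ.exact_zero (t := f0 ∘ₗ dP 0) (by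
    rw [← LinearMap.comp_assoc, hf0]
    exact LinearMap.ext fun x => hP.exact_zero.apply_apply_eq_zero x)
  -- The recursion carries two consecutive maps with their commuting square, which is what the next
  -- lift needs.
  obtain ⟨s, hs0, hs⟩ := exists_dependent_seq
    (S := fun i => {f : (P i →ₗ[Λ] Q i) × (P (i + 1) →ₗ[Λ] Q (i + 1)) //
      dQ i ∘ₗ f.2 = f.1 ∘ₗ dP i}) (fun i f f' => f'.1.1 = f.1.2) ⟨(f0, f1), hf1⟩ (by
    rintro i ⟨⟨f, f'⟩, hf⟩
    obtain ⟨f'', hf''⟩ := exists_lift_of_exact (hP.projective (i + 2)) (hQ.exact_succ i)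
      (t := f' ∘ₗ dP (i + 1)) (by
        rw [← LinearMap.comp_assoc, hf, LinearMap.comp_assoc, hP.d_comp_d, LinearMap.comp_zero])
    exact ⟨⟨(f', f''), hf''⟩, rfl⟩)
  refine ⟨fun i => (s i).1.1, by dsimp only; rw [hs0]; exact hf0, fun i => ?_⟩
  dsimp only
  rw [hs i]
  exact (s i).2

/-- A chain endomorphism that lifts zero is null homotopic. -/
theorem exists_homotopy (hP : IsProjectiveResolution Λ dP εP) {t : ∀ i, P i →ₗ[Λ] P i}
    (h0 : εP ∘ₗ t 0 = 0) (ht : ∀ i, dP i ∘ₗ t (i + 1) = t i ∘ₗ dP i) :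
    ∃ h : ∀ i, P i →ₗ[Λ] P (i + 1),
      ∀ i, t (i + 1) = dP (i + 1) ∘ₗ h (i + 1) + h i ∘ₗ dP i := by
  obtain ⟨h0, hh0⟩ := exists_lift_of_exact (hP.projective 0) hP.exact_zero h0
  -- The condition carried along says that the part of `t` not yet accounted for consists of cycles,
  -- so that it can be lifted.
  obtain ⟨s, -, hs⟩ := exists_dependent_seq
    (S := fun i => {h : P i →ₗ[Λ] P (i + 1) // dP i ∘ₗ (t (i + 1) - h ∘ₗ dP i) = 0})
    (fun i h h' => dP (i + 1) ∘ₗ h'.1 = t (i + 1) - h.1 ∘ₗ dP i)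
    ⟨h0, by rw [LinearMap.comp_sub, ← LinearMap.comp_assoc, hh0, ht, sub_self]⟩ (by
    rintro i ⟨h, hh⟩
    obtain ⟨h', hh'⟩ := exists_lift_of_exact (hP.projective (i + 1)) (hP.exact_succ i) hh
    refine ⟨⟨h', ?_⟩, hh'⟩
    rw [LinearMap.comp_sub, ← LinearMap.comp_assoc, hh', ht, LinearMap.sub_comp,
      LinearMap.comp_assoc, hP.d_comp_d, LinearMap.comp_zero, sub_zero, sub_self])
  exact ⟨fun i => (s i).1, fun i => by rw [hs i, sub_add_cancel]⟩

/-- If `Hom(-, N)` annihilates the differential of a projective resolution, it also annihilates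
the terms beyond the length of any other projective resolution. -/
theorem eq_zero_of_lengthLE (hP : IsProjectiveResolution Λ dP εP)
    (hQ : IsProjectiveResolution Λ dQ εQ) {n : ℕ} (hn : LengthLE Q n)
    {N : Type*} [AddCommGroup N] [Module Λ N]
    (hN : ∀ i (θ : P i →ₗ[Λ] N), θ ∘ₗ dP i = 0) {i : ℕ} (hi : n < i) (α : P i →ₗ[Λ] N) :
    α = 0 := by
  obtain ⟨f, hf0, hf⟩ := hP.exists_chainMap hQ
  obtain ⟨g, hg0, hg⟩ := hQ.exists_chainMap hP
  obtain ⟨h, hh⟩ := hP.exists_homotopy (t := fun i => LinearMap.id - g i ∘ₗ f i)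
    (by rw [LinearMap.comp_sub, ← LinearMap.comp_assoc, hg0, hf0, LinearMap.comp_id, sub_self])
    (fun i => by rw [LinearMap.comp_sub, LinearMap.sub_comp, ← LinearMap.comp_assoc, hg,
      LinearMap.comp_assoc, hf, LinearMap.comp_assoc, LinearMap.comp_id, LinearMap.id_comp])
  obtain ⟨j, rfl⟩ : ∃ j, i = j + 1 := ⟨i - 1, by omega⟩
  have := hn (j + 1) hi
  have h1 : f (j + 1) = 0 := LinearMap.ext fun x => Subsingleton.elim _ _
  -- Beyond the length of `Q` the composite through it is zero, so the identity is a sum of two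
  -- terms through the differential, and `α` kills both.
  have h2 : LinearMap.id = dP (j + 1) ∘ₗ h (j + 1) + h j ∘ₗ dP j := by
    rw [← hh j, h1, LinearMap.comp_zero, sub_zero]
  rw [← LinearMap.comp_id α, h2, LinearMap.comp_add, ← LinearMap.comp_assoc, hN,
    ← LinearMap.comp_assoc, hN, LinearMap.zero_comp, add_zero]

end IsProjectiveResolution

end Comparison

/-! ### Minimality of the resolution -/

section Minimal

variable {E : Type*} [NormedAddCommGroup E] [NormedSpace ℝ E] {M : Submodule ℤ E}
  {k : Type*} [Field k] {C : ToricCone M} {p : E} {ι : Type*} {c : ι → E} {r : ι → ℕ}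

/-- The codimensions differ, so the face is proper and the inclusion is strict at the level of some
wall. -/
theorem exists_index_of_cellModule_le [FiniteDimensional ℝ E] [DiscreteTopology M] [IsZLattice ℝ M]
    {i : ℕ} {τ' : Cell C p i} {τ : Cell C p (i + 1)} (h : cellModule k C τ ≤ cellModule k C τ') :
    ∃ n, τ.index.1 n = 0 ∧ τ'.index.1 n ≠ 0 := by
  by_contra! hcon
  have h1 := (cellModule_le_iff k τ τ').1 h
  have h2 : τ.index = τ'.index := Subtype.ext (funext fun n => by
    by_cases hn : τ.index.1 n = 0
    · rw [hn, hcon n hn]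
    · rw [h1 n hn])
  have h3 := τ.finrank_dir
  have h4 := τ'.finrank_dir
  rw [h2] at h3
  omega

variable [FiniteDimensional ℝ E] [DiscreteTopology M] [IsZLattice ℝ M]

variable (k C p c r) in
/-- The complex ends at the largest codimension of a cell. -/
theorem exists_lengthLE :
    ∃ ℓ : ℕ, LengthLE (HomK k C c r p) ℓ ∧ Nonempty (Cell C p ℓ) := by
  classical
  have h0 : Nonempty (Cell C p 0) := inferInstance
  refine ⟨Nat.findGreatest (fun i => Nonempty (Cell C p i)) (finrank ℝ E), fun i hi => ?_,
    Nat.findGreatest_spec (P := fun i => Nonempty (Cell C p i)) (Nat.zero_le _) h0⟩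
  have h1 : IsEmpty (Cell C p i) := by
    by_contra h
    rw [not_isEmpty_iff] at h
    obtain ⟨τ⟩ := id h
    have := Nat.le_findGreatest (P := fun i => Nonempty (Cell C p i)) (n := finrank ℝ E)
      (by have := τ.2.2; omega) h
    omega
  infer_instance

variable [Fintype ι]

/-- The level inequalities along the composite lose a step at `n` in the strict inclusion, so no
monomial of it can be an isomorphism. -/
theorem comp_inclusion_comp_mem_nonunits {B B' : Submodule (ToricRing k C) (AddMonoidAlgebra k M)}
    {q q' : C.normals → ℤ} (hB : HasLevel B q) (hB' : HasLevel B' q') (h : B ≤ B')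
    {n : C.normals} (hn : q' n < q n) {v v' : E} (hv' : B' = conic k C v')
    (χ : Mod B' →ₗ[ToricRing k C] Mod (conic k C v))
    (ψ : ConicSum k C c r →ₗ[ToricRing k C] Mod B) :
    χ ∘ₗ Mod.inclusion h ∘ₗ ψ ∈ nonunits k C c r v := by
  have hq : ⌈n.1 v'⌉ ≤ q' n := by
    have h1 := hasLevel_conic C k v'
    exact (hB'.le_iff h1).1 hv'.le n
  subst hv'
  intro s m hm
  have h1 : coord (χ ∘ₗ Mod.inclusion h ∘ₗ ψ) = fun s => symbol χ * coord ψ s :=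
    coord_eq fun f => by
      rw [LinearMap.comp_apply, LinearMap.comp_apply, val_eq_symbol_mul, Mod.val_inclusion,
        val_eq_sum_coord, Finset.mul_sum]
      exact Finset.sum_congr rfl fun s _ => (mul_assoc _ _ _).symm
  rw [h1]
  by_contra hne
  obtain ⟨a, b, rfl, ha, hb⟩ := exists_coeff_ne_zero_of_mul hne
  have h2 := level_le_of_symbol_ne_zero (hasLevel_conic C k v) χ ha n
  have h3 := level_le_of_coord_ne_zero hB ψ hb n
  have h4 := hm n
  rw [map_add] at h4
  omega

/-- Since `B'` is a retract of the complete sum, the composite is a multiple of the retraction `f`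
by an endomorphism. Pulled out of `θ` and applied to a lift of `θ f`, this endomorphism gives a map
through the strict inclusion, which lies in the radical. -/
theorem map_inclusion_comp_eq_zero (hA : IsCompleteSum k C c r)
    {B B' : Submodule (ToricRing k C) (AddMonoidAlgebra k M)}
    {q q' : C.normals → ℤ} (hB : HasLevel B q) (hB' : HasLevel B' q') (h : B ≤ B')
    {n : C.normals} (hn : q' n < q n) {v v' : E} (hv' : B' = conic k C v')
    (θ : (ConicSum k C c r →ₗ[ToricRing k C] Mod B') →ₗ[EndRing k C c r] SimpleMod k C c r v)
    (ψ : ConicSum k C c r →ₗ[ToricRing k C] Mod B) : θ (Mod.inclusion h ∘ₗ ψ) = 0 := by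
  obtain ⟨e, f, hfe⟩ := exists_retraction hA hv'
  obtain ⟨x, hx⟩ := (projRadical k C c r v).mkQ_surjective (θ f)
  have h1 : Mod.inclusion h ∘ₗ ψ =
      (MulOpposite.op (e ∘ₗ Mod.inclusion h ∘ₗ ψ) : EndRing k C c r) • f := by
    rw [EndRing.smul_def, MulOpposite.unop_op, ← LinearMap.comp_assoc, hfe, LinearMap.id_comp]
  rw [h1, map_smul, ← hx, ← map_smul, EndRing.smul_def, MulOpposite.unop_op,
    ← LinearMap.comp_assoc]
  refine (Submodule.Quotient.mk_eq_zero _).2 ?_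
  rw [projRadical_eq v (nonunits_ne_top hA v)]
  exact comp_inclusion_comp_mem_nonunits hB hB' h hn hv' (x ∘ₗ e) ψ

/-- Homomorphisms to the graded simple modules annihilate the differential. -/
theorem comp_homKd_eq_zero (hA : IsCompleteSum k C c r)
    (o : ∀ (i : ℕ) (τ : Cell C p i), CellOrientation τ.1) (v : E) {i : ℕ}
    (θ : HomK k C c r p i →ₗ[EndRing k C c r] SimpleMod k C c r v) :
    θ ∘ₗ homKd k C c r o i = 0 := by
  classical
  refine LinearMap.ext fun f => ?_
  let sg : ∀ τ' : Cell C p i, Mod (cellModule k C τ') →ₗ[ToricRing k C] K k C p i := fun τ' =>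
    LinearMap.single (ToricRing k C) (fun τ' : Cell C p i => Mod (cellModule k C τ')) τ'
  have hf : homKd k C c r o i f = ∑ τ' : Cell C p i, ∑ τ : Cell C p (i + 1),
      if h : cellModule k C τ ≤ cellModule k C τ' then
        incidenceSign τ'.1 τ.1 (o i τ') (o (i + 1) τ) •
          (sg τ' ∘ₗ (Mod.inclusion h ∘ₗ component f τ)) else 0 := by
    refine LinearMap.ext fun x => ?_
    change Kd k C o i (f x) = _
    rw [← Finset.univ_sum_single (Kd k C o i (f x)), LinearMap.sum_apply]
    refine Finset.sum_congr rfl fun τ' _ => ?_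
    rw [LinearMap.sum_apply]
    change sg τ' (Kd k C o i (f x) τ') = _
    simp only [Kd, LinearMap.pi_apply, LinearMap.sum_apply, map_sum]
    refine Finset.sum_congr rfl fun τ _ => ?_
    split_ifs with h
    · rw [LinearMap.comp_apply, LinearMap.smul_apply, map_zsmul, LinearMap.smul_apply]
      rfl
    · simp
  rw [LinearMap.comp_apply, hf, map_sum]
  refine Finset.sum_eq_zero fun τ' _ => ?_
  rw [map_sum]
  refine Finset.sum_eq_zero fun τ _ => ?_
  split_ifs with h
  · obtain ⟨n, hn, hn'⟩ := exists_index_of_cellModule_le h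
    obtain ⟨v', hv', -⟩ := exists_openConic_eq_conic C k τ'.point
    rw [map_zsmul]
    have := map_inclusion_comp_eq_zero hA (hasLevel_cellModule k τ) (hasLevel_cellModule k τ') h
      (n := n) (by rw [if_pos hn, if_neg hn']; omega) hv'
      (θ ∘ₗ homMap (ConicSum k C c r) (sg τ')) (component f τ)
    rw [LinearMap.comp_apply] at this
    exact (congrArg _ this).trans (smul_zero _)
  · exact map_zero θ

/-- Project to the summand of `τ`, which is some conic module `A_v`, and on to its simple module.
The first projection splits and the simple module is nonzero. -/
theorem exists_hom_simpleMod_ne_zero (hA : IsCompleteSum k C c r) {i : ℕ} (τ : Cell C p i) :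
    ∃ (v : E) (α : HomK k C c r p i →ₗ[EndRing k C c r] SimpleMod k C c r v), α ≠ 0 := by
  classical
  obtain ⟨v, hv, -⟩ := exists_openConic_eq_conic C k τ.point
  refine ⟨v, (projRadical k C c r v).mkQ ∘ₗ
    homMap (ConicSum k C c r) (Mod.inclusion hv.le ∘ₗ LinearMap.proj τ), fun h0 => ?_⟩
  obtain ⟨y, hy⟩ := (nontrivial_iff_exists_ne 0).1 (isGradedSimple_simpleMod hA v).1
  obtain ⟨x, rfl⟩ := (projRadical k C c r v).mkQ_surjective y
  refine hy ?_
  have h1 := LinearMap.congr_fun h0 (LinearMap.single (ToricRing k C)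
    (fun τ' : Cell C p i => Mod (cellModule k C τ')) τ ∘ₗ Mod.inclusion hv.ge ∘ₗ x)
  refine Eq.trans (congrArg _ (LinearMap.ext fun f => Mod.ext ?_)) h1
  change _ = Mod.val ((Pi.single τ (Mod.inclusion hv.ge (x f)) : K k C p i) τ)
  rw [Pi.single_eq_same]
  rfl

end Minimal

end

end ConicModules

end

theorem theorem6p4 {E : Type u} [NormedAddCommGroup E] [NormedSpace ℝ E]
    [FiniteDimensional ℝ E] (M : Submodule ℤ E) [DiscreteTopology M] [IsZLattice ℝ M]
    (k : Type v) [Field k] (C : ToricCone M)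
    {ι : Type x} [Finite ι] (c : ι → E) (r : ι → ℕ) (hA : IsCompleteSum k C c r)
    (p : E) (o : ∀ (i : ℕ) (τ : Cell C p i), CellOrientation τ.1) :
    (∀ i, Kd k C o i ∘ₗ Kd k C o (i + 1) = 0) ∧
    IsGradedSimple (EndRing k C c r) (simpleGrading k C c r p) ∧
    IsGradedProjectiveResolution (endGrading (conicSumGrading k C c r))
      (homKGrading k C c r p) (homKd k C c r o) (simpleGrading k C c r p) (homKaug k C c r p) ∧
    ∃ ℓ : ℕ, LengthLE (HomK k C c r p) ℓ ∧
      ∀ (Q : ℕ → Type w) [∀ i, AddCommGroup (Q i)] [∀ i, Module (EndRing k C c r) (Q i)]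
        (dQ : ∀ i, Q (i + 1) →ₗ[EndRing k C c r] Q i)
        (η : Q 0 →ₗ[EndRing k C c r] SimpleMod k C c r p),
        IsProjectiveResolution (EndRing k C c r) dQ η → ∀ n, LengthLE Q n → ℓ ≤ n := by
  cases nonempty_fintype ι
  have hres := isGradedProjectiveResolution_homK hA o
  obtain ⟨ℓ, hℓ, ⟨τ⟩⟩ := exists_lengthLE k C p c r
  refine ⟨Kd_comp_Kd o, isGradedSimple_simpleMod hA p, hres, ℓ, hℓ, ?_⟩
  intro Q _ _ dQ η hQ n hn
  by_contra! hlt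
  -- A cell of codimension `ℓ` gives a nonzero map from the last term to a graded simple module, in
  -- general not that of `p`; a shorter resolution would force it to vanish.
  obtain ⟨v, α, hα⟩ := exists_hom_simpleMod_ne_zero hA τ
  exact hα (hres.isResolution.eq_zero_of_lengthLE hQ hn
    (fun _ θ => comp_homKd_eq_zero hA o v θ) hlt α)
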